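/- Graphs are finite and connected; parallel edges and self-edges are allowed. The degree of a vertex is the number of edges incident to it, and simple random walk moves at each step along an edge chosen uniformly among the edges incident to its current position. A sequence of graphs $(G_n)$ is called \emph{Gino-regular} if there is a sequence of real numbers $D_n$ such that, as $n \to \infty$, (i) the maximum and the minimum degree of a vertex of $G_n$ are $(1+o(1))D_n$; and (ii) the maximum and the minimum, over triples of distinct vertices $x, y, z$ of $G_n$, of the probability that simple random walk on $G_n$ started at $x$ hits $y$ before $z$ are $1/2 + o(1)$. For a tree $T$ with root $v$, the \emph{$r$-truncation} $T \wedge r$ is the subtree, rooted at $v$, spanned by the vertices at distance at most $r$ from $v$; it is regarded as an abstract rooted tree, that is, up to root-preserving isomorphism. Let $\mathcal P_1$ be the random infinite tree obtained from an infinite line $v_0, v_1, v_2, \dots$, rooted at $v_0$, by attaching to the vertices $v_i$ independent Galton--Watson trees with Poisson(1) offspring distribution, the $i$-th of which has root $v_i$. \textbf{Theorem.} Let $(G_n)$ be a Gino-regular sequence of graphs with $|V(G_n)| \to \infty$, let $v_n$ be a vertex of $G_n$, and let $\mathbf T_n$ be a uniformly chosen spanning tree of $G_n$, rooted at $v_n$.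 Then for every $r \ge 0$, $\mathbf T_n \wedge r$ converges in distribution to $\mathcal P_1 \wedge r$ as $n \to \infty$: for every finite rooted tree $t$ of height at most $r$, $$\mathbf P(\mathbf T_n \wedge r = t) \longrightarrow \mathbf P(\mathcal P_1 \wedge r = t).$$ Here $\mathcal P_1$ is the Poisson(1) Galton--Watson tree $U$ conditioned to survive forever, in the sense that for all such $r$ and $t$ $$\mathbf P(\mathcal P_1 \wedge r = t) = \lim_{N \to \infty} \mathbf P(U \wedge r = t \mid U \text{ survives for at least } N \text{ generations}).$$ -/

import Mathlib

open Filter Topology MeasureTheory ProbabilityTheory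
open scoped Graph

noncomputable section

namespace UST

/-! ### Rooted truncations -/

/-- The `r`-truncation of the graph `T` rooted at `v` (the subgraph spanned by the vertices at
distance at most `r` from `v`, with root `v`) is the abstract rooted graph `(t, x)`: there is a
graph isomorphism onto `t` which matches the roots. -/
def TruncationIs {V W : Type*} (T : SimpleGraph V) (v : V) (r : ℕ)
    (t : SimpleGraph W) (x : W) : Prop :=
  ∃ φ : T.induce {w | T.edist v w ≤ r} ≃g t, ((φ.symm x : {w | T.edist v w ≤ r}) : V) = v

/-! ### Finite multigraphs: degree, connectedness, simple random walk -/

section Multigraph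

variable {α β : Type*}

/-- The degree of a vertex is the number of edges incident to it
(parallel edges are counted separately, a self-edge is counted once). -/
def degree (G : Graph α β) (x : α) : ℕ := (G.incidenceSet x).ncard

/-- Any two vertices are joined by a path of edges, and there is a vertex. -/
def IsConnected (G : Graph α β) : Prop := G.toSimpleGraph.Connected

open Classical in
/-- The endpoint reached by leaving `x` along the edge `e` (`x` itself if `e` is a self-edge). -/
def otherEnd (G : Graph α β) (x : α) (e : β) : α :=
  if h : G.Inc e x then h.other else x

open Classical in
/-- One step of simple random walk: choose uniformly one of the edges incident to the current
position `x` and move to its other end. (The walk stays put if there is no incident edge.) -/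
def srwStep (G : Graph α β) (x : α) : PMF α :=
  if h : (G.incidenceSet x).Finite ∧ (G.incidenceSet x).Nonempty then
    (PMF.uniformOfFinset h.1.toFinset (h.1.toFinset_nonempty.2 h.2)).map (otherEnd G x)
  else PMF.pure x

/-- The joint law of the positions at times `0, 1, …, k` of simple random walk started at `x`. -/
def srwPath (G : Graph α β) : ℕ → α → PMF (List α)
  | 0, x => PMF.pure [x]
  | k + 1, x => (srwStep G x).bind fun y => (srwPath G k y).map fun l => x :: l

/-- The sequence of positions `l` visits `y`, and does so without having visited `z` earlier. -/
def HitsBefore (y z : α) (l : List α) : Prop :=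
  ∃ l₁ l₂ : List α, l = l₁ ++ y :: l₂ ∧ z ∉ l₁

/-- The probability that simple random walk started at `x` hits `y` before `z`: the increasing
limit over `k` of the probabilities that this has happened by time `k`. -/
def hitProb (G : Graph α β) (x y z : α) : ℝ :=
  (⨆ k : ℕ, (srwPath G k x).toOuterMeasure {l | HitsBefore y z l}).toReal

/-! ### Uniform spanning trees -/

/-- The edge set `F` is (the edge set of) a spanning tree of `G`: the subgraph with all the
vertices of `G` and the edges in `F` has no self-edges and no parallel edges, is connected and
has no cycles. -/
def IsSpanningTree (G : Graph α β) (F : Set β) : Prop :=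
  F ⊆ E(G) ∧ (G.restrict F).Simple ∧ (G.restrict F).toSimpleGraph.IsTree

/-- The subgraph of `G` with edge set `F`, on the vertex set of `G`. -/
def subgraphOf (G : Graph α β) (F : Set β) : SimpleGraph V(G) := (G.restrict F).toSimpleGraph

/-- The probability that the `r`-truncation at `v` of a uniformly chosen spanning tree of `G` is
the rooted tree `(t, x)`. -/
def ustTruncProb {W : Type*} (G : Graph α β) (v : V(G)) (r : ℕ) (t : SimpleGraph W) (x : W) : ℝ :=
  ({F : Set β | IsSpanningTree G F ∧ TruncationIs (subgraphOf G F) v r t x}.ncard : ℝ) /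
    ({F : Set β | IsSpanningTree G F}.ncard : ℝ)

end Multigraph

/-- Gino-regularity of a sequence of graphs: for some sequence `D`, all the degrees in `G n` are
`(1 + o(1)) D n`, and the probability of hitting `y` before `z` from `x` is `1/2 + o(1)`,
uniformly over distinct vertices `x, y, z` of `G n`. -/
def IsGinoRegular {α β : ℕ → Type*} (G : ∀ n, Graph (α n) (β n)) : Prop :=
  ∃ D : ℕ → ℝ,
    (∀ ε : ℝ, 0 < ε → ∀ᶠ n in atTop, ∀ x ∈ V(G n), |(degree (G n) x : ℝ) - D n| ≤ ε * D n) ∧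
    (∀ ε : ℝ, 0 < ε → ∀ᶠ n in atTop, ∀ x ∈ V(G n), ∀ y ∈ V(G n), ∀ z ∈ V(G n),
      x ≠ y → x ≠ z → y ≠ z → |hitProb (G n) x y z - 1 / 2| ≤ ε)

/-! ### The Poisson(1) Galton–Watson tree -/

/-- Given the number of children `ξ u` of every potential individual `u`, the set of individuals
that are born. An individual is a finite word: the root is the empty word, and the children of
`u` are `u ++ [k]` for `k < ξ u`. -/
def gwVertices (ξ : List ℕ → ℕ) : Set (List ℕ) :=
  {u | ∀ (w : List ℕ) (k : ℕ), w ++ [k] <+: u → k < ξ w}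

lemma nil_mem_gwVertices (ξ : List ℕ → ℕ) : [] ∈ gwVertices ξ := by
  intro w k h
  simp at h

/-- One of the two words is a child of the other. -/
def ParentChild (u w : List ℕ) : Prop := (∃ k, w = u ++ [k]) ∨ (∃ k, u = w ++ [k])

lemma ParentChild.symm {u w : List ℕ} (h : ParentChild u w) : ParentChild w u := Or.symm h

lemma not_parentChild_self (u : List ℕ) : ¬ ParentChild u u := by
  rintro (⟨k, h⟩ | ⟨k, h⟩) <;> simpa using congrArg List.length h

/-- The family tree. -/
def gwTree (ξ : List ℕ → ℕ) : SimpleGraph (gwVertices ξ) where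
  Adj u w := ParentChild u.1 w.1
  symm := ⟨fun _ _ h => h.symm⟩
  loopless := ⟨fun u h => not_parentChild_self u.1 h⟩

/-- The root of the family tree. -/
def gwRoot (ξ : List ℕ → ℕ) : gwVertices ξ := ⟨[], nil_mem_gwVertices ξ⟩

/-- The `N`-th generation is not empty. -/
def Survives (N : ℕ) (ξ : List ℕ → ℕ) : Prop := ∃ u ∈ gwVertices ξ, u.length = N

/-- All numbers of children are independent and Poisson(1). -/
def gwMeasure : Measure (List ℕ → ℕ) := Measure.infinitePi fun _ => poissonMeasure 1

instance : IsProbabilityMeasure gwMeasure := by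
  unfold gwMeasure
  infer_instance

/-- The conditional probability, given that the Poisson(1) Galton–Watson tree survives for at
least `N` generations, that its `r`-truncation at the root is `(t, x)`. -/
def gwCondTruncProb {W : Type*} (N r : ℕ) (t : SimpleGraph W) (x : W) : ℝ :=
  gwMeasure.real {ξ | Survives N ξ ∧ TruncationIs (gwTree ξ) (gwRoot ξ) r t x} /
    gwMeasure.real {ξ | Survives N ξ}

/-! ### The infinite tree `𝒫₁` -/

/-- The vertices of the tree obtained by pasting the family tree given by `ω i` onto the `i`-th
vertex of an infinite line, for every `i`. -/
def spineVertices (ω : ℕ → List ℕ → ℕ) : Set (ℕ × List ℕ) := {p | p.2 ∈ gwVertices (ω p.1)}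

/-- The tree obtained by pasting, for every `i`, the family tree given by `ω i` onto the `i`-th
vertex of an infinite line (the root of the `i`-th family tree is this vertex). -/
def spineTree (ω : ℕ → List ℕ → ℕ) : SimpleGraph (spineVertices ω) where
  Adj p q := (p.1.1 = q.1.1 ∧ ParentChild p.1.2 q.1.2) ∨
    (p.1.2 = [] ∧ q.1.2 = [] ∧ (q.1.1 = p.1.1 + 1 ∨ p.1.1 = q.1.1 + 1))
  symm := ⟨by
    rintro p q (⟨h, h'⟩ | ⟨h, h', h''⟩)
    · exact Or.inl ⟨h.symm, h'.symm⟩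
    · exact Or.inr ⟨h', h, h''.symm⟩⟩
  loopless := ⟨by
    rintro p (⟨_, h⟩ | ⟨_, _, h⟩)
    · exact not_parentChild_self _ h
    · omega⟩

/-- The root is the first vertex of the line. -/
def spineRoot (ω : ℕ → List ℕ → ℕ) : spineVertices ω := ⟨(0, []), nil_mem_gwVertices (ω 0)⟩

/-- The family trees pasted onto the line are independent Poisson(1) Galton–Watson trees. -/
def spineMeasure : Measure (ℕ → List ℕ → ℕ) := Measure.infinitePi fun _ => gwMeasure

/-- The probability that the `r`-truncation of `𝒫₁` is the rooted tree `(t, x)`. -/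
def p1TruncProb {W : Type*} (r : ℕ) (t : SimpleGraph W) (x : W) : ℝ :=
  spineMeasure.real {ω | TruncationIs (spineTree ω) (spineRoot ω) r t x}

end UST

end

/-! Fix a finite rooted tree `t` of height at most `r` with vertex set `W`, and let `I` be its set
of vertices at depth less than `r`. Call an embedding of `t` into a rooted tree exact if it respects
roots and parents and gives no vertex of `I` a child outside the image (`Fits`). The image of an
exact embedding is the whole ball of radius `r`, so the number of exact embeddings is the number of
automorphisms of `t` if the truncation is `t`, and zero otherwise (`card_fits`). Each of the three
laws is therefore an expected number of exact embeddings divided by `autCard`. That expectation is,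
exactly or in the limit, `e^{-|I|} (|W| - |I|)`, where `|W| - |I|` counts the vertices of `t` at
depth `r`.

For the uniform spanning tree, exact embeddings are counted by inclusion-exclusion over the ways of
attaching `m` further leaves to `I` (`abs_card_fits_sub_le`), so it suffices to know the expected
number of embeddings of any fixed tree with `k + 1` vertices. Spanning trees containing a given copy
correspond to spanning forests rooted at the vertex set `A` of the copy (`sum_wt_of_extends`); the
expectation is a sum over copies of the product of conductances times `Z_A / Z_{v}`, where `Z` is
`forestSum`. The probability that `x` lies in the tree of the root `a` of a random forest is
harmonic off the roots (`reachSum_harmonic`), which ties it to hitting probabilities.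
Gino-regularity makes it nearly `1/2` for two roots; the maximum principle makes it nearly `1/|A|`
for any root set; and deleting a root then gives `Z_A ≈ D m/(m+1) Z_{A ∪ {y}}` with `m = |A|`. This
telescopes to `Z_A / Z_{v} ≈ (k+1)/D^k`. Degrees are close to `D` and single conductances are
negligible, so the products of conductances sum to about `D^k`. Hence the expected number of
embeddings tends to `k + 1` (`tendsto_treeSum`), and `∑ (-1)^m |I|^m (|W|+m)/m! = e^{-|I|} (|W| -
|I|)`.

In the limit trees, an exact embedding amounts to numbering the children of each vertex of `I`,
together with the choice, for `𝒫₁`, of the depth-`r` vertex that ends the spine. The Poisson weights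
`e^{-1}/j!` cancel the numbers of numberings and leave `e^{-|I|}` (`sum_labelling`). For the
conditioned Galton–Watson tree the factor `|W| - |I|` appears because, asymptotically, each
depth-`r` vertex contributes equally to the small probability of long survival. -/

noncomputable section

namespace UST

/-! ### Parent maps -/

section ParentMap

variable {V W : Type*}

/-- `σ` is the parent map of a tree with root `v`: it fixes `v`, and every vertex is carried to
`v` by the iterates of `σ`. -/
structure IsParentMap (σ : V → V) (v : V) : Prop where
  root : σ v = v
  reach : ∀ u, ∃ n, σ^[n] u = v

/-- The graph joining every vertex to its image under `σ`. -/
def parentGraph (σ : V → V) : SimpleGraph V := SimpleGraph.fromRel fun a b => σ a = b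

lemma parentGraph_adj {σ : V → V} {a b : V} :
    (parentGraph σ).Adj a b ↔ a ≠ b ∧ (σ a = b ∨ σ b = a) := by
  simp [parentGraph]

namespace IsParentMap

variable {σ : V → V} {v : V}

lemma iterate_root (h : IsParentMap σ v) (n : ℕ) : σ^[n] v = v :=
  Function.iterate_fixed h.root n

lemma iterate_of_le (h : IsParentMap σ v) {u : V} {m n : ℕ} (hm : σ^[m] u = v) (hmn : m ≤ n) :
    σ^[n] u = v := by
  obtain ⟨k, rfl⟩ := Nat.exists_eq_add_of_le' hmn
  rw [Function.iterate_add_apply, hm, h.iterate_root]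

lemma eq_root_of_iterate_eq (h : IsParentMap σ v) {u : V} {k : ℕ} (hk : 0 < k)
    (hu : σ^[k] u = u) : u = v := by
  obtain ⟨n, hn⟩ := h.reach u
  have h1 : σ^[k * n] u = u := by
    rw [Function.iterate_mul]
    exact Function.iterate_fixed hu n
  rw [← h1]
  exact h.iterate_of_le hn (Nat.le_mul_of_pos_left n hk)

lemma ne_self (h : IsParentMap σ v) {u : V} (hu : u ≠ v) : σ u ≠ u :=
  fun e => hu (h.eq_root_of_iterate_eq one_pos e)

lemma parent_parent_ne (h : IsParentMap σ v) {u : V} (hu : u ≠ v) : σ (σ u) ≠ u :=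
  fun e => hu (h.eq_root_of_iterate_eq two_pos e)

lemma induction (h : IsParentMap σ v) {P : V → Prop} (h0 : P v)
    (hs : ∀ u, u ≠ v → P (σ u) → P u) (u : V) : P u := by
  obtain ⟨n, hn⟩ := h.reach u
  induction n generalizing u with
  | zero => exact (show u = v from hn) ▸ h0
  | succ n ih =>
    by_cases hu : u = v
    · exact hu ▸ h0
    · exact hs u hu (ih _ hn)

lemma connected (h : IsParentMap σ v) : (parentGraph σ).Connected := by
  have key : ∀ u, (parentGraph σ).Reachable u v := by
    refine h.induction (SimpleGraph.Reachable.refl _) fun u hu ih => ?_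
    refine SimpleGraph.Reachable.trans (SimpleGraph.Adj.reachable ?_) ih
    exact parentGraph_adj.2 ⟨(h.ne_self hu).symm, Or.inl rfl⟩
  have : Nonempty V := ⟨v⟩
  exact ⟨fun a b => (key a).trans (key b).symm⟩

/-- A parent map is determined by its root and its graph. -/
lemma eq_of_parentGraph_eq {σ' : V → V} (h : IsParentMap σ v) (h' : IsParentMap σ' v)
    (hG : parentGraph σ = parentGraph σ') : σ = σ' := by
  by_contra hne
  obtain ⟨u, hu⟩ := Function.ne_iff.1 hne
  -- A disagreement at `u` moves up to `σ' u`: the edge to `σ' u` must also come from `σ`, hence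
  -- leads down from `σ' u` to `u` there, while `σ'` does not go back. At the root no disagreement
  -- is possible.
  have step : ∀ u, σ u ≠ σ' u → σ (σ' u) ≠ σ' (σ' u) := by
    intro u hu
    have huv : u ≠ v := by
      rintro rfl
      exact hu (h.root.trans h'.root.symm)
    have hadj : (parentGraph σ).Adj u (σ' u) := by
      rw [hG]
      exact parentGraph_adj.2 ⟨(h'.ne_self huv).symm, Or.inl rfl⟩
    rcases (parentGraph_adj.1 hadj).2 with h1 | h1
    · exact absurd h1 hu
    · rw [h1]
      exact (h'.parent_parent_ne huv).symm
  have all : ∀ n, σ (σ'^[n] u) ≠ σ' (σ'^[n] u) := by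
    intro n
    induction n with
    | zero => exact hu
    | succ n ih => rw [Function.iterate_succ_apply']; exact step _ ih
  obtain ⟨n, hn⟩ := h'.reach u
  exact all n (by rw [hn, h.root, h'.root])

/-- Every edge is `s(u, σ u)` for some `u ≠ v`, so there are at most `|V| - 1` edges; connectedness
gives the converse inequality. -/
lemma isTree [Finite V] (h : IsParentMap σ v) : (parentGraph σ).IsTree := by
  rw [SimpleGraph.isTree_iff_connected_and_card]
  refine ⟨h.connected, le_antisymm ?_ h.connected.card_vert_le_card_edgeSet_add_one⟩
  have hsub : (parentGraph σ).edgeSet ⊆ (fun u => s(u, σ u)) '' {v}ᶜ := by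
    intro e
    induction e with
    | h a b =>
      intro hab
      obtain ⟨hne, h1 | h1⟩ := parentGraph_adj.1 hab
      · refine ⟨a, ?_, by simp [h1]⟩
        rintro rfl
        exact hne (h.root.symm.trans h1)
      · refine ⟨b, ?_, by simp [h1, Sym2.eq_swap]⟩
        rintro rfl
        exact hne (h1.symm.trans h.root)
  have h1 := Set.ncard_le_ncard hsub (Set.toFinite _)
  have h2 := Set.ncard_image_le (s := ({v}ᶜ : Set V)) (f := fun u => s(u, σ u)) (Set.toFinite _)
  have h3 := Set.ncard_add_ncard_compl ({v} : Set V)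
  rw [Set.ncard_singleton] at h3
  rw [Nat.card_coe_set_eq]
  omega

end IsParentMap

/-- A connected graph contains the graph of a parent map that decreases the distance to the
root. -/
lemma exists_isParentMap {T : SimpleGraph V} (hT : T.Connected) (v : V) :
    ∃ σ : V → V, IsParentMap σ v ∧ (∀ u, u ≠ v → T.Adj u (σ u)) ∧
      ∀ u, u ≠ v → T.dist v u = T.dist v (σ u) + 1 := by
  classical
  have key : ∀ u, u ≠ v → ∃ w, T.Adj u w ∧ T.dist v u = T.dist v w + 1 := by
    intro u hu
    obtain ⟨p, hp⟩ := hT.exists_walk_length_eq_dist u v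
    cases p with
    | nil => exact absurd rfl hu
    | cons hadj q =>
      rename_i w
      refine ⟨w, hadj, ?_⟩
      have h1 : T.dist w v ≤ q.length := SimpleGraph.dist_le q
      have h2 : T.dist v u ≤ T.dist v w + 1 := by
        have := hT.dist_triangle (u := v) (v := w) (w := u)
        rw [SimpleGraph.dist_eq_one_iff_adj.2 hadj.symm] at this
        exact this
      rw [SimpleGraph.Walk.length_cons] at hp
      rw [SimpleGraph.dist_comm (u := w)] at h1
      rw [SimpleGraph.dist_comm (u := u)] at hp
      omega
  choose g hg hg' using key
  refine ⟨fun u => if hu : u = v then v else g u hu, ⟨by simp, ?_⟩, ?_, ?_⟩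
  · have : ∀ n u, T.dist v u = n →
        ∃ n, (fun u => if hu : u = v then v else g u hu)^[n] u = v := by
      intro n
      induction n with
      | zero =>
        intro u hu
        exact ⟨0, ((hT.dist_eq_zero_iff).1 hu).symm⟩
      | succ n ih =>
        intro u hu
        have huv : u ≠ v := by
          rintro rfl
          simp at hu
        obtain ⟨m, hm⟩ := ih (g u huv) (by have := hg' u huv; omega)
        exact ⟨m + 1, by rw [Function.iterate_succ_apply, dif_neg huv]; exact hm⟩
    exact fun u => this _ u rfl
  · intro u hu
    simp only [dif_neg hu]
    exact hg u hu
  · intro u hu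
    simp only [dif_neg hu]
    exact hg' u hu

/-- A tree is the graph of a parent map. -/
lemma exists_eq_parentGraph {T : SimpleGraph V} (hT : T.IsTree) (v : V) :
    ∃ σ : V → V, IsParentMap σ v ∧ T = parentGraph σ ∧
      ∀ u, u ≠ v → T.dist v u = T.dist v (σ u) + 1 := by
  obtain ⟨σ, hσ, hadj, hd⟩ := exists_isParentMap hT.1 v
  refine ⟨σ, hσ, ?_, hd⟩
  have hle : parentGraph σ ≤ T := by
    intro a b hab
    obtain ⟨hne, rfl | rfl⟩ := parentGraph_adj.1 hab
    · exact hadj a fun e => hne (by rw [e, hσ.root])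
    · exact (hadj b fun e => hne (by rw [e, hσ.root])).symm
  -- A tree is a minimal connected graph, so its connected subgraph `parentGraph σ` is all of it.
  exact le_antisymm ((SimpleGraph.isTree_iff_minimal_connected.1 hT).2 hσ.connected hle) hle

/-! ### Truncations and embeddings -/

/-- The map `f` embeds the tree with parent map `p` and root `x` into the tree with parent map `σ`
and root `v` in such a way that the vertices in `I` acquire no new children. -/
structure Fits (p : W → W) (x : W) (I : Set W) (σ : V → V) (v : V) (f : W → V) : Prop where
  inj : Function.Injective f
  map_root : f x = v
  map_parent : ∀ w, σ (f w) = f (p w)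
  mem_range : ∀ u, σ u ∈ f '' I → u ∈ Set.range f

/-- The number of automorphisms of a rooted graph. -/
def autCard (t : SimpleGraph W) (x : W) : ℕ := Nat.card {g : t ≃g t // g x = x}

lemma autCard_pos [Finite W] (t : SimpleGraph W) (x : W) : 0 < autCard t x := by
  have : Finite (t ≃g t) :=
    Finite.of_injective (fun g : t ≃g t => (g : W → W)) DFunLike.coe_injective
  have : Nonempty {g : t ≃g t // g x = x} := ⟨⟨SimpleGraph.Iso.refl, rfl⟩⟩
  exact Nat.card_pos

variable {p : W → W} {x : W} {σ : V → V} {v : V} {r : ℕ}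

lemma Fits.adj_iff {I : Set W} {f : W → V}
    (hf : Fits p x I σ v f) (a b : W) :
    (parentGraph σ).Adj (f a) (f b) ↔ (parentGraph p).Adj a b := by
  simp only [parentGraph_adj, hf.map_parent, hf.inj.ne_iff, hf.inj.eq_iff]

/-- An injective homomorphism of rooted trees commutes with the parent maps. -/
lemma map_parent_of_hom (hp : IsParentMap p x) (hσ : IsParentMap σ v) {f : W → V}
    (hinj : Function.Injective f) (hfx : f x = v)
    (hadj : ∀ a b, (parentGraph p).Adj a b → (parentGraph σ).Adj (f a) (f b)) (w : W) :
    σ (f w) = f (p w) := by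
  refine hp.induction (P := fun w => σ (f w) = f (p w)) ?_ ?_ w
  · rw [hfx, hσ.root, hp.root, hfx]
  · intro w hw ih
    have h1 := hadj w (p w) (parentGraph_adj.2 ⟨(hp.ne_self hw).symm, Or.inl rfl⟩)
    rcases (parentGraph_adj.1 h1).2 with h2 | h2
    · exact h2
    -- Otherwise `f w` is the parent of `f (p w)`, and injectivity gives `p (p w) = w`, impossible
    -- off the root.
    · rw [ih] at h2
      exact absurd (hinj h2) (hp.parent_parent_ne hw)

/-- The range of an embedding as in `Fits` is a ball. -/
lemma Fits.range_eq (hp : IsParentMap p x) (hσ : IsParentMap σ v) {f : W → V}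
    (hr : ∀ w, (parentGraph p).dist x w ≤ r)
    (hf : Fits p x {w | (parentGraph p).dist x w < r} σ v f) :
    Set.range f = {w | (parentGraph σ).edist v w ≤ r} := by
  ext u
  constructor
  · rintro ⟨w, rfl⟩
    obtain ⟨q, hq⟩ := hp.connected.exists_walk_length_eq_dist x w
    let F : parentGraph p →g parentGraph σ := ⟨f, fun h => (hf.adj_iff _ _).2 h⟩
    have h1 := SimpleGraph.Walk.edist_le (q.map F)
    rw [SimpleGraph.Walk.length_map, hq] at h1
    have h2 : F x = v := hf.map_root
    rw [h2] at h1
    exact h1.trans (by exact_mod_cast hr w)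
  · intro hu
    -- Walk outwards from the root: a neighbour of an image vertex of depth less than `r` is either
    -- its parent, which is an image, or a child, which `mem_range` puts into the range.
    have key : ∀ n : ℕ, n ≤ r → ∀ u, (parentGraph σ).dist v u = n →
        ∃ w, f w = u ∧ (parentGraph p).dist x w ≤ n := by
      intro n
      induction n with
      | zero =>
        intro _ u hu
        exact ⟨x, by rw [hf.map_root]; exact (hσ.connected.dist_eq_zero_iff).1 hu, by simp⟩
      | succ n ih =>
        intro hn u hu
        obtain ⟨y, hy, hyu⟩ : ∃ y, (parentGraph σ).dist v y = n ∧ (parentGraph σ).Adj y u := by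
          obtain ⟨τ, hτ, h1, h2⟩ := exists_isParentMap hσ.connected v
          have huv : u ≠ v := by
            rintro rfl
            simp at hu
          exact ⟨τ u, by have := h2 u huv; omega, (h1 u huv).symm⟩
        obtain ⟨w, rfl, hw⟩ := ih (by omega) y hy
        have hmem : u ∈ Set.range f := by
          rcases (parentGraph_adj.1 hyu).2 with h | h
          · exact ⟨p w, by rw [← hf.map_parent, h]⟩
          · exact hf.mem_range u ⟨w, by rw [Set.mem_ofPred_eq]; omega, h.symm⟩
        obtain ⟨w', rfl⟩ := hmem
        refine ⟨w', rfl, ?_⟩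
        have hadj := (hf.adj_iff _ _).1 hyu
        have := hp.connected.dist_triangle (u := x) (v := w) (w := w')
        rw [SimpleGraph.dist_eq_one_iff_adj.2 hadj] at this
        omega
    have hd : ((parentGraph σ).dist v u : ℕ∞) ≤ r := by
      rw [(hσ.connected v u).coe_dist_eq_edist]
      exact hu
    obtain ⟨w, hw, -⟩ := key _ (by exact_mod_cast hd) u rfl
    exact ⟨w, hw⟩

/-- Isomorphisms onto the truncation are the same as embeddings as in `Fits`. -/
def fitsEquiv (hp : IsParentMap p x) (hσ : IsParentMap σ v)
    (hr : ∀ w, (parentGraph p).dist x w ≤ r) :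
    {f : W → V // Fits p x {w | (parentGraph p).dist x w < r} σ v f} ≃
      {ψ : parentGraph p ≃g (parentGraph σ).induce {w | (parentGraph σ).edist v w ≤ r} //
        (ψ x : V) = v} where
  toFun f := ⟨⟨Equiv.ofBijective
      (fun w => ⟨f.1 w, (f.2.range_eq hp hσ hr) ▸ Set.mem_range_self w⟩)
      ⟨fun a b h => f.2.inj (congrArg Subtype.val h), fun u => by
        obtain ⟨w, hw⟩ : (u : V) ∈ Set.range f.1 := by
          rw [f.2.range_eq hp hσ hr]
          exact u.2
        exact ⟨w, Subtype.ext hw⟩⟩, fun {a b} => f.2.adj_iff a b⟩, f.2.map_root⟩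
  invFun ψ := ⟨fun w => ψ.1 w, by
    have hinj : Function.Injective fun w => (ψ.1 w : V) :=
      Subtype.val_injective.comp ψ.1.injective
    have hpar := map_parent_of_hom hp hσ hinj ψ.2 fun a b hab => (ψ.1.map_adj_iff).2 hab
    refine ⟨hinj, ψ.2, hpar, ?_⟩
    rintro u ⟨w, hw, hwu⟩
    by_cases huv : u = v
    · exact ⟨x, huv ▸ ψ.2⟩
    have hadj : (parentGraph σ).Adj (ψ.1 w) u :=
      parentGraph_adj.2 ⟨fun e => hσ.ne_self huv (hwu.symm.trans e), Or.inr hwu.symm⟩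
    -- Embeddings do not increase distances, so a child of the image of a vertex of depth less than
    -- `r` is still in the ball, hence in the range of `ψ`.
    have hdist : (parentGraph σ).edist v (ψ.1 w) ≤ (parentGraph p).dist x w := by
      obtain ⟨q, hq⟩ := hp.connected.exists_walk_length_eq_dist x w
      let F : parentGraph p →g parentGraph σ :=
        ⟨fun w => (ψ.1 w : V), fun h => (ψ.1.map_adj_iff).2 h⟩
      have h1 := SimpleGraph.Walk.edist_le (q.map F)
      rw [SimpleGraph.Walk.length_map, hq] at h1
      have h2 : F x = v := ψ.2
      rw [h2] at h1
      exact h1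
    have hmem : (parentGraph σ).edist v u ≤ r := by
      have h1 := SimpleGraph.edist_triangle (G := parentGraph σ) (u := v) (v := (ψ.1 w : V)) (w := u)
      rw [SimpleGraph.edist_eq_one_iff_adj.2 hadj] at h1
      refine h1.trans ((add_le_add_left hdist 1).trans ?_)
      have : (parentGraph p).dist x w + 1 ≤ r := hw
      exact_mod_cast this
    exact ⟨ψ.1.symm ⟨u, hmem⟩, by simp⟩⟩
  left_inv f := rfl
  right_inv ψ := by
    ext
    rfl

open Classical in
/-- The number of embeddings as in `Fits` is the number of automorphisms or zero. -/
lemma card_fits (hp : IsParentMap p x) (hσ : IsParentMap σ v)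
    (hr : ∀ w, (parentGraph p).dist x w ≤ r) :
    Nat.card {f : W → V // Fits p x {w | (parentGraph p).dist x w < r} σ v f} =
      if TruncationIs (parentGraph σ) v r (parentGraph p) x then autCard (parentGraph p) x
      else 0 := by
  rw [Nat.card_congr (fitsEquiv hp hσ hr)]
  split_ifs with h
  · obtain ⟨φ, hφ⟩ := h
    -- Composition with one fixed isomorphism `φ` turns exact embeddings into root-preserving
    -- automorphisms.
    refine Nat.card_congr ⟨fun ψ => ⟨ψ.1.trans φ, ?_⟩, fun g => ⟨g.1.trans φ.symm, ?_⟩, ?_, ?_⟩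
    · have : ψ.1 x = φ.symm x := Subtype.ext (ψ.2.trans hφ.symm)
      simp [this]
    · simp [g.2, hφ]
    · intro ψ
      ext
      simp
    · intro g
      ext
      simp
  · have : IsEmpty {ψ : parentGraph p ≃g (parentGraph σ).induce
        {w | (parentGraph σ).edist v w ≤ r} // (ψ x : V) = v} :=
      ⟨fun ψ => h ⟨ψ.1.symm, ψ.2⟩⟩
    exact Nat.card_of_isEmpty

end ParentMap

/-! ### Rooted spanning forests of a finite network -/

section Forest

open scoped Classical

variable {V : Type*}

/-- The orbit of `x` under `σ` visits `a`. -/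
def Reach (σ : V → V) (x a : V) : Prop := ∃ n, σ^[n] x = a

lemma Reach.refl (σ : V → V) (x : V) : Reach σ x x := ⟨0, rfl⟩

lemma Reach.single (σ : V → V) (x : V) : Reach σ x (σ x) := ⟨1, rfl⟩

lemma Reach.trans {σ : V → V} {x y z : V} (h : Reach σ x y) (h' : Reach σ y z) :
    Reach σ x z := by
  obtain ⟨m, rfl⟩ := h
  obtain ⟨n, rfl⟩ := h'
  exact ⟨n + m, Function.iterate_add_apply _ _ _ _⟩

lemma Reach.of_fixed {σ : V → V} {x y b : V} (hb : σ b = b) (h : Reach σ x y)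
    (h' : Reach σ x b) : Reach σ y b := by
  obtain ⟨m, rfl⟩ := h
  obtain ⟨n, hn⟩ := h'
  refine ⟨n, ?_⟩
  rw [← Function.iterate_add_apply, add_comm, Function.iterate_add_apply, hn,
    Function.iterate_fixed hb]

lemma Reach.eq_of_fixed {σ : V → V} {x b : V} (hb : σ b = b) (h : Reach σ b x) : x = b := by
  obtain ⟨n, rfl⟩ := h
  exact Function.iterate_fixed hb n

lemma Reach.unique {σ : V → V} {x a b : V} (ha : σ a = a) (hb : σ b = b) (h : Reach σ x a)
    (h' : Reach σ x b) : a = b :=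
  ((h.of_fixed hb h').eq_of_fixed ha).symm

lemma iterate_update_of_not_reach {σ : V → V} {y z w : V} (h : ¬ Reach σ y z) (n : ℕ) :
    (Function.update σ z w)^[n] y = σ^[n] y := by
  induction n with
  | zero => rfl
  | succ n ih =>
    rw [Function.iterate_succ_apply', Function.iterate_succ_apply', ih,
      Function.update_of_ne fun e => h ⟨n, e⟩]

lemma reach_update_iff_of_not_reach {σ : V → V} {y z w u : V} (h : ¬ Reach σ y z) :
    Reach (Function.update σ z w) y u ↔ Reach σ y u := by
  simp only [Reach, iterate_update_of_not_reach h]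

lemma Reach.update {σ : V → V} {y z w : V} (h : Reach σ y z) :
    Reach (Function.update σ z w) y z := by
  obtain ⟨n, hn⟩ := h
  induction n generalizing y with
  | zero => exact ⟨0, hn⟩
  | succ n ih =>
    by_cases hy : y = z
    · exact ⟨0, hy⟩
    · refine Reach.trans ⟨1, ?_⟩ (ih hn)
      exact Function.update_of_ne hy _ _

/-- `σ` maps every vertex outside `A` to its parent in a spanning forest with set of roots `A`. -/
structure IsForest (A : Finset V) (σ : V → V) : Prop where
  fixed : ∀ x ∈ A, σ x = x
  reach : ∀ x, ∃ a ∈ A, Reach σ x a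

namespace IsForest

variable {A B : Finset V} {σ : V → V} {z w : V}

/-- A return to `z` would make `z` periodic, but its orbit is absorbed by a root and `z` is not a
root. -/
lemma not_reach_parent (h : IsForest A σ) (hz : z ∉ A) : ¬ Reach σ (σ z) z := by
  rintro ⟨n, hn⟩
  obtain ⟨a, ha, m, hm⟩ := h.reach z
  have h1 : σ^[(n + 1) * m] z = z := by
    rw [Function.iterate_mul]
    exact Function.iterate_fixed (f := σ^[n + 1]) hn m
  have h2 : (n + 1) * m = n * m + m := by ring
  rw [h2, Function.iterate_add_apply, hm, Function.iterate_fixed (h.fixed a ha)] at h1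
  exact hz (h1 ▸ ha)

lemma ne_insert (hz : z ∉ B) {b : V} (hb : b ∈ B) : b ≠ z := fun e => hz (e ▸ hb)

lemma update_self (h : IsForest B σ) : IsForest (insert z B) (Function.update σ z z) := by
  constructor
  · intro x hx
    by_cases hxz : x = z
    · rw [hxz, Function.update_self]
    · rw [Function.update_of_ne hxz]
      exact h.fixed x (Finset.mem_of_mem_insert_of_ne hx hxz)
  · intro x
    by_cases hx : Reach σ x z
    · exact ⟨z, Finset.mem_insert_self _ _, hx.update⟩
    · obtain ⟨a, ha, hr⟩ := h.reach x
      exact ⟨a, Finset.mem_insert_of_mem ha, (reach_update_iff_of_not_reach hx).2 hr⟩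

lemma not_reach_update_self (h : IsForest B σ) (hz : z ∉ B) :
    ¬ Reach (Function.update σ z z) (σ z) z := by
  rw [reach_update_iff_of_not_reach (h.not_reach_parent hz)]
  exact h.not_reach_parent hz

/-- Reaching an old root after a root `z` has been attached to `w`. -/
lemma reach_update_iff (h : IsForest (insert z B) σ) (hz : z ∉ B) (hw : ¬ Reach σ w z)
    {u b : V} (hb : b ∈ B) :
    Reach (Function.update σ z w) u b ↔ Reach σ u b ∨ (Reach σ u z ∧ Reach σ w b) := by
  have hbf : σ b = b := h.fixed b (Finset.mem_insert_of_mem hb)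
  have hzf : σ z = z := h.fixed z (Finset.mem_insert_self _ _)
  have hbz : b ≠ z := ne_insert hz hb
  by_cases hu : Reach σ u z
  · have h1 : ¬ Reach σ u b := fun h' => hbz (h'.unique hbf hzf hu)
    have hbf' : Function.update σ z w b = b := by rw [Function.update_of_ne hbz, hbf]
    have huw : Reach (Function.update σ z w) u w :=
      hu.update.trans ⟨1, by simp⟩
    simp only [h1, hu, false_or, true_and]
    rw [← reach_update_iff_of_not_reach (w := w) hw]
    exact ⟨fun h' => huw.of_fixed hbf' h', fun h' => huw.trans h'⟩
  · simp only [hu, false_and, or_false]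
    exact reach_update_iff_of_not_reach hu

lemma update (h : IsForest (insert z B) σ) (hz : z ∉ B) (hw : ¬ Reach σ w z) :
    IsForest B (Function.update σ z w) := by
  refine ⟨fun x hx => ?_, fun x => ?_⟩
  · rw [Function.update_of_ne (ne_insert hz hx)]
    exact h.fixed x (Finset.mem_insert_of_mem hx)
  · obtain ⟨a, ha, hr⟩ := h.reach x
    obtain ⟨b, hb, hr'⟩ := h.reach w
    have hbB : b ∈ B := Finset.mem_of_mem_insert_of_ne hb fun e => hw (e ▸ hr')
    by_cases haz : a = z
    · subst haz
      exact ⟨b, hbB, (h.reach_update_iff hz hw hbB).2 (Or.inr ⟨hr, hr'⟩)⟩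
    · have haB := Finset.mem_of_mem_insert_of_ne ha haz
      exact ⟨a, haB, (h.reach_update_iff hz hw haB).2 (Or.inl hr)⟩

lemma isParentMap {v : V} (h : IsForest {v} σ) : IsParentMap σ v :=
  ⟨h.fixed v (Finset.mem_singleton_self v), fun u => by
    obtain ⟨a, ha, hr⟩ := h.reach u
    rwa [Finset.mem_singleton.1 ha] at hr⟩

lemma reach_iff_eq {a x : V} (h : IsForest A σ) (hx : x ∈ A) : Reach σ x a ↔ a = x :=
  ⟨fun h' => h'.eq_of_fixed (h.fixed x hx), fun e => e ▸ Reach.refl _ _⟩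

end IsForest

lemma IsParentMap.isForest {σ : V → V} {v : V} (h : IsParentMap σ v) : IsForest {v} σ :=
  ⟨fun x hx => by rw [Finset.mem_singleton.1 hx, h.root],
    fun x => ⟨v, Finset.mem_singleton_self v, h.reach x⟩⟩

lemma isForest_singleton_iff {σ : V → V} {v : V} : IsForest {v} σ ↔ IsParentMap σ v :=
  ⟨IsForest.isParentMap, IsParentMap.isForest⟩

/-- Symmetric conductances, positive along the edges of some spanning tree. -/
structure IsNetwork (c : V → V → ℝ) : Prop where
  nonneg : ∀ x y, 0 ≤ c x y
  symm : ∀ x y, c x y = c y x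
  self : ∀ x, c x x = 0
  conn : ∀ v, ∃ σ, IsParentMap σ v ∧ ∀ u, u ≠ v → 0 < c u (σ u)

/-- Freezing the vertices of `A` in a tree rooted at one of them leaves a forest with roots `A` that
still uses only positive conductances. -/
lemma IsNetwork.exists_forest {c : V → V → ℝ} (hc : IsNetwork c) {A : Finset V} (hA : A.Nonempty) :
    ∃ σ, IsForest A σ ∧ ∀ u, u ∉ A → 0 < c u (σ u) := by
  obtain ⟨v, hv⟩ := hA
  obtain ⟨σ, hσ, hpos⟩ := hc.conn v
  refine ⟨fun u => if u ∈ A then u else σ u, ⟨fun x hx => if_pos hx, ?_⟩, ?_⟩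
  · refine hσ.induction ⟨v, hv, Reach.refl _ _⟩ fun u _ ⟨a, ha, hr⟩ => ?_
    by_cases hu : u ∈ A
    · exact ⟨u, hu, Reach.refl _ _⟩
    · exact ⟨a, ha, Reach.trans ⟨1, if_neg hu⟩ hr⟩
  · intro u hu
    simp only [if_neg hu]
    exact hpos u fun e => hu (e ▸ hv)

variable [Fintype V] (c : V → V → ℝ)

/-- The spanning forests with set of roots `A`. -/
def forests (A : Finset V) : Finset (V → V) := {σ | IsForest A σ}

lemma mem_forests {A : Finset V} {σ : V → V} : σ ∈ forests A ↔ IsForest A σ := by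
  simp [forests]

/-- The weight of a spanning forest: the product of the conductances of its edges. -/
def wt (A : Finset V) (σ : V → V) : ℝ := ∏ x ∈ Aᶜ, c x (σ x)

/-- The total weight of the spanning forests with set of roots `A`. -/
def forestSum (A : Finset V) : ℝ := ∑ σ ∈ forests A, wt c A σ

/-- The total weight of the spanning forests with set of roots `A` in which `x` belongs to the
tree of `a`. -/
def reachSum (A : Finset V) (a x : V) : ℝ :=
  ∑ σ ∈ forests A, wt c A σ * if Reach σ x a then 1 else 0

/-- The total conductance at a vertex. -/
def deg (x : V) : ℝ := ∑ y, c x y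

lemma wt_update {B : Finset V} {z : V} (hz : z ∉ B) (σ : V → V) (w : V) :
    wt c B (Function.update σ z w) = wt c (insert z B) σ * c z w := by
  have h : Bᶜ = insert z (insert z B)ᶜ := by
    ext x
    by_cases hx : x = z <;> simp [hx, hz]
  rw [wt, wt, h, Finset.prod_insert (by simp), Function.update_self, mul_comm]
  congr 1
  refine Finset.prod_congr rfl fun x hx => ?_
  have : x ≠ z := by
    rintro rfl
    simp at hx
  rw [Function.update_of_ne this]

/-- Decomposition of a forest according to the parent of `z`. -/
lemma sum_forests_split {B : Finset V} {z : V} (hz : z ∉ B) (φ : (V → V) → ℝ) :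
    ∑ σ ∈ forests B, wt c B σ * φ σ =
      ∑ σ ∈ forests (insert z B), ∑ w ∈ {w | ¬ Reach σ w z},
        wt c (insert z B) σ * c z w * φ (Function.update σ z w) := by
  rw [Finset.sum_sigma']
  -- Cutting the edge above `z` turns `z` into a root; the forest is recovered from the result and
  -- the former parent of `z`, which can be any vertex outside the tree of `z`.
  refine Finset.sum_bij' (fun σ _ => ⟨Function.update σ z z, σ z⟩)
    (fun q _ => Function.update q.1 z q.2) ?_ ?_ ?_ ?_ ?_
  · intro σ hσ
    rw [mem_forests] at hσ
    simp only [Finset.mem_sigma, mem_forests, Finset.mem_filter, Finset.mem_univ, true_and]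
    exact ⟨hσ.update_self, hσ.not_reach_update_self hz⟩
  · rintro ⟨σ, w⟩ hq
    simp only [Finset.mem_sigma, mem_forests, Finset.mem_filter, Finset.mem_univ, true_and] at hq
    exact mem_forests.2 (hq.1.update hz hq.2)
  · intro σ _
    simp
  · rintro ⟨σ, w⟩ hq
    simp only [Finset.mem_sigma, mem_forests] at hq
    have hzz : Function.update σ z z = σ := by
      rw [Function.update_eq_self_iff, hq.1.fixed z (Finset.mem_insert_self _ _)]
    simp [hzz]
  · intro σ _
    simp only [Function.update_idem, Function.update_eq_self]
    congr 1
    have := wt_update c hz (Function.update σ z z) (σ z)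
    simpa using this

/-- The reaching weights are harmonic off the roots. -/
lemma reachSum_harmonic {B : Finset V} {z b : V} (hz : z ∉ B) (hb : b ∈ B) :
    ∑ w, c z w * (reachSum c B b z - reachSum c B b w) = 0 := by
  have h1 : ∀ u, reachSum c B b u = ∑ σ ∈ forests (insert z B), ∑ w₀ ∈ {w | ¬ Reach σ w z},
      wt c (insert z B) σ * c z w₀ *
        if Reach (Function.update σ z w₀) u b then 1 else 0 :=
    fun u => sum_forests_split c hz _
  simp only [h1, ← Finset.sum_sub_distrib, Finset.mul_sum]
  rw [Finset.sum_comm]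
  refine Finset.sum_eq_zero fun σ hσ => ?_
  rw [mem_forests] at hσ
  have hzf : σ z = z := hσ.fixed z (Finset.mem_insert_self _ _)
  have hbf : σ b = b := hσ.fixed b (Finset.mem_insert_of_mem hb)
  have hbz : b ≠ z := IsForest.ne_insert hz hb
  have hnz : ¬ Reach σ z b := fun h => hbz (h.eq_of_fixed hzf)
  -- If `w` lies in the tree of `z`, it reaches `b` exactly when the new parent `w₀` of `z` does,
  -- and the difference vanishes. Otherwise the root of `w` does not depend on `w₀`.
  have key : ∀ w, ∀ w₀ ∈ ({w | ¬ Reach σ w z} : Finset V),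
      c z w * (wt c (insert z B) σ * c z w₀ *
          (if Reach (Function.update σ z w₀) z b then 1 else 0) -
        wt c (insert z B) σ * c z w₀ *
          if Reach (Function.update σ z w₀) w b then 1 else 0) =
      wt c (insert z B) σ * (c z w * c z w₀ * if ¬ Reach σ w z then
        ((if Reach σ w₀ b then (1 : ℝ) else 0) - if Reach σ w b then 1 else 0) else 0) := by
    intro w w₀ hw₀
    have hw₀' : ¬ Reach σ w₀ z := by simpa using hw₀
    rw [show Reach (Function.update σ z w₀) z b ↔ Reach σ w₀ b by
      rw [hσ.reach_update_iff hz hw₀' hb]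
      simp [hnz, Reach.refl], hσ.reach_update_iff hz hw₀' hb]
    by_cases hw : Reach σ w z
    · have : ¬ Reach σ w b := fun h => hbz (h.unique hbf hzf hw)
      simp [hw, this]
    · simp only [hw, false_and, or_false, not_false_eq_true, if_true]
      ring
  rw [Finset.sum_congr rfl fun w _ => Finset.sum_congr rfl (key w)]
  simp only [← Finset.mul_sum]
  rw [mul_eq_zero]
  right
  have h2 : ∀ w, (∑ w₀ ∈ {w | ¬ Reach σ w z}, c z w * c z w₀ * if ¬ Reach σ w z then
        ((if Reach σ w₀ b then (1 : ℝ) else 0) - if Reach σ w b then 1 else 0) else 0) =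
      if ¬ Reach σ w z then ∑ w₀ ∈ {w | ¬ Reach σ w z}, c z w * c z w₀ *
        ((if Reach σ w₀ b then (1 : ℝ) else 0) - if Reach σ w b then 1 else 0) else 0 := by
    intro w
    split_ifs <;> simp
  rw [Finset.sum_congr rfl fun w _ => h2 w, ← Finset.sum_filter]
  simp only [mul_sub, Finset.sum_sub_distrib]
  -- Both `w` and `w₀` now range over the vertices outside the tree of `z`, and the summand changes
  -- sign when they are exchanged.
  rw [sub_eq_zero, Finset.sum_comm]
  refine Finset.sum_congr rfl fun w _ => Finset.sum_congr rfl fun w₀ _ => ?_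
  ring

/-- Every vertex belongs to the tree of one root. -/
lemma sum_reachSum (A : Finset V) (x : V) : ∑ a ∈ A, reachSum c A a x = forestSum c A := by
  simp only [reachSum]
  rw [Finset.sum_comm, forestSum]
  refine Finset.sum_congr rfl fun σ hσ => ?_
  rw [mem_forests] at hσ
  obtain ⟨a, ha, hr⟩ := hσ.reach x
  rw [← Finset.mul_sum, Finset.sum_eq_single a, if_pos hr, mul_one]
  · intro b hb hba
    rw [if_neg fun h => hba (h.unique (hσ.fixed b hb) (hσ.fixed a ha) hr)]
  · exact fun h => absurd ha h

lemma reachSum_root {A : Finset V} {a x : V} (hx : x ∈ A) :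
    reachSum c A a x = if a = x then forestSum c A else 0 := by
  rw [reachSum]
  have : ∀ σ ∈ forests A, (wt c A σ * if Reach σ x a then (1 : ℝ) else 0) =
      if a = x then wt c A σ else 0 := by
    intro σ hσ
    rw [(mem_forests.1 hσ).reach_iff_eq hx]
    split_ifs <;> simp
  rw [Finset.sum_congr rfl this]
  split_ifs <;> simp [forestSum]

/-- Removing one root. -/
lemma forestSum_eq {A : Finset V} {y : V} (hy : y ∉ A) :
    forestSum c A = ∑ z, c y z * (forestSum c (insert y A) - reachSum c (insert y A) y z) := by
  -- The former root `y` is attached to some `z` outside its own tree; the forests that forbid this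
  -- `z` are those counted by `reachSum`.
  have h := sum_forests_split c hy fun _ => 1
  simp only [mul_one] at h
  rw [forestSum, h]
  simp only [forestSum, reachSum, ← Finset.sum_sub_distrib, Finset.mul_sum]
  rw [Finset.sum_comm]
  refine Finset.sum_congr rfl fun σ _ => ?_
  rw [Finset.sum_filter]
  refine Finset.sum_congr rfl fun w _ => ?_
  by_cases hw : Reach σ w y
  · simp [hw]
  · simp [hw]
    ring

variable {c}

lemma wt_nonneg (hc : IsNetwork c) (A : Finset V) (σ : V → V) : 0 ≤ wt c A σ :=
  Finset.prod_nonneg fun _ _ => hc.nonneg _ _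

lemma forestSum_pos (hc : IsNetwork c) {A : Finset V} (hA : A.Nonempty) : 0 < forestSum c A := by
  obtain ⟨σ, hσ, hpos⟩ := hc.exists_forest hA
  refine Finset.sum_pos' (fun σ _ => wt_nonneg hc A σ) ⟨σ, mem_forests.2 hσ, ?_⟩
  exact Finset.prod_pos fun x hx => hpos x (Finset.mem_compl.1 hx)

/-- The maximum principle. -/
lemma IsNetwork.le_of_harmonic (hc : IsNetwork c) {A : Finset V} (hA : A.Nonempty) {g : V → ℝ}
    (hg : ∀ z, z ∉ A → ∑ w, c z w * (g z - g w) = 0) {ε : ℝ} (hε : ∀ a ∈ A, g a ≤ ε) (x : V) :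
    g x ≤ ε := by
  obtain ⟨σ, hσ, hpos⟩ := hc.exists_forest hA
  obtain ⟨m, -, hm⟩ := Finset.exists_max_image Finset.univ g ⟨x, Finset.mem_univ x⟩
  -- At a maximum off `A` harmonicity is a vanishing sum of nonnegative terms, so the maximum passes
  -- along every positive conductance; the forest leads it into `A`.
  have step : ∀ u, g u = g m → g (σ u) = g m := by
    intro u hu
    by_cases huA : u ∈ A
    · rw [hσ.fixed u huA, hu]
    · have h0 := hg u huA
      rw [Finset.sum_eq_zero_iff_of_nonneg] at h0
      · have h1 := h0 (σ u) (Finset.mem_univ _)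
        rcases mul_eq_zero.1 h1 with h2 | h2
        · exact absurd h2 (hpos u huA).ne'
        · linarith
      · intro w _
        refine mul_nonneg (hc.nonneg _ _) ?_
        rw [hu]
        linarith [hm w (Finset.mem_univ w)]
  have all : ∀ n, g (σ^[n] m) = g m := by
    intro n
    induction n with
    | zero => rfl
    | succ n ih => rw [Function.iterate_succ_apply']; exact step _ ih
  obtain ⟨a, ha, n, hn⟩ := hσ.reach m
  have h1 := all n
  rw [hn] at h1
  linarith [hm x (Finset.mem_univ x), hε a ha]

/-- The forests extending a given tree, embedded by `f`. -/
lemma sum_wt_of_extends {S : Type*} [Fintype S] {p : S → S} {x : S} (hp : IsParentMap p x)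
    {f : S → V} (hf : Function.Injective f) :
    (∑ σ ∈ forests {f x}, if ∀ s, σ (f s) = f (p s) then wt c {f x} σ else 0) =
      (∏ s ∈ Finset.univ.erase x, c (f s) (f (p s))) * forestSum c (Finset.univ.image f) := by
  have hmem : ∀ u, u ∈ Finset.univ.image f ↔ ∃ s, f s = u := fun u => by simp
  rw [← Finset.sum_filter, forestSum, Finset.mul_sum]
  -- Erasing the edges of the copy makes all its vertices roots. Conversely, giving the image
  -- vertices the parents dictated by `p` joins all the trees of a forest into one tree rooted at `f
  -- x`.
  refine Finset.sum_bij' (fun σ _ u => if u ∈ Finset.univ.image f then u else σ u)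
    (fun σ _ u => if h : ∃ s, f s = u then f (p h.choose) else σ u) ?_ ?_ ?_ ?_ ?_
  · intro σ hσ
    simp only [Finset.mem_filter, mem_forests] at hσ
    rw [mem_forests]
    refine ⟨fun u hu => if_pos hu, ?_⟩
    refine hσ.1.isParentMap.induction ⟨f x, by simp, Reach.refl _ _⟩ ?_
    rintro u - ⟨a, ha, hr⟩
    by_cases hu : u ∈ Finset.univ.image f
    · exact ⟨u, hu, Reach.refl _ _⟩
    · exact ⟨a, ha, Reach.trans ⟨1, if_neg hu⟩ hr⟩
  · intro σ hσ
    rw [mem_forests] at hσ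
    have hfs : ∀ s, (fun u => if h : ∃ s, f s = u then f (p h.choose) else σ u) (f s) =
        f (p s) := by
      intro s
      have h : ∃ s', f s' = f s := ⟨s, rfl⟩
      simp only [dif_pos h]
      rw [hf h.choose_spec]
    simp only [Finset.mem_filter, mem_forests]
    refine ⟨isForest_singleton_iff.2 ⟨(hfs x).trans (by rw [hp.root]), ?_⟩, hfs⟩
    have hr : ∀ s, Reach (fun u => if h : ∃ s, f s = u then f (p h.choose) else σ u)
        (f s) (f x) := by
      refine hp.induction (Reach.refl _ _) fun s _ ih => ?_
      exact Reach.trans ⟨1, hfs s⟩ ih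
    intro u
    obtain ⟨a, ha, n, hn⟩ := hσ.reach u
    induction n generalizing u with
    | zero =>
      obtain ⟨s, hs⟩ := (hmem a).1 ha
      rw [Function.iterate_zero, id] at hn
      rw [hn, ← hs]
      exact hr s
    | succ n ih =>
      by_cases hu : ∃ s, f s = u
      · obtain ⟨s, rfl⟩ := hu
        exact hr s
      · exact Reach.trans ⟨1, dif_neg hu⟩ (ih (σ u) hn)
  · intro σ hσ
    simp only [Finset.mem_filter] at hσ
    funext u
    by_cases hu : ∃ s, f s = u
    · rw [dif_pos hu, ← hσ.2, hu.choose_spec]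
    · rw [dif_neg hu]
      exact if_neg fun h => hu ((hmem u).1 h)
  · intro σ hσ
    rw [mem_forests] at hσ
    funext u
    by_cases hu : u ∈ Finset.univ.image f
    · rw [if_pos hu, hσ.fixed u hu]
    · rw [if_neg hu]
      exact dif_neg fun h => hu ((hmem u).2 h)
  · intro σ hσ
    simp only [Finset.mem_filter] at hσ
    have h1 : ({f x} : Finset V)ᶜ = (Finset.univ.erase x).image f ∪ (Finset.univ.image f)ᶜ := by
      ext u
      simp only [Finset.mem_compl, Finset.mem_singleton, Finset.mem_union, Finset.mem_image,
        Finset.mem_erase, Finset.mem_univ, and_true, true_and]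
      constructor
      · intro hu
        by_cases h : ∃ s, f s = u
        · obtain ⟨s, rfl⟩ := h
          exact Or.inl ⟨s, fun e => hu (by rw [e]), rfl⟩
        · exact Or.inr h
      · rintro (⟨s, hs, rfl⟩ | h) e
        · exact hs (hf e)
        · exact h ⟨x, e.symm⟩
    have h2 : Disjoint ((Finset.univ.erase x).image f) (Finset.univ.image f)ᶜ := by
      rw [Finset.disjoint_left]
      intro u hu hu'
      obtain ⟨s, -, rfl⟩ := Finset.mem_image.1 hu
      simp at hu'
    rw [wt, h1, Finset.prod_union h2, Finset.prod_image fun a _ b _ h => hf h]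
    congr 1
    · exact Finset.prod_congr rfl fun s _ => by rw [hσ.2]
    · exact Finset.prod_congr rfl fun u hu =>
        congrArg (c u) (if_neg (Finset.mem_compl.1 hu)).symm

end Forest

/-! ### Networks in which all hitting probabilities are nearly one half -/

section Regular

open scoped Classical

variable {V : Type*} [Fintype V] {c : V → V → ℝ}

variable (c) in
/-- The probability that `x` belongs to the tree of `a` in a random spanning forest with set of
roots `A`. -/
def reachProb (A : Finset V) (a x : V) : ℝ := reachSum c A a x / forestSum c A

lemma reachProb_harmonic {B : Finset V} {z b : V} (hz : z ∉ B) (hb : b ∈ B) :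
    ∑ w, c z w * (reachProb c B b z - reachProb c B b w) = 0 := by
  have h := reachSum_harmonic c hz hb
  have h2 : ∀ w, c z w * (reachProb c B b z - reachProb c B b w) =
      c z w * (reachSum c B b z - reachSum c B b w) / forestSum c B := by
    intro w
    simp only [reachProb]
    ring
  rw [Finset.sum_congr rfl fun w _ => h2 w, ← Finset.sum_div, h, zero_div]

lemma reachProb_root (hc : IsNetwork c) {A : Finset V} {a x : V} (hx : x ∈ A) :
    reachProb c A a x = if a = x then 1 else 0 := by
  have hpos := forestSum_pos hc ⟨x, hx⟩
  rw [reachProb, reachSum_root c hx]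
  split_ifs
  · exact div_self hpos.ne'
  · exact zero_div _

lemma sum_reachProb (hc : IsNetwork c) {A : Finset V} (hA : A.Nonempty) (x : V) :
    ∑ a ∈ A, reachProb c A a x = 1 := by
  simp only [reachProb]
  rw [← Finset.sum_div, sum_reachSum, div_self (forestSum_pos hc hA).ne']

lemma reachProb_nonneg (hc : IsNetwork c) (A : Finset V) (a x : V) : 0 ≤ reachProb c A a x := by
  refine div_nonneg (Finset.sum_nonneg fun σ _ => ?_)
    (Finset.sum_nonneg fun σ _ => wt_nonneg hc A σ)
  exact mul_nonneg (wt_nonneg hc A σ) (by split_ifs <;> norm_num)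

variable (c) in
/-- The probability that `x` belongs to the tree of `y` in a random spanning forest with roots
`y` and `z`. -/
def pairProb (y z x : V) : ℝ := reachProb c {y, z} y x

lemma pairProb_left (hc : IsNetwork c) (y z : V) : pairProb c y z y = 1 := by
  rw [pairProb, reachProb_root hc (by simp), if_pos rfl]

lemma pairProb_add (hc : IsNetwork c) {y z : V} (hyz : y ≠ z) (x : V) :
    pairProb c y z x + pairProb c z y x = 1 := by
  have h := sum_reachProb hc (A := {y, z}) ⟨y, by simp⟩ x
  rw [Finset.sum_pair hyz] at h
  rwa [pairProb, pairProb, Finset.pair_comm z y]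

lemma pairProb_nonneg (hc : IsNetwork c) (y z x : V) : 0 ≤ pairProb c y z x :=
  reachProb_nonneg hc _ _ _

lemma pairProb_harmonic {y z u : V} (hy : u ≠ y) (hz : u ≠ z) :
    ∑ w, c u w * (pairProb c y z u - pairProb c y z w) = 0 :=
  reachProb_harmonic (by simp [hy, hz]) (by simp)

lemma deg_nonneg (hc : IsNetwork c) (x : V) : 0 ≤ deg c x :=
  Finset.sum_nonneg fun y _ => hc.nonneg x y

variable (c) in
/-- All three-point connection probabilities are within `ε` of one half. -/
def IsBalanced (ε : ℝ) : Prop :=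
  ∀ x y z, x ≠ y → x ≠ z → y ≠ z → |reachProb c {y, z} y x - 1 / 2| ≤ ε

/-- The deviation of the two-root connection probability from its idealized value. -/
lemma IsBalanced.abs_sub_le (hc : IsNetwork c) {ε : ℝ} (hε : 0 ≤ ε) (h : IsBalanced c ε) {y z : V}
    (hyz : y ≠ z) (w : V) :
    |reachProb c {y, z} y w - (1 / 2 + ((if w = y then 1 / 2 else 0) - if w = z then 1 / 2 else 0))|
      ≤ ε := by
  by_cases hy : w = y
  · subst hy
    rw [reachProb_root hc (by simp), if_pos rfl, if_pos rfl, if_neg hyz]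
    norm_num
    exact hε
  by_cases hz : w = z
  · subst hz
    rw [reachProb_root hc (by simp), if_neg (Ne.symm hy), if_neg hy, if_pos rfl]
    norm_num
    exact hε
  · rw [if_neg hy, if_neg hz]
    simpa using h w y z hy hz hyz

lemma abs_sum_mul_le (hc : IsNetwork c) (x : V) {e : V → ℝ} {ε : ℝ} (he : ∀ w, |e w| ≤ ε) :
    |∑ w, c x w * e w| ≤ ε * deg c x := by
  rw [deg, Finset.mul_sum]
  refine (Finset.abs_sum_le_sum_abs _ _).trans (Finset.sum_le_sum fun w _ => ?_)
  rw [abs_mul, abs_of_nonneg (hc.nonneg x w), mul_comm]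
  exact mul_le_mul_of_nonneg_right (he w) (hc.nonneg x w)

lemma sum_mul_half (y : V) (x : V) :
    ∑ w, c x w * (if w = y then 1 / 2 else 0) = c x y / 2 := by
  simp [div_eq_mul_inv]

/-- The connection probability to `y` against `z` is harmonic at `x`. It is `1` at `y`, `0` at `z`,
and `1/2` up to `ε` elsewhere, so `(c x y - c x z) / 2` must be compensated by errors of total size
at most `2 ε deg c x`. -/
lemma IsBalanced.abs_conductance_sub_le (hc : IsNetwork c) {ε : ℝ} (hε : 0 ≤ ε)
    (h : IsBalanced c ε) {x y z : V} (hxy : x ≠ y) (hxz : x ≠ z) (hyz : y ≠ z) :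
    |c x y - c x z| ≤ 4 * ε * deg c x := by
  set e : V → ℝ := fun w => reachProb c {y, z} y w -
    (1 / 2 + ((if w = y then 1 / 2 else 0) - if w = z then 1 / 2 else 0)) with he
  have he' : ∀ w, |e w| ≤ ε := h.abs_sub_le hc hε hyz
  have hexp : ∀ w, reachProb c {y, z} y w =
      e w + (1 / 2 + ((if w = y then 1 / 2 else 0) - if w = z then 1 / 2 else 0)) := by
    intro w
    simp only [he]
    ring
  have h0 := reachProb_harmonic (c := c) (B := {y, z}) (z := x) (b := y) (by simp [hxy, hxz])
    (by simp)
  have h1 : ∀ w, c x w * (reachProb c {y, z} y x - reachProb c {y, z} y w) =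
      e x * c x w - c x w * e w - c x w * (if w = y then 1 / 2 else 0) +
        c x w * (if w = z then 1 / 2 else 0) := by
    intro w
    rw [hexp x, hexp w, if_neg hxy, if_neg hxz]
    ring
  rw [Finset.sum_congr rfl fun w _ => h1 w, Finset.sum_add_distrib, Finset.sum_sub_distrib,
    Finset.sum_sub_distrib, sum_mul_half, sum_mul_half, ← Finset.mul_sum] at h0
  have h2 := abs_sum_mul_le hc x he'
  have h3 : |e x * ∑ w, c x w| ≤ ε * deg c x := by
    rw [abs_mul, show |∑ w, c x w| = deg c x from abs_of_nonneg (deg_nonneg hc x)]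
    exact mul_le_mul_of_nonneg_right (he' x) (deg_nonneg hc x)
  rw [abs_le] at h2 h3 ⊢
  constructor <;> linarith [h2.1, h2.2, h3.1, h3.2]

/-- The conductances from `x` to the other vertices nearly agree and sum to at most `deg c x`;
averaging over all `z ≠ x` bounds each of them. -/
lemma IsBalanced.conductance_le (hc : IsNetwork c) {ε : ℝ} (hε : 0 ≤ ε) (h : IsBalanced c ε)
    (hcard : 2 ≤ Fintype.card V) (x y : V) :
    c x y ≤ (4 * ε + 1 / (Fintype.card V - 1)) * deg c x := by
  have hcard' : (2 : ℝ) ≤ Fintype.card V := by exact_mod_cast hcard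
  have hd := deg_nonneg hc x
  by_cases hxy : x = y
  · subst hxy
    rw [hc.self]
    have : (0 : ℝ) ≤ 1 / (Fintype.card V - 1) := by
      apply div_nonneg <;> linarith
    positivity
  · have h1 : ∀ z ∈ Finset.univ.erase x, c x y ≤ c x z + 4 * ε * deg c x := by
      intro z hz
      have hz' : x ≠ z := (Finset.ne_of_mem_erase hz).symm
      by_cases hyz : y = z
      · subst hyz
        have : 0 ≤ 4 * ε * deg c x := by positivity
        linarith
      · have := (abs_le.1 (h.abs_conductance_sub_le hc hε hxy hz' hyz)).2
        linarith
    have h2 := Finset.sum_le_sum h1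
    have h3 : ∑ z ∈ Finset.univ.erase x, c x z ≤ deg c x :=
      Finset.sum_le_sum_of_subset_of_nonneg (Finset.erase_subset _ _) fun z _ _ => hc.nonneg x z
    rw [Finset.sum_add_distrib, Finset.sum_const, Finset.sum_const,
      Finset.card_erase_of_mem (Finset.mem_univ x), Finset.card_univ, nsmul_eq_mul, nsmul_eq_mul,
      Nat.cast_sub (by omega), Nat.cast_one] at h2
    have hpos : (0 : ℝ) < Fintype.card V - 1 := by linarith
    have h4 : c x y - 4 * ε * deg c x ≤ deg c x / (Fintype.card V - 1) := by
      rw [le_div_iff₀ hpos]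
      nlinarith
    calc c x y ≤ 4 * ε * deg c x + deg c x / (Fintype.card V - 1) := by linarith
      _ = _ := by ring

/-- Total flow vanishes. -/
lemma sum_sum_mul_sub_eq_zero (hc : IsNetwork c) (g : V → ℝ) :
    ∑ u, ∑ w, c u w * (g u - g w) = 0 := by
  have h : ∑ u, ∑ w, c u w * (g u - g w) = -∑ u, ∑ w, c u w * (g u - g w) := by
    conv_lhs => rw [Finset.sum_comm]
    rw [← Finset.sum_neg_distrib]
    refine Finset.sum_congr rfl fun u _ => ?_
    rw [← Finset.sum_neg_distrib]
    refine Finset.sum_congr rfl fun w _ => ?_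
    rw [hc.symm w u]
    ring
  linarith

/-- Seen as a potential, the connection probability to `x` against `y` drives a flow out of `x` of
about `deg c x / 2` and into `y` of about `deg c y / 2`, up to the same extra term `c x y / 2`.
There are no other sources, so the two flows agree. -/
lemma IsBalanced.abs_deg_sub_le (hc : IsNetwork c) {ε : ℝ} (hε : 0 ≤ ε) (h : IsBalanced c ε)
    (x y : V) : |deg c x - deg c y| ≤ 2 * ε * (deg c x + deg c y) := by
  have hdx := deg_nonneg hc x
  have hdy := deg_nonneg hc y
  by_cases hxy : x = y
  · subst hxy
    rw [sub_self, abs_zero]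
    positivity
  set e : V → ℝ := fun w => reachProb c {x, y} x w -
    (1 / 2 + ((if w = x then 1 / 2 else 0) - if w = y then 1 / 2 else 0)) with he
  have he' : ∀ w, |e w| ≤ ε := h.abs_sub_le hc hε hxy
  have hexp : ∀ w, reachProb c {x, y} x w =
      e w + (1 / 2 + ((if w = x then 1 / 2 else 0) - if w = y then 1 / 2 else 0)) := by
    intro w
    simp only [he]
    ring
  have h0 := sum_sum_mul_sub_eq_zero hc (reachProb c {x, y} x)
  rw [← Finset.sum_subset (Finset.subset_univ ({x, y} : Finset V)) fun z _ hz =>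
    reachProb_harmonic hz (by simp), Finset.sum_pair hxy] at h0
  have hx : reachProb c {x, y} x x = 1 := by rw [reachProb_root hc (by simp), if_pos rfl]
  have hy : reachProb c {x, y} x y = 0 := by rw [reachProb_root hc (by simp), if_neg hxy]
  have h1 : ∀ w, c x w * (reachProb c {x, y} x x - reachProb c {x, y} x w) =
      1 / 2 * c x w - c x w * e w - c x w * (if w = x then 1 / 2 else 0) +
        c x w * (if w = y then 1 / 2 else 0) := by
    intro w
    rw [hx, hexp w]
    ring
  have h2 : ∀ w, c y w * (reachProb c {x, y} x y - reachProb c {x, y} x w) =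
      -(1 / 2) * c y w - c y w * e w - c y w * (if w = x then 1 / 2 else 0) +
        c y w * (if w = y then 1 / 2 else 0) := by
    intro w
    rw [hy, hexp w]
    ring
  rw [Finset.sum_congr rfl fun w _ => h1 w, Finset.sum_congr rfl fun w _ => h2 w] at h0
  simp only [Finset.sum_add_distrib, Finset.sum_sub_distrib, sum_mul_half, ← Finset.mul_sum] at h0
  rw [hc.self, hc.self, hc.symm y x] at h0
  have h3 := abs_le.1 (abs_sum_mul_le hc x he')
  have h4 := abs_le.1 (abs_sum_mul_le hc y he')
  change 1 / 2 * deg c x - _ - _ + _ + (-(1 / 2) * deg c y - _ - _ + _) = 0 at h0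
  rw [abs_le]
  constructor <;> linarith [h3.1, h3.2, h4.1, h4.2]

lemma deg_pos (hc : IsNetwork c) (hcard : 2 ≤ Fintype.card V) (x : V) : 0 < deg c x := by
  obtain ⟨y, hy⟩ := Fintype.exists_ne_of_one_lt_card hcard x
  obtain ⟨σ, -, hσ⟩ := hc.conn y
  exact (hσ x hy.symm).trans_le
    (Finset.single_le_sum (fun z _ => hc.nonneg x z) (Finset.mem_univ (σ x)))

variable (c) in
/-- A balanced network in which all the degrees are close to `D` and all the conductances are
small. -/
structure IsRegular (D ε : ℝ) : Prop where
  pos : 0 < D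
  deg_le : ∀ x, |deg c x - D| ≤ ε * D
  small : ∀ x y, c x y ≤ ε * D
  balanced : IsBalanced c ε

/-- The bound `ε ≤ 1 / 6` gives `(1 + 2ε) / (1 - 2ε) ≤ 2`, so every degree is at most `2 * deg c v`;
this doubles the constant of `conductance_le`. -/
lemma IsBalanced.isRegular (hc : IsNetwork c) {ε : ℝ} (hε : 0 ≤ ε) (hε' : ε ≤ 1 / 6)
    (h : IsBalanced c ε) (hcard : 2 ≤ Fintype.card V) (v : V) :
    IsRegular c (deg c v) (8 * ε + 2 / (Fintype.card V - 1)) := by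
  have hcard' : (2 : ℝ) ≤ Fintype.card V := by exact_mod_cast hcard
  have hδ : (0 : ℝ) ≤ 1 / (Fintype.card V - 1) := by apply div_nonneg <;> linarith
  have hD := deg_pos hc hcard v
  have hE : 8 * ε + 2 / ((Fintype.card V : ℝ) - 1) =
      2 * (4 * ε + 1 / ((Fintype.card V : ℝ) - 1)) := by ring
  have h2 : ∀ x, deg c x ≤ 2 * deg c v := by
    intro x
    have := (abs_le.1 (h.abs_deg_sub_le hc hε x v)).2
    nlinarith [deg_nonneg hc x]
  refine ⟨hD, fun x => ?_, fun x y => ?_, fun x y z hxy hxz hyz => ?_⟩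
  · refine (h.abs_deg_sub_le hc hε x v).trans ?_
    rw [hE]
    nlinarith [h2 x, mul_nonneg hδ hD.le, mul_nonneg hε hD.le]
  · refine (h.conductance_le hc hε hcard x y).trans ?_
    rw [hE]
    nlinarith [mul_le_mul_of_nonneg_left (h2 x) (by positivity :
      0 ≤ 4 * ε + 1 / ((Fintype.card V : ℝ) - 1))]
  · refine (h x y z hxy hxz hyz).trans ?_
    rw [hE]
    linarith

/-- In a balanced network every root is nearly equally likely. -/
lemma IsBalanced.abs_reachProb_sub_le (hc : IsNetwork c) {ε : ℝ} (hε : 0 ≤ ε)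
    (h : IsBalanced c ε) {A : Finset V} {a x : V} (ha : a ∈ A) (hx : x ∉ A) :
    |reachProb c A a x - 1 / A.card| ≤ 4 * ε := by
  have key : ∀ b ∈ A, |reachProb c A a x - reachProb c A b x| ≤ 4 * ε := by
    intro b hb
    by_cases hab : a = b
    · subst hab
      rw [sub_self, abs_zero]
      positivity
    -- Half the difference of the probabilities of `a` and `b` has boundary values `1/2` at `a`,
    -- `-1/2` at `b` and `0` on the rest of `A`, which up to `ε` are those of the two-root
    -- probability minus `1/2`. The maximum principle extends this to `x`, where the two-root term
    -- is itself at most `ε`; doubling gives `4 ε`.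
    set g : V → ℝ := fun w => reachProb c {a, b} a w - 1 / 2 - reachProb c A a w / 2 +
      reachProb c A b w / 2 with hg
    have hharm : ∀ z, z ∉ A → ∑ w, c z w * (g z - g w) = 0 := by
      intro z hz
      have hz' : z ∉ ({a, b} : Finset V) := by
        simp only [Finset.mem_insert, Finset.mem_singleton, not_or]
        exact ⟨fun e => hz (e ▸ ha), fun e => hz (e ▸ hb)⟩
      have h1 := reachProb_harmonic (c := c) hz' (b := a) (by simp)
      have h2 := reachProb_harmonic (c := c) hz ha
      have h3 := reachProb_harmonic (c := c) hz hb
      have h4 : ∀ w, c z w * (g z - g w) =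
          c z w * (reachProb c {a, b} a z - reachProb c {a, b} a w) -
          1 / 2 * (c z w * (reachProb c A a z - reachProb c A a w)) +
          1 / 2 * (c z w * (reachProb c A b z - reachProb c A b w)) := by
        intro w
        simp only [hg]
        ring
      rw [Finset.sum_congr rfl fun w _ => h4 w, Finset.sum_add_distrib, Finset.sum_sub_distrib,
        ← Finset.mul_sum, ← Finset.mul_sum, h1, h2, h3]
      ring
    have hbd : ∀ w ∈ A, |g w| ≤ ε := by
      intro w hw
      have h1 := h.abs_sub_le hc hε hab w
      simp only [hg]
      rw [reachProb_root hc hw, reachProb_root hc hw]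
      convert h1 using 2
      by_cases hwa : w = a
      · subst hwa
        simp [hab, Ne.symm hab]
        ring
      · by_cases hwb : w = b
        · subst hwb
          simp [hwa, Ne.symm hwa]
        · simp [hwa, hwb, Ne.symm hwa, Ne.symm hwb]
    have hneg : ∀ z, z ∉ A → ∑ w, c z w * ((-g) z - (-g) w) = 0 := by
      intro z hz
      rw [← neg_eq_zero, ← Finset.sum_neg_distrib, ← hharm z hz]
      refine Finset.sum_congr rfl fun w _ => ?_
      simp only [Pi.neg_apply]
      ring
    have h1 := hc.le_of_harmonic ⟨a, ha⟩ hharm (fun w hw => (abs_le.1 (hbd w hw)).2) x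
    have h2 := hc.le_of_harmonic ⟨a, ha⟩ hneg (ε := ε)
      (fun w hw => by linarith [(abs_le.1 (hbd w hw)).1, Pi.neg_apply g w]) x
    have h3 := abs_le.1 (h x a b (fun e => hx (e ▸ ha)) (fun e => hx (e ▸ hb)) hab)
    simp only [Pi.neg_apply, hg] at h1 h2
    rw [abs_le]
    constructor <;> linarith [h3.1, h3.2]
  have hcard : (0 : ℝ) < A.card := by exact_mod_cast Finset.card_pos.2 ⟨a, ha⟩
  -- The probabilities over the roots sum to one, so the deviation from uniformity is the average of
  -- the pairwise differences.
  have h1 : reachProb c A a x - 1 / A.card =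
      (∑ b ∈ A, (reachProb c A a x - reachProb c A b x)) / A.card := by
    rw [Finset.sum_sub_distrib, sum_reachProb hc ⟨a, ha⟩, Finset.sum_const, nsmul_eq_mul]
    field_simp
  rw [h1, abs_div, abs_of_pos hcard, div_le_iff₀ hcard]
  refine (Finset.abs_sum_le_sum_abs _ _).trans ((Finset.sum_le_sum key).trans ?_)
  rw [Finset.sum_const, nsmul_eq_mul, mul_comm]

/-- The effect of adding one root on the total weight of the forests. -/
lemma IsRegular.abs_forestSum_div_sub_le (hc : IsNetwork c) {D ε : ℝ} (hε : 0 ≤ ε) (hε' : ε ≤ 1)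
    (h : IsRegular c D ε) {A : Finset V} {y : V} (hy : y ∉ A) :
    |forestSum c A / (D * forestSum c (insert y A)) - A.card / (A.card + 1)| ≤
      (A.card + 9) * ε := by
  set m : ℝ := (A.card : ℝ) with hm
  have hm0 : 0 ≤ m := Nat.cast_nonneg _
  have hD := h.pos
  have hpos := forestSum_pos hc (A := insert y A) ⟨y, Finset.mem_insert_self _ _⟩
  have h1 : forestSum c A / forestSum c (insert y A) =
      ∑ z, c y z * (1 - reachProb c (insert y A) y z) := by
    rw [forestSum_eq c hy, Finset.sum_div]
    refine Finset.sum_congr rfl fun z _ => ?_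
    rw [reachProb]
    field_simp
  have hcardI : ((insert y A).card : ℝ) = m + 1 := by
    rw [Finset.card_insert_of_notMem hy]
    push_cast
    rfl
  -- Away from the roots the factor is `m / (m + 1)` up to `4 ε`. On `A` it equals `1`, and there
  -- the smallness of `c y z` pays for the discrepancy.
  have h2 : ∀ z, |c y z * (1 - reachProb c (insert y A) y z) - c y z * (m / (m + 1))| ≤
      4 * ε * c y z + if z ∈ A then ε * D else 0 := by
    intro z
    have hcz := hc.nonneg y z
    rw [← mul_sub, abs_mul, abs_of_nonneg hcz]
    by_cases hzy : z = y
    · subst hzy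
      rw [hc.self, if_neg hy]
      simp
    by_cases hz : z ∈ A
    · rw [if_pos hz, reachProb_root hc (Finset.mem_insert_of_mem hz), if_neg (Ne.symm hzy)]
      have h3 : 1 - 0 - m / (m + 1) = 1 / (m + 1) := by
        field_simp
        ring
      rw [h3, abs_of_nonneg (by positivity)]
      have h4 : 1 / (m + 1) ≤ 1 := by
        rw [div_le_one (by positivity)]
        linarith
      nlinarith [h.small y z, mul_le_mul_of_nonneg_left h4 hcz]
    · rw [if_neg hz]
      have h3 := h.balanced.abs_reachProb_sub_le hc hε (A := insert y A) (a := y) (x := z)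
        (Finset.mem_insert_self _ _) (by simp [hz, hzy])
      rw [hcardI] at h3
      have h4 : 1 - reachProb c (insert y A) y z - m / (m + 1) =
          -(reachProb c (insert y A) y z - 1 / (m + 1)) := by
        field_simp
        ring
      rw [h4, abs_neg, add_zero, mul_comm]
      exact mul_le_mul_of_nonneg_right h3 hcz
  have h3 : |forestSum c A / forestSum c (insert y A) - deg c y * (m / (m + 1))| ≤
      4 * ε * deg c y + m * (ε * D) := by
    rw [h1, deg, Finset.sum_mul, ← Finset.sum_sub_distrib]
    refine (Finset.abs_sum_le_sum_abs _ _).trans ((Finset.sum_le_sum fun z _ => h2 z).trans ?_)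
    rw [Finset.sum_add_distrib, ← Finset.mul_sum, ← Finset.sum_filter, Finset.sum_const,
      Finset.filter_mem_eq_inter, Finset.univ_inter, nsmul_eq_mul]
  have h4 := abs_le.1 (h.deg_le y)
  have h5 : m / (m + 1) ≤ 1 := by
    rw [div_le_one (by positivity)]
    linarith
  have h5' : 0 ≤ m / (m + 1) := by positivity
  have h6 : forestSum c A / (D * forestSum c (insert y A)) - m / (m + 1) =
      (forestSum c A / forestSum c (insert y A) - deg c y * (m / (m + 1)) +
        (deg c y - D) * (m / (m + 1))) / D := by
    field_simp
    ring
  rw [h6, abs_div, abs_of_pos hD, div_le_iff₀ hD]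
  have h7 : |(deg c y - D) * (m / (m + 1))| ≤ ε * D := by
    rw [abs_mul, abs_of_nonneg h5']
    nlinarith [h.deg_le y, abs_nonneg (deg c y - D)]
  have h8 : deg c y ≤ 2 * D := by nlinarith [h4.2]
  refine (abs_add_le _ _).trans ((add_le_add h3 h7).trans ?_)
  -- In `m + 9`, the `8` comes from `4 ε deg c y` with `deg c y ≤ 2 D`, the `m` from the
  -- conductances to `A`, and the `1` from replacing `deg c y` by `D`.
  nlinarith [mul_le_mul_of_nonneg_left h8 hε]

end Regular

/-! ### Weighted embeddings of a fixed tree -/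

section Embeddings

open scoped Classical

variable {V : Type*} [Fintype V]

/-- The sum of `F` over the embeddings of a rooted tree, weighted by the conductances. -/
def embFold {S : Type*} [Fintype S] (c : V → V → ℝ) (p : S → S) (x : S) (v : V)
    (F : (S → V) → ℝ) : ℝ :=
  ∑ f : S → V, if Function.Injective f ∧ f x = v then
    (∏ s ∈ Finset.univ.erase x, c (f s) (f (p s))) * F f else 0

/-- The total weight of the embeddings of a rooted tree. -/
def embSum {S : Type*} [Fintype S] (c : V → V → ℝ) (p : S → S) (x : S) (v : V) : ℝ :=
  embFold c p x v fun _ => 1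

/-- The expected number of embeddings of a rooted tree into the random spanning tree. -/
def treeSum {S : Type*} [Fintype S] (c : V → V → ℝ) (p : S → S) (x : S) (v : V) : ℝ :=
  embFold c p x v fun f => forestSum c (Finset.univ.image f) / forestSum c {v}

lemma embFold_mono {S : Type*} [Fintype S] {c : V → V → ℝ} (hc : IsNetwork c) {p : S → S} {x : S}
    {v : V} {F F' : (S → V) → ℝ}
    (h : ∀ f, Function.Injective f → f x = v → F f ≤ F' f) :
    embFold c p x v F ≤ embFold c p x v F' := by
  refine Finset.sum_le_sum fun f _ => ?_
  split_ifs with hf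
  · exact mul_le_mul_of_nonneg_left (h f hf.1 hf.2) (Finset.prod_nonneg fun s _ => hc.nonneg _ _)
  · exact le_rfl

lemma embFold_const {S : Type*} [Fintype S] (c : V → V → ℝ) (p : S → S) (x : S) (v : V) (a : ℝ) :
    (embFold c p x v fun _ => a) = a * embSum c p x v := by
  rw [embSum, embFold, embFold, Finset.mul_sum]
  refine Finset.sum_congr rfl fun f _ => ?_
  split_ifs <;> ring

/-- Without a leaf `p` would be a permutation of a finite set, and no other vertex could be carried
to the fixed point `x`. -/
lemma IsParentMap.exists_notMem_range {S : Type*} [Finite S] {p : S → S} {x : S}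
    (hp : IsParentMap p x) (hS : ∃ s, s ≠ x) : ∃ s, s ∉ Set.range p := by
  by_contra hcon
  push Not at hcon
  have hinj : Function.Injective p := Finite.injective_iff_surjective.2 hcon
  obtain ⟨s, hs⟩ := hS
  obtain ⟨n, hn⟩ := hp.reach s
  exact hs (hinj.iterate n (hn.trans (hp.iterate_root n).symm))

lemma IsParentMap.restrict {S : Type*} {p : S → S} {x s₀ : S} (hp : IsParentMap p x)
    (hs : s₀ ∉ Set.range p) (hx : x ≠ s₀) :
    IsParentMap (fun s : {s // s ≠ s₀} => (⟨p s, fun e => hs ⟨s, e⟩⟩ : {s // s ≠ s₀})) ⟨x, hx⟩ := by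
  refine ⟨Subtype.ext hp.root, fun u => ?_⟩
  obtain ⟨n, hn⟩ := hp.reach u
  refine ⟨n, Subtype.ext (Eq.trans ?_ hn)⟩
  clear hn
  induction n with
  | zero => rfl
  | succ n ih => rw [Function.iterate_succ_apply', Function.iterate_succ_apply', ← ih]

/-- Embeddings of a tree in terms of the embeddings of the tree without a leaf. -/
lemma embSum_eq {S : Type*} [Fintype S] (c : V → V → ℝ) {p : S → S} {x s₀ : S} (v : V)
    (hs : s₀ ∉ Set.range p) (hx : x ≠ s₀) :
    embSum c p x v = embFold c
      (fun s : {s // s ≠ s₀} => (⟨p s, fun e => hs ⟨s, e⟩⟩ : {s // s ≠ s₀})) ⟨x, hx⟩ v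
      fun f => ∑ y ∈ (Finset.univ.image f)ᶜ, c y (f ⟨p s₀, fun e => hs ⟨s₀, e⟩⟩) := by
  -- An embedding is split into the image `y` of the leaf and the restriction to the other vertices;
  -- injectivity adds that `y` avoids the image of the restriction.
  rw [embSum, embFold, embFold, ← (Equiv.funSplitAt s₀ V).symm.sum_comp, Fintype.sum_prod_type,
    Finset.sum_comm]
  simp only [mul_one]
  refine Finset.sum_congr (by ext; simp) fun f _ => ?_
  have hg0 : ∀ y, (Equiv.funSplitAt s₀ V).symm (y, f) s₀ = y := fun y => by simp
  have hg : ∀ y, ∀ s : {s // s ≠ s₀}, (Equiv.funSplitAt s₀ V).symm (y, f) s = f s :=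
    fun y s => by simp [s.2]
  have hinj : ∀ y, Function.Injective ((Equiv.funSplitAt s₀ V).symm (y, f)) ↔
      Function.Injective f ∧ y ∈ (Finset.univ.image f)ᶜ := by
    intro y
    constructor
    · intro h
      refine ⟨fun a b hab => Subtype.ext (h ?_), ?_⟩
      · rw [hg, hg, hab]
      · simp only [Finset.mem_compl, Finset.mem_image, Finset.mem_univ, true_and]
        rintro ⟨s, rfl⟩
        exact s.2 (h ((hg _ s).trans (hg0 _).symm))
    · rintro ⟨h1, h2⟩ a b hab
      simp only [Finset.mem_compl, Finset.mem_image, Finset.mem_univ, true_and] at h2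
      by_cases ha : a = s₀
      · by_cases hb : b = s₀
        · rw [ha, hb]
        · rw [ha, hg0, hg y ⟨b, hb⟩] at hab
          exact absurd ⟨_, hab.symm⟩ h2
      · by_cases hb : b = s₀
        · rw [hb, hg0, hg y ⟨a, ha⟩] at hab
          exact absurd ⟨_, hab⟩ h2
        · rw [hg y ⟨a, ha⟩, hg y ⟨b, hb⟩] at hab
          exact congrArg Subtype.val (h1 hab)
  have hprod : ∀ y, ∏ s ∈ Finset.univ.erase x, c ((Equiv.funSplitAt s₀ V).symm (y, f) s)
        ((Equiv.funSplitAt s₀ V).symm (y, f) (p s)) =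
      (∏ s ∈ Finset.univ.erase (⟨x, hx⟩ : {s // s ≠ s₀}),
          c (f s) (f ⟨p s, fun e => hs ⟨s, e⟩⟩)) * c y (f ⟨p s₀, fun e => hs ⟨s₀, e⟩⟩) := by
    intro y
    have h1 : Finset.univ.erase x = insert s₀
        ((Finset.univ.erase (⟨x, hx⟩ : {s // s ≠ s₀})).map (Function.Embedding.subtype _)) := by
      ext s
      by_cases h : s = s₀ <;> simp [h, hx.symm]
    rw [h1, Finset.prod_insert (by simp), Finset.prod_map, mul_comm, hg0,
      hg y ⟨p s₀, fun e => hs ⟨s₀, e⟩⟩]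
    congr 1
    refine Finset.prod_congr rfl fun s _ => ?_
    rw [Function.Embedding.subtype_apply, hg, hg y ⟨p s, fun e => hs ⟨s, e⟩⟩]
  by_cases hf : Function.Injective f ∧ f ⟨x, hx⟩ = v
  · rw [if_pos hf, Finset.mul_sum, ← Finset.sum_filter_add_sum_filter_not Finset.univ
      (fun y => y ∈ (Finset.univ.image f)ᶜ)]
    rw [Finset.filter_mem_eq_inter, Finset.univ_inter]
    have h0 : ∑ y ∈ Finset.univ.filter (fun y => ¬ y ∈ (Finset.univ.image f)ᶜ),
        (if Function.Injective ((Equiv.funSplitAt s₀ V).symm (y, f)) ∧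
            (Equiv.funSplitAt s₀ V).symm (y, f) x = v then
          ∏ s ∈ Finset.univ.erase x, c ((Equiv.funSplitAt s₀ V).symm (y, f) s)
            ((Equiv.funSplitAt s₀ V).symm (y, f) (p s)) else 0) = 0 := by
      refine Finset.sum_eq_zero fun y hy => if_neg ?_
      rw [hinj]
      exact fun h => (Finset.mem_filter.1 hy).2 h.1.2
    rw [h0, add_zero]
    refine Finset.sum_congr rfl fun y hy => ?_
    rw [if_pos ⟨(hinj y).2 ⟨hf.1, hy⟩, (hg y ⟨x, hx⟩).trans hf.2⟩, hprod]
    congr!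
  · rw [if_neg hf]
    refine Finset.sum_eq_zero fun y _ => if_neg ?_
    rw [hinj]
    exact fun h => hf ⟨h.1.1, (hg y ⟨x, hx⟩).symm.trans h.2⟩

/-- Bounds for the weighted number of embeddings of a tree. -/
lemma embSum_bounds {c : V → V → ℝ} (hc : IsNetwork c) {lo hi : ℝ} (hlo : 0 ≤ lo) (hhi : 0 ≤ hi)
    {K : ℕ} (h1 : ∀ z, ∀ R : Finset V, R.card ≤ K → lo ≤ ∑ y ∈ Rᶜ, c y z)
    (h2 : ∀ z, deg c z ≤ hi) (v : V) (k : ℕ) (hk : k ≤ K) {S : Type*} [Fintype S] (p : S → S)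
    (x : S) (hp : IsParentMap p x) (hS : Fintype.card S = k + 1) :
    lo ^ k ≤ embSum c p x v ∧ embSum c p x v ≤ hi ^ k := by
  induction k generalizing S with
  | zero =>
    have hsub : ∀ s, s = x := fun s =>
      @Subsingleton.elim S (Fintype.card_le_one_iff_subsingleton.1 (by omega)) s x
    have he : embSum c p x v = 1 := by
      rw [embSum, embFold, Finset.sum_eq_single fun _ => v]
      · rw [if_pos ⟨fun a b _ => (hsub a).trans (hsub b).symm, rfl⟩, mul_one]
        refine Finset.prod_eq_one fun s hs => ?_
        exact absurd (hsub s) (Finset.ne_of_mem_erase hs)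
      · intro f _ hf
        refine if_neg fun h => hf (funext fun s => ?_)
        rw [hsub s, h.2]
      · simp
    simp [he]
  | succ k ih =>
    have hex : ∃ s, s ≠ x := by
      have : 1 < Fintype.card S := by omega
      exact Fintype.exists_ne_of_one_lt_card this x
    obtain ⟨s₀, hs⟩ := hp.exists_notMem_range hex
    have hx : x ≠ s₀ := fun e => hs ⟨x, hp.root.trans e⟩
    have hcard : Fintype.card {s // s ≠ s₀} = k + 1 := by
      rw [Fintype.card_subtype_compl, hS, Fintype.card_subtype_eq]
      omega
    obtain ⟨ih1, ih2⟩ := ih (by omega) _ _ (hp.restrict hs hx) hcard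
    rw [embSum_eq c v hs hx]
    -- Placing the removed leaf costs a factor between `lo` and `hi`, whatever the at most `K`
    -- vertices already occupied.
    have hb : ∀ f : {s // s ≠ s₀} → V,
        lo ≤ ∑ y ∈ (Finset.univ.image f)ᶜ, c y (f ⟨p s₀, fun e => hs ⟨s₀, e⟩⟩) ∧
        ∑ y ∈ (Finset.univ.image f)ᶜ, c y (f ⟨p s₀, fun e => hs ⟨s₀, e⟩⟩) ≤ hi := by
      intro f
      constructor
      · refine h1 _ _ (Finset.card_image_le.trans ?_)
        rw [Finset.card_univ, hcard]
        exact hk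
      · refine (Finset.sum_le_sum_of_subset_of_nonneg (Finset.subset_univ _)
          fun y _ _ => hc.nonneg _ _).trans ?_
        simp only [hc.symm _ (f ⟨p s₀, fun e => hs ⟨s₀, e⟩⟩)]
        exact h2 _
    constructor
    · refine le_trans ?_ (embFold_mono hc fun f _ _ => (hb f).1)
      rw [embFold_const, pow_succ, mul_comm]
      exact mul_le_mul_of_nonneg_left ih1 hlo
    · refine (embFold_mono hc fun f _ _ => (hb f).2).trans ?_
      rw [embFold_const, pow_succ, mul_comm]
      exact mul_le_mul_of_nonneg_right ih2 hhi

/-- A degree is at least `(1 - ε) D`, and the at most `k` occupied vertices remove at most `ε D`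
each. -/
lemma IsRegular.embSum_bounds {c : V → V → ℝ} (hc : IsNetwork c) {D ε : ℝ} (hε : 0 ≤ ε)
    (h : IsRegular c D ε) (v : V) {S : Type*} [Fintype S] {p : S → S} {x : S}
    (hp : IsParentMap p x) {k : ℕ} (hS : Fintype.card S = k + 1) (hk : (k + 1) * ε ≤ 1) :
    (1 - (k + 1) * ε) ^ k ≤ embSum c p x v / D ^ k ∧ embSum c p x v / D ^ k ≤ (1 + ε) ^ k := by
  have hD := h.pos
  have hDk : 0 < D ^ k := pow_pos hD k
  rw [le_div_iff₀ hDk, div_le_iff₀ hDk, ← mul_pow, ← mul_pow]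
  refine UST.embSum_bounds hc (mul_nonneg (by linarith) hD.le) (by positivity) (K := k) ?_ ?_ v k
    le_rfl p x hp hS
  · intro z R hR
    have h1 : ∑ y ∈ Rᶜ, c y z = deg c z - ∑ y ∈ R, c y z := by
      rw [deg, eq_sub_iff_add_eq, Finset.sum_compl_add_sum]
      exact Finset.sum_congr rfl fun y _ => hc.symm _ _
    have h2 : ∑ y ∈ R, c y z ≤ k * (ε * D) := by
      refine (Finset.sum_le_sum fun y _ => h.small y z).trans ?_
      rw [Finset.sum_const, nsmul_eq_mul]
      exact mul_le_mul_of_nonneg_right (by exact_mod_cast hR) (by positivity)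
    have h3 := (abs_le.1 (h.deg_le z)).1
    rw [h1]
    linarith
  · intro z
    linarith [(abs_le.1 (h.deg_le z)).2]

end Embeddings

/-! ### Asymptotics of forest weights and of expected embedding counts. -/

section Sequences

open scoped Classical

variable {V : ℕ → Type*} [∀ n, Fintype (V n)] {c : ∀ n, V n → V n → ℝ} {D : ℕ → ℝ}

/-- The ratio of the total weight of the forests with `m` roots to that of the trees. -/
lemma eventually_abs_forestSum_sub_le (hc : ∀ n, IsNetwork (c n))
    (hreg : ∀ ε : ℝ, 0 < ε → ∀ᶠ n in atTop, IsRegular (c n) (D n) ε) (m : ℕ) :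
    ∀ δ : ℝ, 0 < δ → ∀ᶠ n in atTop, ∀ (A : Finset (V n)) (v : V n), v ∈ A → A.card = m + 1 →
      |forestSum (c n) A / forestSum (c n) {v} * D n ^ m - (m + 1)| ≤ δ := by
  induction m with
  | zero =>
    intro δ hδ
    refine Eventually.of_forall fun n A v hv hA => ?_
    obtain ⟨w, rfl⟩ := Finset.card_eq_one.1 hA
    rw [Finset.mem_singleton.1 hv, div_self (forestSum_pos (hc n) ⟨w, by simp⟩).ne']
    simpa using hδ.le
  | succ m ih =>
    intro δ hδ
    have hm : (0 : ℝ) < m + 1 := by positivity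
    have hcont : ContinuousAt (fun q : ℝ × ℝ => q.1 / q.2)
        ((m + 1 : ℝ), (m + 1 : ℝ) / (m + 1 + 1)) :=
      continuousAt_fst.div continuousAt_snd (by positivity)
    have hval : ((m : ℝ) + 1) / (((m : ℝ) + 1) / (m + 1 + 1)) = m + 1 + 1 := by field_simp
    obtain ⟨η, hη, hball⟩ := Metric.continuousAt_iff.1 hcont δ hδ
    set ε : ℝ := min 1 (η / 2 / (m + 1 + 9)) with hεdef
    have hε : 0 < ε := by positivity
    have hε2 : (m + 1 + 9) * ε ≤ η / 2 := by
      have : ε ≤ η / 2 / (m + 1 + 9) := min_le_right _ _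
      rw [le_div_iff₀ (by positivity)] at this
      linarith
    filter_upwards [ih (η / 2) (by positivity), hreg ε hε] with n h1 h2 A v hv hA
    -- Deleting a root other than `v` keeps the induction applicable: the new limit is the old one,
    -- `m + 1`, divided by the one-step factor `(m + 1) / (m + 2)`.
    obtain ⟨y, hy, hyv⟩ : ∃ y ∈ A, y ≠ v := Finset.exists_mem_ne (by omega) v
    have hvA : v ∈ A.erase y := Finset.mem_erase.2 ⟨hyv.symm, hv⟩
    have hcard : (A.erase y).card = m + 1 := by rw [Finset.card_erase_of_mem hy, hA]; rfl
    have h3 := h1 (A.erase y) v hvA hcard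
    have h4 := h2.abs_forestSum_div_sub_le (hc n) hε.le (min_le_left _ _) (Finset.notMem_erase y A)
    rw [hcard, Finset.insert_erase hy] at h4
    push_cast at h4
    have hD := h2.pos
    have hp1 := forestSum_pos (hc n) ⟨v, hv⟩
    have hp2 := forestSum_pos (hc n) ⟨v, hvA⟩
    have hp3 := forestSum_pos (hc n) (A := {v}) ⟨v, by simp⟩
    have h5 := @hball (forestSum (c n) (A.erase y) / forestSum (c n) {v} * D n ^ m,
      forestSum (c n) (A.erase y) / (D n * forestSum (c n) A)) (by
        rw [Prod.dist_eq, max_lt_iff, Real.dist_eq, Real.dist_eq]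
        constructor <;> dsimp only <;> linarith)
    simp only [Real.dist_eq, hval] at h5
    have h6 : forestSum (c n) (A.erase y) / forestSum (c n) {v} * D n ^ m /
        (forestSum (c n) (A.erase y) / (D n * forestSum (c n) A)) =
        forestSum (c n) A / forestSum (c n) {v} * D n ^ (m + 1) := by
      field_simp
      ring
    rw [h6] at h5
    push_cast
    exact h5.le

lemma tendsto_embSum (hc : ∀ n, IsNetwork (c n))
    (hreg : ∀ ε : ℝ, 0 < ε → ∀ᶠ n in atTop, IsRegular (c n) (D n) ε) (v : ∀ n, V n)
    {S : Type*} [Fintype S] {p : S → S} {x : S} (hp : IsParentMap p x) {k : ℕ}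
    (hS : Fintype.card S = k + 1) :
    Tendsto (fun n => embSum (c n) p x (v n) / D n ^ k) atTop (𝓝 1) := by
  rw [Metric.tendsto_atTop']
  intro δ hδ
  have hc1 : ContinuousAt (fun ε : ℝ => (1 - (k + 1) * ε) ^ k) 0 := by fun_prop
  have hc2 : ContinuousAt (fun ε : ℝ => (1 + ε) ^ k) 0 := by fun_prop
  obtain ⟨η₁, hη₁, h1⟩ := Metric.continuousAt_iff.1 hc1 δ hδ
  obtain ⟨η₂, hη₂, h2⟩ := Metric.continuousAt_iff.1 hc2 δ hδ
  set ε : ℝ := min (1 / (k + 1)) (min (η₁ / 2) (η₂ / 2)) with hεdef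
  have hε : 0 < ε := by positivity
  have e1 : ε ≤ 1 / (k + 1) := min_le_left _ _
  have e2 : ε ≤ η₁ / 2 := (min_le_right _ _).trans (min_le_left _ _)
  have e3 : ε ≤ η₂ / 2 := (min_le_right _ _).trans (min_le_right _ _)
  have h1' := @h1 ε (by rw [Real.dist_eq, sub_zero, abs_of_pos hε]; linarith)
  have h2' := @h2 ε (by rw [Real.dist_eq, sub_zero, abs_of_pos hε]; linarith)
  simp only [Real.dist_eq, mul_zero, sub_zero, add_zero, one_pow] at h1' h2'
  obtain ⟨N, hN⟩ := eventually_atTop.1 (hreg ε hε)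
  refine ⟨N, fun n hn => ?_⟩
  have hk : ((k : ℝ) + 1) * ε ≤ 1 := by
    rw [le_div_iff₀ (by positivity)] at e1
    linarith
  have h3 := (hN n hn.le).embSum_bounds (hc n) hε.le (v n) hp hS hk
  rw [Real.dist_eq, abs_lt]
  rw [abs_lt] at h1' h2'
  constructor <;> linarith [h1'.1, h2'.2, h3.1, h3.2]

/-- The expected number of embeddings of a tree converges to its number of vertices. -/
lemma tendsto_treeSum (hc : ∀ n, IsNetwork (c n))
    (hreg : ∀ ε : ℝ, 0 < ε → ∀ᶠ n in atTop, IsRegular (c n) (D n) ε) (v : ∀ n, V n)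
    {S : Type*} [Fintype S] {p : S → S} {x : S} (hp : IsParentMap p x) :
    Tendsto (fun n => treeSum (c n) p x (v n)) atTop (𝓝 (Fintype.card S)) := by
  obtain ⟨k, hS⟩ : ∃ k, Fintype.card S = k + 1 :=
    Nat.exists_eq_succ_of_ne_zero ((Fintype.card_pos_iff.2 ⟨x⟩).ne')
  have hZ := tendsto_embSum hc hreg v hp hS
  -- All images have `k + 1` vertices, so the forest ratio is `(k + 1) / D ^ k` with a relative
  -- error uniform in the embedding, and it can be taken out of the sum.
  have hdiff : Tendsto (fun n => treeSum (c n) p x (v n) -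
      (k + 1) * (embSum (c n) p x (v n) / D n ^ k)) atTop (𝓝 0) := by
    rw [Metric.tendsto_nhds]
    intro δ hδ
    filter_upwards [eventually_abs_forestSum_sub_le hc hreg k (δ / 4) (by positivity),
      hreg 1 one_pos, hZ.eventually (gt_mem_nhds one_lt_two)] with n h1 h2 h3
    have hD : 0 < D n ^ k := pow_pos h2.pos k
    rw [Real.dist_eq, sub_zero]
    have h4 : |treeSum (c n) p x (v n) - (k + 1) * (embSum (c n) p x (v n) / D n ^ k)| ≤
        δ / 4 * (embSum (c n) p x (v n) / D n ^ k) := by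
      have hq : ∀ f : S → V n, Function.Injective f → f x = v n →
          |forestSum (c n) (Finset.univ.image f) / forestSum (c n) {v n} - (k + 1) / D n ^ k| ≤
            δ / 4 / D n ^ k := by
        intro f hf hfx
        have h5 := h1 (Finset.univ.image f) (v n) (by rw [← hfx]; simp)
          (by rw [Finset.card_image_of_injective _ hf, Finset.card_univ, hS])
        rw [le_div_iff₀ hD]
        refine le_of_eq_of_le ?_ h5
        rw [← abs_of_pos hD, ← abs_mul, abs_of_pos hD, sub_mul, div_mul_cancel₀ _ hD.ne']
      have h5 := embFold_mono (hc n) (p := p) fun f hf hfx => (abs_le.1 (hq f hf hfx)).2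
      have h6 := embFold_mono (hc n) (p := p) (F := fun _ => -(δ / 4 / D n ^ k))
        fun f hf hfx => (abs_le.1 (hq f hf hfx)).1
      have h7 : (embFold (c n) p x (v n) fun f =>
          forestSum (c n) (Finset.univ.image f) / forestSum (c n) {v n} - (k + 1) / D n ^ k) =
          treeSum (c n) p x (v n) - (k + 1) * (embSum (c n) p x (v n) / D n ^ k) := by
        rw [show (k + 1) * (embSum (c n) p x (v n) / D n ^ k) =
          (k + 1) / D n ^ k * embSum (c n) p x (v n) by ring, ← embFold_const, treeSum, embFold,
          embFold, embFold, ← Finset.sum_sub_distrib]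
        refine Finset.sum_congr rfl fun f _ => ?_
        split_ifs <;> ring
      rw [h7, embFold_const] at h5 h6
      rw [abs_le]
      constructor
      · refine le_of_eq_of_le ?_ h6
        ring
      · refine h5.trans_eq ?_
        ring
    nlinarith
  have := hdiff.add (hZ.const_mul ((k : ℝ) + 1))
  simp only [sub_add_cancel, zero_add, mul_one] at this
  rw [hS]
  push_cast
  exact this

end Sequences

/-! ### Counting embeddings without superfluous children -/

section Extensions

open scoped Classical

variable {V W : Type*}

/-- The map `f` embeds the tree with parent map `p` and root `x` into the tree with parent map `σ`
and root `v`. -/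
structure IsExt (p : W → W) (x : W) (σ : V → V) (v : V) (f : W → V) : Prop where
  inj : Function.Injective f
  map_root : f x = v
  map_parent : ∀ w, σ (f w) = f (p w)

/-- The number of embeddings of a rooted tree. -/
def extCard (p : W → W) (x : W) (σ : V → V) (v : V) : ℕ := Nat.card {f : W → V // IsExt p x σ v f}

/-- The parent map of a tree to which `m` leaves with parents `i 0, …, i (m - 1)` are added. -/
def addLeaves (p : W → W) {m : ℕ} (i : Fin m → W) : W ⊕ Fin m → W ⊕ Fin m :=
  Sum.elim (fun w => Sum.inl (p w)) fun j => Sum.inl (i j)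

lemma IsParentMap.addLeaves {p : W → W} {x : W} (hp : IsParentMap p x) {m : ℕ} (i : Fin m → W) :
    IsParentMap (addLeaves p i) (Sum.inl x) := by
  have h : ∀ w : W, ∃ n, (UST.addLeaves p i)^[n] (Sum.inl w) = Sum.inl x := by
    intro w
    obtain ⟨n, hn⟩ := hp.reach w
    refine ⟨n, ?_⟩
    rw [← hn]
    clear hn
    induction n with
    | zero => rfl
    | succ n ih => rw [Function.iterate_succ_apply', Function.iterate_succ_apply', ih]; rfl
  refine ⟨congrArg Sum.inl hp.root, ?_⟩
  rintro (w | j)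
  · exact h w
  · obtain ⟨n, hn⟩ := h (i j)
    exact ⟨n + 1, hn⟩

/-- The children of the image of `I` under `f` that do not lie in the range of `f`. -/
def extraChildren (I : Set W) (σ : V → V) (f : W → V) : Set V :=
  {u | u ∉ Set.range f ∧ σ u ∈ f '' I}

lemma isExt_addLeaves_iff {p : W → W} {x : W} {σ : V → V} {v : V} {m : ℕ} {i : Fin m → W}
    {f : W ⊕ Fin m → V} : IsExt (addLeaves p i) (Sum.inl x) σ v f ↔
      IsExt p x σ v (f ∘ Sum.inl) ∧ Function.Injective (f ∘ Sum.inr) ∧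
        (∀ j, f (Sum.inr j) ∉ Set.range (f ∘ Sum.inl)) ∧
        ∀ j, σ (f (Sum.inr j)) = f (Sum.inl (i j)) := by
  constructor
  · intro h
    refine ⟨⟨h.inj.comp Sum.inl_injective, h.map_root, fun w => h.map_parent (Sum.inl w)⟩,
      h.inj.comp Sum.inr_injective, ?_, fun j => h.map_parent (Sum.inr j)⟩
    rintro j ⟨w, hw⟩
    exact Sum.inl_ne_inr (h.inj hw)
  · rintro ⟨h1, h2, h3, h4⟩
    refine ⟨?_, h1.map_root, ?_⟩
    · rintro (a | a) (b | b) hab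
      · exact congrArg _ (h1.inj hab)
      · exact absurd ⟨a, hab⟩ (h3 b)
      · exact absurd ⟨b, hab.symm⟩ (h3 a)
      · exact congrArg _ (h2 hab)
    · rintro (w | j)
      · exact h1.map_parent w
      · exact h4 j

/-- Embeddings with `m` further children of the vertices in `I`. -/
def extLeavesEquiv (p : W → W) (x : W) (σ : V → V) (v : V) (I : Set W) (m : ℕ) :
    (Σ i : Fin m → I, {f // IsExt (addLeaves p fun j => (i j : W)) (Sum.inl x) σ v f}) ≃
      Σ f : {f : W → V // IsExt p x σ v f}, Fin m ↪ extraChildren I σ f.1 where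
  toFun q := ⟨⟨q.2.1 ∘ Sum.inl, (isExt_addLeaves_iff.1 q.2.2).1⟩,
    ⟨fun j => ⟨q.2.1 (Sum.inr j), (isExt_addLeaves_iff.1 q.2.2).2.2.1 j,
      ⟨q.1 j, (q.1 j).2, ((isExt_addLeaves_iff.1 q.2.2).2.2.2 j).symm⟩⟩,
      fun a b hab => (isExt_addLeaves_iff.1 q.2.2).2.1 (congrArg Subtype.val hab)⟩⟩
  invFun q := ⟨fun j => ⟨(q.2 j).2.2.choose, (q.2 j).2.2.choose_spec.1⟩,
    ⟨Sum.elim q.1.1 fun j => q.2 j, isExt_addLeaves_iff.2 ⟨q.1.2,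
      fun _ _ hab => q.2.injective (Subtype.ext hab), fun j => (q.2 j).2.1,
      fun j => (q.2 j).2.2.choose_spec.2.symm⟩⟩⟩
  left_inv := by
    rintro ⟨i, f, hf⟩
    have h := isExt_addLeaves_iff.1 hf
    -- Injectivity of `f` forces the chosen preimage of the parent to be the original index `i j`.
    have hi : ∀ (j : Fin m) (hj : ∃ a, a ∈ I ∧ (f ∘ Sum.inl) a = σ (f (Sum.inr j))),
        hj.choose = i j :=
      fun j hj => h.1.inj (hj.choose_spec.2.trans (h.2.2.2 j))
    have h1 : (fun j => (⟨(⟨i j, (i j).2, (h.2.2.2 j).symm⟩ :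
        ∃ a, a ∈ I ∧ (f ∘ Sum.inl) a = σ (f (Sum.inr j))).choose,
        (Exists.choose_spec (⟨i j, (i j).2, (h.2.2.2 j).symm⟩ :
          ∃ a, a ∈ I ∧ (f ∘ Sum.inl) a = σ (f (Sum.inr j)))).1⟩ : I)) = i :=
      funext fun j => Subtype.ext (hi j _)
    have h2 : (Sum.elim (f ∘ Sum.inl) fun j => f (Sum.inr j)) = f := by
      ext (w | j) <;> rfl
    refine Sigma.ext h1 ?_
    dsimp only
    refine (Subtype.heq_iff_coe_eq ?_).2 h2
    intro g
    exact iff_of_eq (congrArg (fun i' : Fin m → I =>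
      IsExt (addLeaves p fun j => (i' j : W)) (Sum.inl x) σ v g) h1)
  right_inv q := rfl

variable [Fintype V] [Fintype W]

/-- The factorial moments of the number of extra children. -/
lemma sum_extCard_addLeaves (p : W → W) (x : W) (σ : V → V) (v : V) (I : Set W) (m : ℕ) :
    ∑ i : Fin m → I, extCard (addLeaves p fun j => (i j : W)) (Sum.inl x) σ v =
      ∑ f : {f : W → V // IsExt p x σ v f}, (extraChildren I σ f.1).ncard.descFactorial m := by
  have h := Nat.card_congr (extLeavesEquiv p x σ v I m)
  rw [Nat.card_sigma, Nat.card_sigma] at h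
  refine h.trans (Finset.sum_congr rfl fun f _ => ?_)
  rw [Nat.card_eq_fintype_card, Fintype.card_embedding_eq, Fintype.card_fin,
    ← Nat.card_eq_fintype_card, Nat.card_coe_set_eq]

lemma card_fits_eq (p : W → W) (x : W) (σ : V → V) (v : V) (I : Set W) :
    Nat.card {f : W → V // Fits p x I σ v f} =
      ∑ f : {f : W → V // IsExt p x σ v f}, if (extraChildren I σ f.1).ncard = 0 then 1 else 0 := by
  rw [← Finset.card_filter, ← Fintype.card_subtype, ← Nat.card_eq_fintype_card]
  refine Nat.card_congr
    ⟨fun f => ⟨⟨f.1, f.2.inj, f.2.map_root, f.2.map_parent⟩, ?_⟩,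
      fun f => ⟨f.1.1, f.1.2.inj, f.1.2.map_root, f.1.2.map_parent, ?_⟩, fun f => rfl,
      fun f => rfl⟩
  · rw [Set.ncard_eq_zero, Set.eq_empty_iff_forall_notMem]
    exact fun u hu => hu.1 (f.2.mem_range u hu.2)
  · intro u hu
    have h := f.2
    rw [Set.ncard_eq_zero, Set.eq_empty_iff_forall_notMem] at h
    by_contra hu'
    exact h u ⟨hu', hu⟩

/-- Bonferroni's inequalities. -/
lemma abs_indicator_sub_alternating_sum_le (N M : ℕ) :
    |(if N = 0 then (1 : ℝ) else 0) - ∑ m ∈ Finset.range M, (-1) ^ m * (N.choose m : ℝ)| ≤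
      N.choose M := by
  cases N with
  | zero =>
    cases M with
    | zero => simp
    | succ M => simp [Finset.sum_range_succ']
  | succ N =>
    cases M with
    | zero => simp
    | succ M =>
      -- The truncated alternating sum collapses to `± N.choose M`, which Pascal's rule bounds by
      -- `(N + 1).choose (M + 1)`.
      have h := Int.alternating_sum_range_choose_eq_choose (n := N) (m := M)
      have h' : ∑ m ∈ Finset.range (M + 1), (-1 : ℝ) ^ m * ((N + 1).choose m : ℝ) =
          (-1) ^ M * (N.choose M : ℝ) := by
        have := congrArg (fun z : ℤ => (z : ℝ)) h
        push_cast at this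
        simpa using this
      rw [h', if_neg (Nat.succ_ne_zero N), zero_sub, abs_neg, abs_mul, abs_pow, abs_neg, abs_one,
        one_pow, one_mul, Nat.abs_cast]
      exact_mod_cast by rw [Nat.choose_succ_succ]; omega

/-- This is Bonferroni's inequality for the number of extra children, summed over all embeddings;
division by `m!` turns ordered choices of extra children into binomial coefficients. -/
lemma abs_card_fits_sub_le (p : W → W) (x : W) (σ : V → V) (v : V) (I : Set W) (M : ℕ) :
    |(Nat.card {f : W → V // Fits p x I σ v f} : ℝ) - ∑ m ∈ Finset.range M, (-1) ^ m *
      ((∑ i : Fin m → I, (extCard (addLeaves p fun j => (i j : W)) (Sum.inl x) σ v : ℝ)) /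
        m.factorial)| ≤
      (∑ i : Fin M → I, (extCard (addLeaves p fun j => (i j : W)) (Sum.inl x) σ v : ℝ)) /
        M.factorial := by
  have h1 : ∀ m : ℕ,
      (∑ i : Fin m → I, (extCard (addLeaves p fun j => (i j : W)) (Sum.inl x) σ v : ℝ)) /
        m.factorial =
      ∑ f : {f : W → V // IsExt p x σ v f}, ((extraChildren I σ f.1).ncard.choose m : ℝ) := by
    intro m
    have := congrArg (fun k : ℕ => (k : ℝ)) (sum_extCard_addLeaves p x σ v I m)
    push_cast at this
    rw [this, Finset.sum_div]
    refine Finset.sum_congr rfl fun f _ => ?_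
    rw [Nat.descFactorial_eq_factorial_mul_choose]
    push_cast
    rw [mul_div_cancel_left₀ _ (by positivity)]
  simp only [h1]
  rw [card_fits_eq]
  push_cast
  simp only [Finset.mul_sum]
  rw [Finset.sum_comm, ← Finset.sum_sub_distrib]
  refine (Finset.abs_sum_le_sum_abs _ _).trans (Finset.sum_le_sum fun f _ => ?_)
  exact abs_indicator_sub_alternating_sum_le _ _

/-- The expected number of embeddings in terms of spanning trees. -/
lemma treeSum_mul_forestSum {c : V → V → ℝ} (hc : IsNetwork c) {p : W → W} {x : W}
    (hp : IsParentMap p x) (v : V) :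
    treeSum c p x v * forestSum c {v} =
      ∑ σ ∈ forests {v}, wt c {v} σ * (extCard p x σ v : ℝ) := by
  have hpos := forestSum_pos hc (A := {v}) ⟨v, by simp⟩
  have h1 : ∀ f : W → V, (if Function.Injective f ∧ f x = v then
      (∏ s ∈ Finset.univ.erase x, c (f s) (f (p s))) *
        (forestSum c (Finset.univ.image f) / forestSum c {v}) else 0) * forestSum c {v} =
      ∑ σ ∈ forests {v}, if IsExt p x σ v f then wt c {v} σ else 0 := by
    intro f
    by_cases hf : Function.Injective f ∧ f x = v
    · obtain ⟨hf, rfl⟩ := hf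
      rw [if_pos ⟨hf, rfl⟩, mul_assoc, div_mul_cancel₀ _ hpos.ne', ← sum_wt_of_extends hp hf]
      refine Finset.sum_congr rfl fun σ _ => ?_
      congr 1
      exact propext ⟨fun h => ⟨hf, rfl, h⟩, fun h => h.map_parent⟩
    · rw [if_neg hf, zero_mul]
      refine (Finset.sum_eq_zero fun σ _ => if_neg ?_).symm
      exact fun h => hf ⟨h.inj, h.map_root⟩
  rw [treeSum, embFold, Finset.sum_mul, Finset.sum_congr rfl fun f _ => h1 f, Finset.sum_comm]
  refine Finset.sum_congr rfl fun σ _ => ?_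
  rw [← Finset.sum_filter, Finset.sum_const, nsmul_eq_mul, mul_comm, extCard,
    Nat.card_eq_fintype_card, Fintype.card_subtype]

end Extensions

/-! ### Passage to the limit in the inclusion-exclusion. -/

section Limit

open scoped Classical

/-- Convergence of quantities that are squeezed by alternating partial sums. -/
lemma tendsto_of_alternating_bounds {P : ℕ → ℝ} {S : ℕ → ℕ → ℝ} {L : ℕ → ℝ} {ℓ : ℝ}
    (h : ∀ M n, |P n - ∑ m ∈ Finset.range M, (-1) ^ m * S m n| ≤ S M n)
    (hS : ∀ m, Tendsto (S m) atTop (𝓝 (L m)))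
    (hL : HasSum (fun m => (-1) ^ m * L m) ℓ) : Tendsto P atTop (𝓝 ℓ) := by
  -- Summability makes the limiting error `L M` small, so `M` can be fixed before `n` tends to
  -- infinity.
  have hL0 : Tendsto L atTop (𝓝 0) := by
    have := hL.summable.tendsto_atTop_zero.abs
    simp only [abs_mul, abs_pow, abs_neg, abs_one, one_pow, one_mul, abs_zero] at this
    exact (tendsto_zero_iff_abs_tendsto_zero L).2 this
  rw [Metric.tendsto_nhds]
  intro δ hδ
  have h1 := Metric.tendsto_nhds.1 hL.tendsto_sum_nat (δ / 4) (by positivity)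
  have h2 := Metric.tendsto_nhds.1 hL0 (δ / 4) (by positivity)
  obtain ⟨M, hM1, hM2⟩ := (h1.and h2).exists
  have h3 : Tendsto (fun n => ∑ m ∈ Finset.range M, (-1) ^ m * S m n) atTop
      (𝓝 (∑ m ∈ Finset.range M, (-1) ^ m * L m)) :=
    tendsto_finsetSum _ fun m _ => (hS m).const_mul _
  filter_upwards [Metric.tendsto_nhds.1 h3 (δ / 4) (by positivity),
    Metric.tendsto_nhds.1 (hS M) (δ / 4) (by positivity)] with n h4 h5
  have h6 := abs_le.1 (h M n)
  rw [Real.dist_eq, abs_lt] at *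
  constructor <;> linarith [h6.1, h6.2, h4.1, h4.2, h5.1, h5.2, hM1.1, hM1.2, hM2.1, hM2.2]

/-- The part with `a` is the exponential series at `-k`; the part with `m` is the same series
shifted by one and multiplied by `-k`. -/
lemma hasSum_alternating_poisson (k a : ℝ) :
    HasSum (fun m : ℕ => (-1) ^ m * (k ^ m * (a + m) / m.factorial))
      (Real.exp (-k) * (a - k)) := by
  have h1 : HasSum (fun m : ℕ => (-k) ^ m / (m.factorial : ℝ)) (Real.exp (-k)) := by
    rw [Real.exp_eq_exp_ℝ]
    exact NormedSpace.expSeries_div_hasSum_exp (-k)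
  have h2 : HasSum (fun m : ℕ => (m : ℝ) * ((-k) ^ m / (m.factorial : ℝ)))
      (-k * Real.exp (-k)) := by
    rw [← hasSum_nat_add_iff' 1]
    simp only [Finset.range_one, Finset.sum_singleton, Nat.cast_zero, zero_mul, sub_zero]
    refine (h1.mul_left (-k)).congr_fun ?_
    intro m
    rw [Nat.factorial_succ]
    push_cast
    field_simp
    ring
  have h3 := (h1.mul_left a).add h2
  rw [show Real.exp (-k) * (a - k) = a * Real.exp (-k) + -k * Real.exp (-k) by ring]
  refine h3.congr_fun fun m => ?_
  rw [neg_pow k]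
  ring

variable {V : ℕ → Type*} [∀ n, Fintype (V n)] {c : ∀ n, V n → V n → ℝ} {D : ℕ → ℝ}

/-- The expected number of embeddings of a tree into the random spanning tree such that the
vertices in `I` have no further children. -/
theorem tendsto_sum_card_fits (hc : ∀ n, IsNetwork (c n))
    (hreg : ∀ ε : ℝ, 0 < ε → ∀ᶠ n in atTop, IsRegular (c n) (D n) ε) (v : ∀ n, V n)
    {W : Type*} [Fintype W] {p : W → W} {x : W} (hp : IsParentMap p x) (I : Set W) :
    Tendsto (fun n => (∑ σ ∈ forests {v n}, wt (c n) {v n} σ *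
      (Nat.card {f : W → V n // Fits p x I σ (v n) f} : ℝ)) / forestSum (c n) {v n}) atTop
      (𝓝 (Real.exp (-I.ncard) * (Fintype.card W - I.ncard))) := by
  -- There are `|I| ^ m` ways to attach `m` numbered leaves to `I`, and each resulting tree has `|W|
  -- + m` vertices, the limit of its expected number of embeddings.
  refine tendsto_of_alternating_bounds (S := fun m n =>
    (∑ i : Fin m → I, treeSum (c n) (addLeaves p fun j => (i j : W)) (Sum.inl x) (v n)) /
      m.factorial) (L := fun m => (I.ncard : ℝ) ^ m * (Fintype.card W + m) / m.factorial)
    ?_ ?_ (hasSum_alternating_poisson _ _)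
  · intro M n
    have hpos := forestSum_pos (hc n) (A := {v n}) ⟨v n, by simp⟩
    have h1 : ∀ m : ℕ,
        (∑ i : Fin m → I, treeSum (c n) (addLeaves p fun j => (i j : W)) (Sum.inl x) (v n)) /
          m.factorial =
        (∑ σ ∈ forests {v n}, wt (c n) {v n} σ * ((∑ i : Fin m → I,
          (extCard (addLeaves p fun j => (i j : W)) (Sum.inl x) σ (v n) : ℝ)) / m.factorial)) /
            forestSum (c n) {v n} := by
      intro m
      rw [eq_div_iff hpos.ne', div_mul_eq_mul_div, Finset.sum_mul]
      simp only [treeSum_mul_forestSum (hc n) (hp.addLeaves _)]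
      rw [Finset.sum_comm, Finset.sum_div]
      refine Finset.sum_congr rfl fun σ _ => ?_
      rw [← Finset.mul_sum, mul_div_assoc]
    simp only [h1]
    have h2 : ∀ m : ℕ, (-1 : ℝ) ^ m * ((∑ σ ∈ forests {v n}, wt (c n) {v n} σ *
        ((∑ i : Fin m → I,
          (extCard (addLeaves p fun j => (i j : W)) (Sum.inl x) σ (v n) : ℝ)) / m.factorial)) /
            forestSum (c n) {v n}) =
        (∑ σ ∈ forests {v n}, wt (c n) {v n} σ * ((-1) ^ m * ((∑ i : Fin m → I,
          (extCard (addLeaves p fun j => (i j : W)) (Sum.inl x) σ (v n) : ℝ)) / m.factorial))) /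
            forestSum (c n) {v n} := by
      intro m
      rw [← mul_div_assoc, Finset.mul_sum]
      congr 1
      refine Finset.sum_congr rfl fun σ _ => ?_
      ring
    simp only [h2]
    rw [← Finset.sum_div, ← sub_div, abs_div, abs_of_pos hpos, Finset.sum_comm,
      ← Finset.sum_sub_distrib]
    refine div_le_div_of_nonneg_right ?_ hpos.le
    refine (Finset.abs_sum_le_sum_abs _ _).trans (Finset.sum_le_sum fun σ _ => ?_)
    rw [← Finset.mul_sum, ← mul_sub, abs_mul, abs_of_nonneg (wt_nonneg (hc n) _ _)]
    exact mul_le_mul_of_nonneg_left (abs_card_fits_sub_le p x σ (v n) I M)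
      (wt_nonneg (hc n) _ _)
  · intro m
    refine Tendsto.div_const ?_ _
    have h1 : Tendsto (fun n => ∑ i : Fin m → I,
        treeSum (c n) (addLeaves p fun j => (i j : W)) (Sum.inl x) (v n)) atTop
        (𝓝 (∑ _i : Fin m → I, (Fintype.card (W ⊕ Fin m) : ℝ))) :=
      tendsto_finsetSum _ fun i _ => tendsto_treeSum hc hreg v (hp.addLeaves _)
    convert h1 using 2
    rw [Finset.sum_const, Finset.card_univ, Fintype.card_fun, Fintype.card_fin, nsmul_eq_mul,
      Fintype.card_sum, Fintype.card_fin, ← Nat.card_eq_fintype_card (α := I),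
      Nat.card_coe_set_eq]
    push_cast
    rfl

end Limit

/-! ### From multigraphs to networks -/

section MultigraphNetwork

open scoped Classical

variable {α β : Type*} (G : Graph α β)

/-- The number of edges between two distinct vertices. -/
def conductance (x y : V(G)) : ℝ :=
  if x = y then 0 else ({e | G.IsLink e x y}.ncard : ℝ)

variable {G}

lemma conductance_of_ne {x y : V(G)} (h : x ≠ y) :
    conductance G x y = ({e | G.IsLink e x y}.ncard : ℝ) := if_neg h

lemma finite_isLink (hE : E(G).Finite) (x y : α) : {e | G.IsLink e x y}.Finite :=
  hE.subset fun _ he => Graph.IsLink.edge_mem he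

lemma isNetwork_conductance (hE : E(G).Finite) (hconn : IsConnected G) :
    IsNetwork (conductance G) where
  nonneg x y := by
    unfold conductance
    split_ifs <;> positivity
  symm x y := by
    unfold conductance
    simp only [eq_comm (a := x) (b := y), Graph.isLink_comm (x := (x : α))]
  self x := if_pos rfl
  conn v := by
    obtain ⟨σ, hσ, hadj, -⟩ := exists_isParentMap hconn v
    refine ⟨σ, hσ, fun u hu => ?_⟩
    obtain ⟨hne, e, he⟩ := hadj u hu
    rw [conductance_of_ne hne]
    exact_mod_cast (Set.ncard_pos (finite_isLink hE _ _)).2 ⟨e, he⟩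

/-! #### Hitting probabilities -/

lemma otherEnd_eq_iff {x w : α} {e : β} (he : G.Inc e x) : otherEnd G x e = w ↔ G.IsLink e x w := by
  rw [otherEnd, dif_pos he]
  exact ⟨fun h => h ▸ he.isLink_other, fun h => he.isLink_other.right_unique h⟩

lemma isLink_otherEnd {x : α} {e : β} (he : G.Inc e x) : G.IsLink e x (otherEnd G x e) :=
  (otherEnd_eq_iff he).1 rfl

/-- Harmonicity in terms of edges. -/
lemma sum_incidenceSet_eq [Fintype V(G)] {h : α → ℝ} {x : V(G)}
    (hx : ∑ w, conductance G x w * (h x - h w) = 0)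
    (hfin : (G.incidenceSet (x : α)).Finite) :
    ∑ e ∈ hfin.toFinset, h (otherEnd G x e) = hfin.toFinset.card * h x := by
  have h1 : ∑ e ∈ hfin.toFinset, (h x - h (otherEnd G x e)) = 0 := by
    rw [← hx]
    have hmap : ∀ e ∈ hfin.toFinset, G.Inc e x := fun e he => by simpa using he
    have h2 : ∀ e ∈ hfin.toFinset, h x - h (otherEnd G x e) =
        ∑ w : V(G), if otherEnd G x e = w then h x - h w else 0 := by
      intro e he
      have hmem : otherEnd G x e ∈ V(G) := (isLink_otherEnd (hmap e he)).right_mem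
      rw [Finset.sum_eq_single ⟨otherEnd G x e, hmem⟩]
      · rw [if_pos rfl]
      · intro w _ hw
        exact if_neg fun h => hw (Subtype.ext h.symm)
      · simp
    rw [Finset.sum_congr rfl h2, Finset.sum_comm]
    refine Finset.sum_congr rfl fun w _ => ?_
    rw [← Finset.sum_filter, Finset.sum_const, nsmul_eq_mul]
    -- Self-edges contribute zero on both sides, so the network may drop them.
    by_cases hw : x = w
    · subst hw
      simp
    · rw [conductance_of_ne hw]
      congr 2
      rw [← Set.ncard_coe_finset]
      congr 1
      ext e
      simp only [Finset.coe_filter, Set.Finite.mem_toFinset, Graph.mem_incidenceSet,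
        Set.mem_ofPred_eq]
      exact ⟨fun h => (otherEnd_eq_iff h.1).1 h.2, fun h => ⟨h.inc_left,
        (otherEnd_eq_iff h.inc_left).2 h⟩⟩
  rw [Finset.sum_sub_distrib, Finset.sum_const, nsmul_eq_mul, sub_eq_zero] at h1
  exact h1.symm

lemma hitsBefore_cons {x y z : α} {l : List α} (hxy : x ≠ y) (hxz : x ≠ z) :
    HitsBefore y z (x :: l) ↔ HitsBefore y z l := by
  constructor
  · rintro ⟨l₁, l₂, h, hz⟩
    cases l₁ with
    | nil => exact absurd (List.cons.inj h).1 hxy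
    | cons a l₁ =>
      exact ⟨l₁, l₂, (List.cons.inj h).2, fun hmem => hz (List.mem_cons_of_mem _ hmem)⟩
  · rintro ⟨l₁, l₂, rfl, hz⟩
    refine ⟨x :: l₁, l₂, rfl, ?_⟩
    simp only [List.mem_cons, not_or]
    exact ⟨hxz.symm, hz⟩

lemma not_hitsBefore_cons_self {y z : α} {l : List α} (hyz : y ≠ z) :
    ¬ HitsBefore y z (z :: l) := by
  rintro ⟨l₁, l₂, h, hz⟩
  cases l₁ with
  | nil => exact hyz (List.cons.inj h).1.symm
  | cons a l₁ => exact hz (by rw [(List.cons.inj h).1]; exact List.mem_cons_self)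

lemma toOuterMeasure_le_one {γ : Type*} (p : PMF γ) (s : Set γ) : p.toOuterMeasure s ≤ 1 := by
  rw [PMF.toOuterMeasure_apply, ← p.tsum_coe]
  exact ENNReal.tsum_le_tsum fun a => Set.indicator_le_self' (fun _ _ => zero_le) a

/-- The probability of hitting `y` before `z` within `k` steps is dominated by every nonnegative
harmonic function with boundary values `1` at `y` and `0` at `z`. -/
lemma srwPath_hitsBefore_le [Fintype V(G)] {h : α → ℝ} {y z : α}
    (hyz : y ≠ z) (h0 : ∀ x, 0 ≤ h x) (hy : h y = 1)
    (hharm : ∀ x : V(G), (x : α) ≠ y → (x : α) ≠ z →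
      ∑ w, conductance G x w * (h x - h w) = 0) (k : ℕ) (x : V(G)) :
    (srwPath G k x).toOuterMeasure {l | HitsBefore y z l} ≤ ENNReal.ofReal (h x) := by
  induction k generalizing x with
  | zero =>
    by_cases hxy : (x : α) = y
    · rw [hxy, hy, ENNReal.ofReal_one]
      exact toOuterMeasure_le_one _ _
    · rw [srwPath, PMF.toOuterMeasure_pure_apply, if_neg]
      · exact zero_le
      · rintro ⟨l₁, l₂, hl, -⟩
        cases l₁ with
        | nil => exact hxy (List.cons.inj hl).1
        | cons a l₁ => simp at hl
  | succ k ih =>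
    by_cases hxy : (x : α) = y
    · rw [hxy, hy, ENNReal.ofReal_one]
      exact toOuterMeasure_le_one _ _
    -- From `z` itself, `y` can no longer be visited first.
    by_cases hxz : (x : α) = z
    · rw [srwPath, PMF.toOuterMeasure_bind_apply]
      refine le_of_eq_of_le (ENNReal.tsum_eq_zero.2 fun a => ?_) (zero_le)
      rw [PMF.toOuterMeasure_map_apply]
      have : (fun l => (x : α) :: l) ⁻¹' {l | HitsBefore y z l} = ∅ := by
        ext l
        simp only [Set.mem_preimage, Set.mem_ofPred_eq, Set.mem_empty_iff_false, iff_false, hxz]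
        exact not_hitsBefore_cons_self hyz
      rw [this]
      simp
    · have hpre : (fun l => (x : α) :: l) ⁻¹' {l | HitsBefore y z l} = {l | HitsBefore y z l} := by
        ext l
        exact hitsBefore_cons hxy hxz
      rw [srwPath, srwStep]
      split_ifs with hinc
      -- Away from `y` and `z`, the induction hypothesis bounds the probability after the first step
      -- by `h` at the new position, and the average of these values is `h x`.
      · rw [PMF.bind_map, PMF.toOuterMeasure_bind_apply]
        have hterm : ∀ e, PMF.uniformOfFinset hinc.1.toFinset
              (hinc.1.toFinset_nonempty.2 hinc.2) e *
            (((fun y => (srwPath G k y).map fun l => (x : α) :: l) ∘ otherEnd G x) e).toOuterMeasure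
              {l | HitsBefore y z l} ≤
            if e ∈ hinc.1.toFinset then
              ENNReal.ofReal (h (otherEnd G x e) / hinc.1.toFinset.card) else 0 := by
          intro e
          rw [PMF.uniformOfFinset_apply]
          split_ifs with he
          · have hmem : otherEnd G x e ∈ V(G) :=
              (isLink_otherEnd (by simpa using he)).right_mem
            rw [Function.comp_apply, PMF.toOuterMeasure_map_apply, hpre, div_eq_inv_mul,
              ENNReal.ofReal_mul (by positivity)]
            have hcard : 0 < hinc.1.toFinset.card := Finset.card_pos.2 ⟨e, he⟩
            rw [ENNReal.ofReal_inv_of_pos (by exact_mod_cast hcard), ENNReal.ofReal_natCast]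
            gcongr
            exact ih ⟨otherEnd G x e, hmem⟩
          · rw [zero_mul]
        refine (ENNReal.tsum_le_tsum hterm).trans ?_
        rw [tsum_eq_sum (s := hinc.1.toFinset) fun e he => if_neg he,
          Finset.sum_congr rfl fun e he => if_pos he,
          ← ENNReal.ofReal_sum_of_nonneg fun e _ => div_nonneg (h0 _) (Nat.cast_nonneg _),
          ← Finset.sum_div, sum_incidenceSet_eq (hharm x hxy hxz),
          mul_div_cancel_left₀]
        have hcard : 0 < hinc.1.toFinset.card :=
          Finset.card_pos.2 (hinc.1.toFinset_nonempty.2 hinc.2)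
        exact_mod_cast hcard.ne'
      · rw [PMF.pure_bind, PMF.toOuterMeasure_map_apply, hpre]
        exact ih x

/-- The connection probability is a nonnegative harmonic function with value `1` at `y`, so it
dominates the hitting probability at every time horizon. -/
lemma hitProb_le_pairProb [Fintype V(G)] (hE : E(G).Finite) (hconn : IsConnected G)
    {x y z : V(G)} (hyz : y ≠ z) :
    hitProb G x y z ≤ pairProb (conductance G) y z x := by
  have hc := isNetwork_conductance hE hconn
  set h : α → ℝ := fun a => if ha : a ∈ V(G) then pairProb (conductance G) y z ⟨a, ha⟩ else 0
    with hh
  have hval : ∀ w : V(G), h w = pairProb (conductance G) y z w := fun w => dif_pos w.2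
  have h0 : ∀ a, 0 ≤ h a := by
    intro a
    simp only [hh]
    split_ifs
    · exact pairProb_nonneg hc _ _ _
    · exact le_rfl
  have hy : h y = 1 := by rw [hval, pairProb_left hc]
  rw [← hval x, hitProb]
  refine ENNReal.toReal_le_of_le_ofReal (h0 x) (iSup_le fun k => ?_)
  refine srwPath_hitsBefore_le (fun e => hyz (Subtype.ext e)) h0 hy (fun u huy huz => ?_) k x
  simp only [hval]
  exact pairProb_harmonic (fun e => huy (by rw [e])) fun e => huz (by rw [e])

/-- The one-sided comparison is enough: it bounds the connection probabilities to `y` and to `z`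
below by `1/2 - ε`, and these sum to one. Almost sure hitting need not be discussed. -/
lemma isBalanced_conductance [Fintype V(G)] (hE : E(G).Finite) (hconn : IsConnected G) {ε : ℝ}
    (h : ∀ x ∈ V(G), ∀ y ∈ V(G), ∀ z ∈ V(G), x ≠ y → x ≠ z → y ≠ z →
      |hitProb G x y z - 1 / 2| ≤ ε) : IsBalanced (conductance G) ε := by
  intro x y z hxy hxz hyz
  have h1 := (abs_le.1 (h x x.2 y y.2 z z.2 (Subtype.coe_injective.ne hxy)
    (Subtype.coe_injective.ne hxz) (Subtype.coe_injective.ne hyz))).1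
  have h2 := (abs_le.1 (h x x.2 z z.2 y y.2 (Subtype.coe_injective.ne hxz)
    (Subtype.coe_injective.ne hxy) (Subtype.coe_injective.ne hyz.symm))).1
  have h3 := hitProb_le_pairProb hE hconn (x := x) hyz
  have h4 := hitProb_le_pairProb hE hconn (x := x) hyz.symm
  have h5 := pairProb_add (isNetwork_conductance hE hconn) hyz x
  change |pairProb (conductance G) y z x - 1 / 2| ≤ ε
  rw [abs_le]
  constructor <;> linarith

/-! #### Spanning trees -/

lemma subgraphOf_adj {F : Set β} {a b : V(G)} :
    (subgraphOf G F).Adj a b ↔ a ≠ b ∧ ∃ e ∈ F, G.IsLink e a b := by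
  constructor
  · rintro ⟨hne, e, he⟩
    rw [Graph.restrict_isLink] at he
    exact ⟨hne, e, by tauto⟩
  · rintro ⟨hne, e, he, hl⟩
    refine ⟨hne, e, ?_⟩
    rw [Graph.restrict_isLink]
    tauto

/-- If two distinct vertices shared the ends of their parent edges, each would be the parent of the
other. -/
lemma IsParentMap.eq_of_isLink {v : V(G)} {σ : V(G) → V(G)} (hσ : IsParentMap σ v) {u u' : V(G)}
    (hu : u ≠ v) {a b : α} {e e' : β} (h1 : G.IsLink e u (σ u)) (h2 : G.IsLink e' u' (σ u'))
    (h3 : G.IsLink e a b) (h4 : G.IsLink e' a b) : u = u' := by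
  have key : (u : α) = u' ∧ (σ u : α) = σ u' ∨ (u : α) = σ u' ∧ (σ u : α) = u' := by
    rcases h1.eq_and_eq_or_eq_and_eq h3 with ⟨rfl, rfl⟩ | ⟨rfl, rfl⟩
    · rcases h4.eq_and_eq_or_eq_and_eq h2 with h | h <;> tauto
    · rcases h4.eq_and_eq_or_eq_and_eq h2 with h | h <;> tauto
  rcases key with h | ⟨h, h'⟩
  · exact Subtype.ext h.1
  · refine absurd ?_ (hσ.parent_parent_ne hu)
    rw [show σ u = u' from Subtype.ext h', ← show u = σ u' from Subtype.ext h]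

/-- The spanning trees with a given parent map correspond to the choices of an edge between every
vertex and its parent. -/
lemma card_spanningTrees_parentGraph [Fintype V(G)] {v : V(G)} {σ : V(G) → V(G)}
    (hσ : IsParentMap σ v) :
    (Nat.card {F : Set β // IsSpanningTree G F ∧ subgraphOf G F = parentGraph σ} : ℝ) =
      wt (conductance G) {v} σ := by
  have hrange : ∀ g : (u : {u : V(G) // u ≠ v}) → {e // G.IsLink e (u : V(G)) (σ u)},
      subgraphOf G (Set.range fun u => (g u : β)) = parentGraph σ := by
    intro g
    ext a b
    rw [subgraphOf_adj, parentGraph_adj, and_congr_right_iff]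
    intro hne
    constructor
    · rintro ⟨-, ⟨u, rfl⟩, he⟩
      rcases (g u).2.eq_and_eq_or_eq_and_eq he with ⟨h1, h2⟩ | ⟨h1, h2⟩
      · rw [← Subtype.ext h1, ← Subtype.ext h2]
        exact Or.inl rfl
      · rw [← Subtype.ext h1, ← Subtype.ext h2]
        exact Or.inr rfl
    · rintro (rfl | rfl)
      · have ha : a ≠ v := fun e => hne (by rw [e, hσ.root])
        exact ⟨g ⟨a, ha⟩, ⟨⟨a, ha⟩, rfl⟩, (g ⟨a, ha⟩).2⟩
      · have hb : b ≠ v := fun e => hne (by rw [e, hσ.root])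
        exact ⟨g ⟨b, hb⟩, ⟨⟨b, hb⟩, rfl⟩, (g ⟨b, hb⟩).2.symm⟩
  have hspan : ∀ g : (u : {u : V(G) // u ≠ v}) → {e // G.IsLink e (u : V(G)) (σ u)},
      IsSpanningTree G (Set.range fun u => (g u : β)) := by
    intro g
    refine ⟨?_, ?_, ?_⟩
    · rintro - ⟨u, rfl⟩
      exact (g u).2.edge_mem
    · refine @Graph.Simple.mk _ _ _ ⟨?_⟩ ?_
      · intro e a he
        rw [Graph.restrict_isLoopAt] at he
        obtain ⟨he, u, rfl⟩ := he
        have h1 := (g u).2.eq_and_eq_or_eq_and_eq he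
        refine hσ.ne_self u.2 (Subtype.ext ?_)
        rcases h1 with h | h <;> rw [h.1, h.2]
      · intro e f a b he hf
        rw [Graph.restrict_isLink] at he hf
        obtain ⟨⟨u, rfl⟩, he⟩ : e ∈ Set.range (fun u => (g u : β)) ∧ G.IsLink e a b := by tauto
        obtain ⟨⟨u', rfl⟩, hf⟩ : f ∈ Set.range (fun u => (g u : β)) ∧ G.IsLink f a b := by tauto
        have := hσ.eq_of_isLink u.2 (g u).2 (g u').2 he hf
        rw [Subtype.ext this]
    · have h := hrange g
      rw [subgraphOf] at h
      rw [h]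
      exact hσ.isTree
  have hbij : Function.Bijective
      (fun g : (u : {u : V(G) // u ≠ v}) → {e // G.IsLink e (u : V(G)) (σ u)} =>
        (⟨Set.range fun u => (g u : β), hspan g, hrange g⟩ :
          {F : Set β // IsSpanningTree G F ∧ subgraphOf G F = parentGraph σ})) := by
    constructor
    · intro g g' hgg
      have hgg' := congrArg Subtype.val hgg
      dsimp only at hgg'
      funext u
      have hu : (g u : β) ∈ Set.range fun u => (g' u : β) := hgg' ▸ ⟨u, rfl⟩
      obtain ⟨u', hu'⟩ := hu
      dsimp only at hu'
      have h2 := (g' u').2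
      rw [hu'] at h2
      have := hσ.eq_of_isLink u.2 (g u).2 h2 (g u).2 (g u).2
      have huu : u = u' := Subtype.ext this
      subst huu
      exact Subtype.ext hu'.symm
    · rintro ⟨F, hF, hFσ⟩
      have hex : ∀ u : {u : V(G) // u ≠ v}, ∃ e ∈ F, G.IsLink e (u : V(G)) (σ u) := by
        intro u
        have hadj : (subgraphOf G F).Adj u (σ u) := by
          rw [hFσ, parentGraph_adj]
          exact ⟨(hσ.ne_self u.2).symm, Or.inl rfl⟩
        exact (subgraphOf_adj.1 hadj).2
      choose g hgF hg using hex
      refine ⟨fun u => ⟨g u, hg u⟩, Subtype.ext ?_⟩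
      refine Set.Subset.antisymm ?_ ?_
      · rintro - ⟨u, rfl⟩
        exact hgF u
      -- An edge of `F` joins a vertex to its parent, and in the absence of parallel edges in `F` it
      -- is the chosen one.
      · intro e he
        obtain ⟨a, b, hab⟩ := Graph.exists_isLink_of_mem_edgeSet (hF.1 he)
        have hsimple := hF.2.1
        have hl : (G.restrict F).IsLink e a b := by
          rw [Graph.restrict_isLink]
          tauto
        have hadj : (subgraphOf G F).Adj ⟨a, hab.left_mem⟩ ⟨b, hab.right_mem⟩ :=
          subgraphOf_adj.2 ⟨fun h => hl.ne (congrArg Subtype.val h), e, he, hab⟩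
        rw [hFσ, parentGraph_adj] at hadj
        obtain ⟨hne, h1 | h1⟩ := hadj
        · have ha : (⟨a, hab.left_mem⟩ : V(G)) ≠ v := fun h => hne (by rw [← h1, h, hσ.root])
          refine ⟨⟨_, ha⟩, ?_⟩
          have h2 := hg ⟨_, ha⟩
          rw [h1] at h2
          refine Graph.IsLink.eq (G := G.restrict F) (u := a) (v := b) ?_ hl
          rw [Graph.restrict_isLink]
          exact ⟨hgF _, h2⟩
        · have hb : (⟨b, hab.right_mem⟩ : V(G)) ≠ v := fun h => hne (by rw [← h1, h, hσ.root])
          refine ⟨⟨_, hb⟩, ?_⟩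
          have h2 := hg ⟨_, hb⟩
          rw [h1] at h2
          refine Graph.IsLink.eq (G := G.restrict F) (u := a) (v := b) ?_ hl
          rw [Graph.restrict_isLink]
          exact ⟨hgF _, h2.symm⟩
  rw [← Nat.card_congr (Equiv.ofBijective _ hbij), Nat.card_pi]
  push_cast
  rw [wt, Finset.prod_subtype (p := fun u => u ≠ v) _ (by simp)]
  refine Finset.prod_congr rfl fun u _ => ?_
  rw [conductance_of_ne (hσ.ne_self u.2).symm]
  rfl

/-- Spanning trees with a given property, counted by parent maps. -/
lemma ncard_spanningTrees [Fintype V(G)] (hE : E(G).Finite) (v : V(G))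
    (P : SimpleGraph V(G) → Prop) :
    ({F : Set β | IsSpanningTree G F ∧ P (subgraphOf G F)}.ncard : ℝ) =
      ∑ σ ∈ forests {v}, if P (parentGraph σ) then wt (conductance G) {v} σ else 0 := by
  have hbij : Function.Bijective
      (fun q : (σ : {σ : V(G) → V(G) // IsParentMap σ v ∧ P (parentGraph σ)}) ×
          {F : Set β // IsSpanningTree G F ∧ subgraphOf G F = parentGraph σ.1} =>
        (⟨q.2.1, q.2.2.1, by rw [q.2.2.2]; exact q.1.2.2⟩ :
          {F : Set β | IsSpanningTree G F ∧ P (subgraphOf G F)})) := by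
    constructor
    · rintro ⟨⟨σ, hσ⟩, F, hF⟩ ⟨⟨σ', hσ'⟩, F', hF'⟩ h
      have hFF : F = F' := congrArg Subtype.val h
      subst hFF
      have hσσ : σ = σ' := hσ.1.eq_of_parentGraph_eq hσ'.1 (hF.2.symm.trans hF'.2)
      subst hσσ
      rfl
    · rintro ⟨F, hF, hP⟩
      obtain ⟨σ, hσ, hT, -⟩ := exists_eq_parentGraph (T := subgraphOf G F) hF.2.2 v
      exact ⟨⟨⟨σ, hσ, hT ▸ hP⟩, F, hF, hT⟩, rfl⟩
  have hfin : ∀ σ : V(G) → V(G),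
      Finite {F : Set β // IsSpanningTree G F ∧ subgraphOf G F = parentGraph σ} := fun σ =>
    Set.Finite.to_subtype (s := {F | IsSpanningTree G F ∧ subgraphOf G F = parentGraph σ})
      (hE.finite_subsets.subset fun F hF => hF.1.1)
  rw [← Nat.card_coe_set_eq, ← Nat.card_congr (Equiv.ofBijective _ hbij), Nat.card_sigma]
  push_cast
  rw [← Finset.sum_filter, Finset.sum_subtype (p := fun σ => IsParentMap σ v ∧ P (parentGraph σ))]
  · exact Finset.sum_congr rfl fun σ _ => card_spanningTrees_parentGraph σ.2.1
  · intro σ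
    rw [Finset.mem_filter, mem_forests, isForest_singleton_iff]

/-- The law of the truncation of the uniform spanning tree in terms of weighted embeddings. -/
lemma ustTruncProb_mul_autCard [Fintype V(G)] (hE : E(G).Finite) (v : V(G)) {W : Type*}
    {p : W → W} {x : W} (hp : IsParentMap p x) {r : ℕ}
    (hr : ∀ w, (parentGraph p).dist x w ≤ r) :
    ustTruncProb G v r (parentGraph p) x * autCard (parentGraph p) x =
      (∑ σ ∈ forests {v}, wt (conductance G) {v} σ *
        (Nat.card {f : W → V(G) // Fits p x {w | (parentGraph p).dist x w < r} σ v f} : ℝ)) /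
        forestSum (conductance G) {v} := by
  have h1 := ncard_spanningTrees hE v fun T => TruncationIs T v r (parentGraph p) x
  have h2 := ncard_spanningTrees hE v fun _ => True
  simp only [and_true, if_true] at h2
  rw [ustTruncProb, h1, h2, ← forestSum, div_mul_eq_mul_div, Finset.sum_mul]
  congr 1
  refine Finset.sum_congr rfl fun σ hσ => ?_
  rw [card_fits hp (mem_forests.1 hσ).isParentMap hr]
  split_ifs <;> simp

/-- Convergence of the local law of the uniform spanning tree. -/
theorem tendsto_ustTruncProb {α β : ℕ → Type*} (G : ∀ n, Graph (α n) (β n))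
    (hV : ∀ n, V(G n).Finite) (hE : ∀ n, E(G n).Finite) (hconn : ∀ n, IsConnected (G n))
    (hsize : Tendsto (fun n => V(G n).ncard) atTop atTop) (hG : IsGinoRegular G)
    (v : ∀ n, V(G n)) {W : Type*} [Fintype W] {p : W → W} {x : W} (hp : IsParentMap p x) {r : ℕ}
    (hr : ∀ w, (parentGraph p).dist x w ≤ r) :
    Tendsto (fun n => ustTruncProb (G n) (v n) r (parentGraph p) x * autCard (parentGraph p) x)
      atTop (𝓝 (Real.exp (-{w | (parentGraph p).dist x w < r}.ncard) *
        (Fintype.card W - {w | (parentGraph p).dist x w < r}.ncard))) := by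
  have : ∀ n, Fintype V(G n) := fun n => (hV n).fintype
  have hc := fun n => isNetwork_conductance (hE n) (hconn n)
  simp only [fun n => ustTruncProb_mul_autCard (hE n) (v n) hp hr]
  -- The reference degree is that of `v n` in the network without self-edges.
  refine tendsto_sum_card_fits (D := fun n => deg (conductance (G n)) (v n)) hc ?_ v hp _
  intro ε hε
  obtain ⟨-, -, hhit⟩ := hG
  have hcard : ∀ n, V(G n).ncard = Fintype.card V(G n) := fun n => by
    rw [← Nat.card_eq_fintype_card, Nat.card_coe_set_eq]
  have hlim : Tendsto (fun n => 2 / ((Fintype.card V(G n) : ℝ) - 1)) atTop (𝓝 0) := by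
    refine Tendsto.const_div_atTop (tendsto_atTop_add_const_right _ (-1) ?_) 2
    simp only [← hcard]
    exact tendsto_natCast_atTop_atTop.comp hsize
  -- This makes `8 * ε₁ ≤ ε / 2`, leaving the other half for `2 / (card - 1)`; `1 / 6` is the
  -- threshold of `isRegular`.
  set ε₁ : ℝ := min (1 / 6) (ε / 16) with hε₁
  have hε₁0 : 0 < ε₁ := by positivity
  have hε₁' : ε₁ ≤ ε / 16 := min_le_right _ _
  filter_upwards [hhit ε₁ hε₁0, hsize.eventually_ge_atTop 2,
    hlim.eventually (gt_mem_nhds (half_pos hε))] with n h1 h2 h3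
  rw [hcard] at h2
  have h4 := (isBalanced_conductance (hE n) (hconn n) h1).isRegular (hc n) hε₁0.le
    (min_le_left _ _) h2 (v n)
  have hle : 8 * ε₁ + 2 / ((Fintype.card V(G n) : ℝ) - 1) ≤ ε := by linarith
  exact ⟨h4.pos, fun y => (h4.deg_le y).trans (mul_le_mul_of_nonneg_right hle h4.pos.le),
    fun y z => (h4.small y z).trans (mul_le_mul_of_nonneg_right hle h4.pos.le),
    fun a b d h5 h6 h7 => (h4.balanced a b d h5 h6 h7).trans hle⟩

end MultigraphNetwork

/-! ### Labelled embeddings of a finite tree -/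

section Labels

open scoped Classical

variable {W : Type*}

/-- `dep` is the distance to the root in a tree of height at most `r`. -/
structure IsDepth (p : W → W) (x : W) (dep : W → ℕ) (r : ℕ) : Prop where
  root : dep x = 0
  succ : ∀ w, w ≠ x → dep w = dep (p w) + 1
  le : ∀ w, dep w ≤ r

/-- `Q` is a path that starts at the root. -/
structure IsSpine (p : W → W) (x : W) (dep : W → ℕ) (Q : Set W) : Prop where
  root : x ∈ Q
  parent : ∀ w ∈ Q, p w ∈ Q
  inj : Set.InjOn dep Q

/-- `f` places the path `Q` on the spine and labels the other children of every vertex `w` by the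
numbers smaller than `ω (f w)`, using all of them if `dep w < r`. -/
structure Compat (p : W → W) (dep : W → ℕ) (r : ℕ) (Q : Set W) (ω : ℕ × List ℕ → ℕ)
    (f : W → ℕ × List ℕ) : Prop where
  inj : Function.Injective f
  spine : ∀ w ∈ Q, f w = (dep w, [])
  child : ∀ u, u ∉ Q → ∃ k < ω (f (p u)), f u = ((f (p u)).1, (f (p u)).2 ++ [k])
  surj : ∀ w, dep w < r → ∀ k < ω (f w), ∃ u, u ∉ Q ∧ p u = w ∧ f u = ((f w).1, (f w).2 ++ [k])

/-- The children of `w` outside `Q`. -/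
abbrev OffChildren (p : W → W) (Q : Set W) (w : W) : Type _ := {u : W // u ∉ Q ∧ p u = w}

/-- The number of children outside `Q`. -/
def offCard (p : W → W) (Q : Set W) (w : W) : ℕ := Nat.card (OffChildren p Q w)

/-- An enumeration of the children outside `Q` of every vertex. -/
abbrev Labelling (p : W → W) (Q : Set W) : Type _ :=
  (w : W) → OffChildren p Q w ≃ Fin (offCard p Q w)

/-- The label of a vertex. -/
def Labelling.label {p : W → W} {Q : Set W} (e : Labelling p Q) (u : W) : ℕ :=
  if h : u ∈ Q then 0 else e (p u) ⟨u, h, rfl⟩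

/-- The position of a vertex, computed from its `n` nearest ancestors. -/
def placeAux (p : W → W) (dep : W → ℕ) (Q : Set W) (ℓ : W → ℕ) : ℕ → W → ℕ × List ℕ
  | 0, w => (dep w, [])
  | n + 1, w => if w ∈ Q then (dep w, []) else
      ((placeAux p dep Q ℓ n (p w)).1, (placeAux p dep Q ℓ n (p w)).2 ++ [ℓ w])

/-- The position of a vertex determined by a labelling. -/
def Labelling.place {p : W → W} (dep : W → ℕ) {Q : Set W} (e : Labelling p Q) (w : W) :
    ℕ × List ℕ :=
  placeAux p dep Q e.label (dep w) w

variable {p : W → W} {x : W} {dep : W → ℕ} {r : ℕ} {Q : Set W}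

lemma place_of_mem (e : Labelling p Q) {w : W} (hw : w ∈ Q) : e.place dep w = (dep w, []) := by
  rw [Labelling.place]
  generalize hn : dep w = n
  cases n with
  | zero => rw [placeAux, hn]
  | succ n => rw [placeAux, if_pos hw, hn]

lemma IsSpine.ne_of_notMem (hQ : IsSpine p x dep Q) {w : W} (hw : w ∉ Q) : w ≠ x :=
  fun h => hw (h ▸ hQ.root)

lemma place_of_notMem (hd : IsDepth p x dep r) (hQ : IsSpine p x dep Q) (e : Labelling p Q) {w : W}
    (hw : w ∉ Q) :
    e.place dep w = ((e.place dep (p w)).1, (e.place dep (p w)).2 ++ [e.label w]) := by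
  rw [Labelling.place, hd.succ w (hQ.ne_of_notMem hw), placeAux, if_neg hw]
  rfl

lemma Labelling.label_of_notMem (e : Labelling p Q) {u w : W} (hu : u ∉ Q) (hw : p u = w) :
    e.label u = e w ⟨u, hu, hw⟩ := by
  subst hw
  exact dif_neg hu

/-- Positions in the right shape have the right depth. -/
lemma fst_add_length_eq (hp : IsParentMap p x) (hd : IsDepth p x dep r) (hQ : IsSpine p x dep Q)
    {f : W → ℕ × List ℕ} (h1 : ∀ w ∈ Q, f w = (dep w, []))
    (h2 : ∀ u, u ∉ Q → ∃ k, f u = ((f (p u)).1, (f (p u)).2 ++ [k])) (w : W) :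
    (f w).1 + (f w).2.length = dep w := by
  refine hp.induction (P := fun w => (f w).1 + (f w).2.length = dep w) ?_ ?_ w
  · rw [h1 x hQ.root]
    simp
  · intro u hu ih
    by_cases huQ : u ∈ Q
    · rw [h1 u huQ]
      simp
    · obtain ⟨k, hk⟩ := h2 u huQ
      rw [hk, hd.succ u hu]
      simp only [List.length_append, List.length_singleton]
      omega

/-- A position reveals the depth of its vertex, whether the vertex is on `Q` (empty word) and, off
`Q`, the position of the parent and the label; induction towards the root concludes. -/
lemma place_injective (hp : IsParentMap p x) (hd : IsDepth p x dep r) (hQ : IsSpine p x dep Q)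
    (e : Labelling p Q) : Function.Injective (e.place dep) := by
  have hlen := fst_add_length_eq hp hd hQ (f := e.place dep) (fun w hw => place_of_mem e hw)
    fun u hu => ⟨_, place_of_notMem hd hQ e hu⟩
  intro a
  refine hp.induction (P := fun a => ∀ b, e.place dep a = e.place dep b → a = b) ?_ ?_ a
  · intro b hb
    have h1 := hlen b
    rw [← hb, hlen x, hd.root] at h1
    by_contra hne
    have := hd.succ b (Ne.symm hne)
    omega
  · intro a ha ih b hb
    have hdep : dep a = dep b := by rw [← hlen a, ← hlen b, hb]
    by_cases haQ : a ∈ Q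
    · by_cases hbQ : b ∈ Q
      · exact hQ.inj haQ hbQ hdep
      · rw [place_of_mem e haQ, place_of_notMem hd hQ e hbQ] at hb
        simp at hb
    · by_cases hbQ : b ∈ Q
      · rw [place_of_mem e hbQ, place_of_notMem hd hQ e haQ] at hb
        simp at hb
      · rw [place_of_notMem hd hQ e haQ, place_of_notMem hd hQ e hbQ, Prod.mk.injEq] at hb
        obtain ⟨h1, h2⟩ := hb
        obtain ⟨h2, h3⟩ : (e.place dep (p a)).2 = (e.place dep (p b)).2 ∧ e.label a = e.label b := by
          simpa using h2
        have hpar : p a = p b := ih (p b) (Prod.ext h1 h2)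
        rw [e.label_of_notMem haQ hpar, e.label_of_notMem hbQ rfl] at h3
        exact congrArg Subtype.val ((e (p b)).injective (Fin.ext h3))

/-- At depth `r` the finite tree has no children, so labellings carry no information there, just as
`Compat` does not require every potential child to be used. -/
lemma isEmpty_offChildren (hd : IsDepth p x dep r) (hQ : IsSpine p x dep Q) {w : W}
    (hw : ¬ dep w < r) : IsEmpty (OffChildren p Q w) := by
  refine ⟨fun u => ?_⟩
  have h1 := hd.succ u (hQ.ne_of_notMem u.2.1)
  have h2 := hd.le u
  rw [u.2.2] at h1
  omega

lemma offCard_eq_zero (hd : IsDepth p x dep r) (hQ : IsSpine p x dep Q) {w : W}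
    (hw : ¬ dep w < r) : offCard p Q w = 0 := by
  have := isEmpty_offChildren hd hQ hw
  exact Nat.card_of_isEmpty

lemma IsDepth.parent_lt (hd : IsDepth p x dep r) {w : W} (hw : w ≠ x) : dep (p w) < r := by
  have h1 := hd.succ w hw
  have h2 := hd.le w
  omega

lemma compat_place (hp : IsParentMap p x) (hd : IsDepth p x dep r) (hQ : IsSpine p x dep Q)
    (e : Labelling p Q) {ω : ℕ × List ℕ → ℕ}
    (hω : ∀ w, dep w < r → ω (e.place dep w) = offCard p Q w) :
    Compat p dep r Q ω (e.place dep) where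
  inj := place_injective hp hd hQ e
  spine w hw := place_of_mem e hw
  child u hu := by
    refine ⟨e.label u, ?_, place_of_notMem hd hQ e hu⟩
    rw [hω _ (hd.parent_lt (hQ.ne_of_notMem hu)), e.label_of_notMem hu rfl]
    exact Fin.is_lt _
  surj w hw k hk := by
    rw [hω w hw] at hk
    obtain ⟨u, hu⟩ := (e w).surjective ⟨k, hk⟩
    refine ⟨u, u.2.1, u.2.2, ?_⟩
    rw [place_of_notMem hd hQ e u.2.1, e.label_of_notMem u.2.1 u.2.2]
    have : e w ⟨u, u.2.1, u.2.2⟩ = ⟨k, hk⟩ := hu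
    rw [this, show p u = w from u.2.2]

/-- Compatible placements correspond to labellings. -/
def compatEquiv (hp : IsParentMap p x) (hd : IsDepth p x dep r) (hQ : IsSpine p x dep Q)
    (ω : ℕ × List ℕ → ℕ) :
    {e : Labelling p Q // ∀ w, dep w < r → ω (e.place dep w) = offCard p Q w} ≃
      {f : W → ℕ × List ℕ // Compat p dep r Q ω f} := by
  refine Equiv.ofBijective
    (fun e => ⟨e.1.place dep, compat_place hp hd hQ e.1 e.2⟩) ⟨?_, ?_⟩
  · rintro ⟨e, he⟩ ⟨e', he'⟩ h
    have h' : e.place dep = e'.place dep := congrArg Subtype.val h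
    refine Subtype.ext (funext fun w => Equiv.ext fun u => Fin.ext ?_)
    have h1 := congrFun h' u
    rw [place_of_notMem hd hQ e u.2.1, place_of_notMem hd hQ e' u.2.1, h'] at h1
    have h2 : e.label u = e'.label u := by simpa using h1
    rwa [e.label_of_notMem u.2.1 u.2.2, e'.label_of_notMem u.2.1 u.2.2] at h2
  · rintro ⟨f, hf⟩
    -- The last letters of the positions are the labels; `child` and `surj` make them a bijection
    -- from the off-`Q` children of `w` onto `Fin (ω (f w))`, which also identifies `ω (f w)`.
    choose! ℓ hℓ hfℓ using hf.child
    have hbij : ∀ w, dep w < r → Function.Bijective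
        (fun u : OffChildren p Q w => (⟨ℓ u, by
          have := hℓ u u.2.1
          rwa [u.2.2] at this⟩ : Fin (ω (f w)))) := by
      intro w hw
      constructor
      · intro u u' h
        have h1 : ℓ u = ℓ u' := congrArg Fin.val h
        refine Subtype.ext (hf.inj ?_)
        rw [hfℓ u u.2.1, hfℓ u' u'.2.1, u.2.2, u'.2.2, h1]
      · intro k
        obtain ⟨u, hu, hpu, hfu⟩ := hf.surj w hw k k.2
        refine ⟨⟨u, hu, hpu⟩, Fin.ext ?_⟩
        have h1 := hfℓ u hu
        rw [hfu, hpu] at h1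
        have : (k : ℕ) = ℓ u := by simpa using h1
        exact this.symm
    have hcard : ∀ w, dep w < r → ω (f w) = offCard p Q w := by
      intro w hw
      rw [offCard, Nat.card_congr (Equiv.ofBijective _ (hbij w hw)), Nat.card_eq_fintype_card,
        Fintype.card_fin]
    have hex : ∀ w, ∃ ew : OffChildren p Q w ≃ Fin (offCard p Q w), ∀ u, (ew u : ℕ) = ℓ u := by
      intro w
      by_cases hw : dep w < r
      · exact ⟨(Equiv.ofBijective _ (hbij w hw)).trans (finCongr (hcard w hw)), fun u => rfl⟩
      · have := isEmpty_offChildren hd hQ hw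
        have h0 := offCard_eq_zero hd hQ hw
        exact ⟨(Equiv.equivOfIsEmpty _ (Fin 0)).trans (finCongr h0.symm), fun u => isEmptyElim u⟩
    choose e he using hex
    have hplace : Labelling.place dep e = f := by
      funext w
      refine hp.induction (P := fun w => Labelling.place dep e w = f w) ?_ ?_ w
      · rw [place_of_mem e hQ.root, hf.spine x hQ.root]
      · intro u _ ih
        by_cases hu : u ∈ Q
        · rw [place_of_mem e hu, hf.spine u hu]
        · rw [place_of_notMem hd hQ e hu, ih, hfℓ u hu, Labelling.label_of_notMem e hu rfl, he]
    exact ⟨⟨e, fun w hw => by rw [hplace, hcard w hw]⟩, Subtype.ext hplace⟩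

lemma card_labelling [Fintype W] (p : W → W) (Q : Set W) :
    Nat.card (Labelling p Q) = ∏ w, (offCard p Q w).factorial := by
  rw [Nat.card_pi]
  refine Finset.prod_congr rfl fun w => ?_
  intro _
  have e : OffChildren p Q w ≃ Fin (offCard p Q w) := Finite.equivFin _
  rw [Nat.card_eq_fintype_card, Fintype.card_equiv e, ← Nat.card_eq_fintype_card]
  rfl

end Labels

/-! ### Family trees and trees with a spine -/

section FamilyTrees

open scoped Classical

lemma mem_gwVertices_concat {ξ : List ℕ → ℕ} {u : List ℕ} {k : ℕ} :
    u ++ [k] ∈ gwVertices ξ ↔ u ∈ gwVertices ξ ∧ k < ξ u := by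
  constructor
  · intro h
    exact ⟨fun w j hw => h w j (hw.trans (List.prefix_append u [k])), h u k List.prefix_rfl⟩
  · rintro ⟨h, hk⟩ w j hw
    rcases List.prefix_concat_iff.1 hw with hw | hw
    · obtain ⟨rfl, rfl⟩ : w = u ∧ j = k := by simpa using hw
      exact hk
    · exact h w j hw

lemma dropLast_mem_gwVertices {ξ : List ℕ → ℕ} {u : List ℕ} (h : u ∈ gwVertices ξ) :
    u.dropLast ∈ gwVertices ξ :=
  fun w k hw => h w k (hw.trans (List.dropLast_prefix u))

/-- The parent map of the family tree. -/
def gwParent (ξ : List ℕ → ℕ) (u : gwVertices ξ) : gwVertices ξ :=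
  ⟨u.1.dropLast, dropLast_mem_gwVertices u.2⟩

lemma parentChild_iff {u w : List ℕ} :
    ParentChild u w ↔ u ≠ w ∧ (u.dropLast = w ∨ w.dropLast = u) := by
  constructor
  · intro h
    refine ⟨fun e => not_parentChild_self u (e ▸ h), ?_⟩
    rcases h with ⟨k, rfl⟩ | ⟨k, rfl⟩ <;> simp
  · rintro ⟨hne, h | h⟩
    · refine Or.inr ?_
      rcases List.eq_nil_or_concat u with rfl | ⟨u', k, rfl⟩
      · exact absurd h hne
      · exact ⟨k, by simpa using h⟩
    · refine Or.inl ?_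
      rcases List.eq_nil_or_concat w with rfl | ⟨w', k, rfl⟩
      · exact absurd h.symm hne
      · exact ⟨k, by simpa using h⟩

lemma gwTree_eq (ξ : List ℕ → ℕ) : gwTree ξ = parentGraph (gwParent ξ) := by
  ext u w
  rw [parentGraph_adj]
  change ParentChild u.1 w.1 ↔ _
  rw [parentChild_iff]
  simp only [gwParent, Subtype.ext_iff, ne_eq]

lemma isParentMap_gwParent (ξ : List ℕ → ℕ) : IsParentMap (gwParent ξ) (gwRoot ξ) := by
  refine ⟨rfl, fun u => ⟨u.1.length, ?_⟩⟩
  have h : ∀ n (u : gwVertices ξ), u.1.length = n → (gwParent ξ)^[n] u = gwRoot ξ := by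
    intro n
    induction n with
    | zero => exact fun u hu => Subtype.ext (List.length_eq_zero_iff.1 hu)
    | succ n ih =>
      intro u hu
      exact ih _ (by simp [gwParent, hu])
  exact h _ u rfl

/-- The parent of a position in a tree with a spine. -/
def spinePos (q : ℕ × List ℕ) : ℕ × List ℕ :=
  if q.2 = [] then (q.1 - 1, []) else (q.1, q.2.dropLast)

lemma spinePos_concat (i : ℕ) (u : List ℕ) (k : ℕ) : spinePos (i, u ++ [k]) = (i, u) := by
  simp [spinePos]

lemma spinePos_nil (i : ℕ) : spinePos (i, []) = (i - 1, []) := by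
  simp [spinePos]

lemma spinePos_mem {ω : ℕ → List ℕ → ℕ} {q : ℕ × List ℕ} (h : q ∈ spineVertices ω) :
    spinePos q ∈ spineVertices ω := by
  unfold spinePos
  split_ifs
  · exact nil_mem_gwVertices _
  · exact dropLast_mem_gwVertices (u := q.2) h

/-- The parent map of a tree with a spine. -/
def spineParent (ω : ℕ → List ℕ → ℕ) (q : spineVertices ω) : spineVertices ω :=
  ⟨spinePos q.1, spinePos_mem q.2⟩

lemma spineTree_eq (ω : ℕ → List ℕ → ℕ) : spineTree ω = parentGraph (spineParent ω) := by
  ext ⟨⟨i, u⟩, hu⟩ ⟨⟨j, w⟩, hw⟩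
  rw [parentGraph_adj]
  change ((i = j ∧ ParentChild u w) ∨ (u = [] ∧ w = [] ∧ (j = i + 1 ∨ i = j + 1))) ↔ _
  rw [parentChild_iff]
  simp only [spineParent, spinePos, Subtype.mk.injEq, ne_eq, Prod.mk.injEq]
  rcases List.eq_nil_or_concat u with rfl | ⟨u', k, rfl⟩ <;>
  rcases List.eq_nil_or_concat w with rfl | ⟨w', l, rfl⟩
  · simp
    omega
  · simp
    exact fun _ => eq_comm
  · simp
  · simp
    tauto

lemma isParentMap_spineParent (ω : ℕ → List ℕ → ℕ) :
    IsParentMap (spineParent ω) (spineRoot ω) := by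
  refine ⟨Subtype.ext (spinePos_nil 0), fun q => ⟨q.1.1 + q.1.2.length, ?_⟩⟩
  have h : ∀ n (q : spineVertices ω), q.1.1 + q.1.2.length = n →
      (spineParent ω)^[n] q = spineRoot ω := by
    intro n
    induction n with
    | zero =>
      rintro ⟨⟨i, u⟩, hu⟩ hq
      obtain ⟨rfl, h2⟩ := Nat.add_eq_zero_iff.1 hq
      obtain rfl := List.length_eq_zero_iff.1 h2
      rfl
    | succ n ih =>
      rintro ⟨⟨i, u⟩, hu⟩ hq
      refine ih _ ?_
      simp only [spineParent, spinePos]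
      split_ifs with h
      · have h' : u = [] := h
        subst h'
        simp at hq ⊢
        omega
      · have := List.length_pos_iff.2 h
        simp only [List.length_dropLast] at hq this ⊢
        omega
  exact h _ q rfl

/-! ### Exact embeddings into the limit trees as compatible placements. -/

variable {W : Type*} {p : W → W} {x : W} {dep : W → ℕ} {r : ℕ}

lemma isSpine_singleton (hp : IsParentMap p x) (dep : W → ℕ) : IsSpine p x dep {x} :=
  ⟨rfl, fun w hw => by rw [Set.mem_singleton_iff.1 hw, hp.root]; rfl, Set.injOn_singleton _ _⟩

lemma exists_eq_concat {u : List ℕ} (h : u ≠ []) : ∃ k, u = u.dropLast ++ [k] :=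
  ⟨u.getLast h, (List.dropLast_append_getLast h).symm⟩

/-- Embeddings into a family tree are compatible placements. -/
lemma card_fits_gw (hp : IsParentMap p x) (hd : IsDepth p x dep r) (ξ : List ℕ → ℕ) :
    Nat.card {f : W → gwVertices ξ // Fits p x {w | dep w < r} (gwParent ξ) (gwRoot ξ) f} =
      Nat.card {f : W → ℕ × List ℕ // Compat p dep r {x} (fun q => ξ q.2) f} := by
  -- With the one-vertex spine `{x}` the first coordinate stays `0`, so positions are just words.
  have hback : ∀ g : W → ℕ × List ℕ, Compat p dep r {x} (fun q => ξ q.2) g →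
      ∀ w, (g w).1 = 0 ∧ (g w).2 ∈ gwVertices ξ := by
    intro g hg
    refine hp.induction ?_ fun u hu ih => ?_
    · rw [hg.spine x rfl]
      exact ⟨hd.root, nil_mem_gwVertices _⟩
    · obtain ⟨k, hk, hgu⟩ := hg.child u hu
      rw [hgu]
      exact ⟨ih.1, mem_gwVertices_concat.2 ⟨ih.2, hk⟩⟩
  refine Nat.card_congr ⟨fun f => ⟨fun w => (0, (f.1 w).1), ?_, ?_, ?_, ?_⟩,
    fun g => ⟨fun w => ⟨(g.1 w).2, (hback g.1 g.2 w).2⟩, ?_, ?_, ?_, ?_⟩, ?_, ?_⟩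
  · intro a b hab
    exact f.2.inj (Subtype.ext (Prod.ext_iff.1 hab).2)
  · intro w hw
    rw [Set.mem_singleton_iff.1 hw, f.2.map_root, hd.root]
    rfl
  · intro u hu
    have hne : (f.1 u).1 ≠ [] := fun h =>
      hu (f.2.inj ((Subtype.ext h : f.1 u = gwRoot ξ).trans f.2.map_root.symm))
    obtain ⟨k, hk⟩ := exists_eq_concat hne
    have hpar : (f.1 u).1.dropLast = (f.1 (p u)).1 := congrArg Subtype.val (f.2.map_parent u)
    rw [hpar] at hk
    have hmem := (f.1 u).2
    rw [hk] at hmem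
    refine ⟨k, (mem_gwVertices_concat.1 hmem).2, ?_⟩
    rw [hk]
  · intro w hw k hk
    have hmem : (f.1 w).1 ++ [k] ∈ gwVertices ξ := mem_gwVertices_concat.2 ⟨(f.1 w).2, hk⟩
    have hpar : gwParent ξ ⟨(f.1 w).1 ++ [k], hmem⟩ = f.1 w :=
      Subtype.ext (by simp [gwParent])
    obtain ⟨u, hu⟩ := f.2.mem_range ⟨_, hmem⟩ ⟨w, hw, hpar.symm⟩
    have hu' : (f.1 u).1 = (f.1 w).1 ++ [k] := congrArg Subtype.val hu
    refine ⟨u, ?_, f.2.inj (by rw [← f.2.map_parent, hu, hpar]), by rw [hu']⟩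
    rintro rfl
    rw [f.2.map_root] at hu'
    simp [gwRoot] at hu'
  · intro a b hab
    refine g.2.inj (Prod.ext ?_ (congrArg Subtype.val hab))
    rw [(hback g.1 g.2 a).1, (hback g.1 g.2 b).1]
  · exact Subtype.ext (by simp [g.2.spine x rfl, gwRoot])
  · intro w
    refine Subtype.ext ?_
    by_cases hw : w = x
    · simp [hw, gwParent, hp.root, g.2.spine x rfl]
    · obtain ⟨k, -, hgw⟩ := g.2.child w hw
      simp [gwParent, hgw]
  · rintro u ⟨w, hw, hwu⟩
    have hpar : u.1.dropLast = (g.1 w).2 := (congrArg Subtype.val hwu).symm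
    by_cases hne : u.1 = []
    · exact ⟨x, Subtype.ext (by simp [g.2.spine x rfl, hne])⟩
    · obtain ⟨k, hk⟩ := exists_eq_concat hne
      rw [hpar] at hk
      have hmem := u.2
      rw [hk] at hmem
      obtain ⟨u', -, -, hu'⟩ := g.2.surj w hw k (mem_gwVertices_concat.1 hmem).2
      exact ⟨u', Subtype.ext (by simp [hu', hk])⟩
  · intro f
    rfl
  · intro g
    refine Subtype.ext (funext fun w => Prod.ext ?_ rfl)
    exact (hback g.1 g.2 w).1.symm

lemma IsDepth.parent_eq (hp : IsParentMap p x) (hd : IsDepth p x dep r) (w : W) :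
    dep (p w) = dep w - 1 := by
  by_cases hw : w = x
  · rw [hw, hp.root, hd.root]
  · rw [hd.succ w hw, Nat.add_sub_cancel]

lemma IsDepth.iterate_eq (hp : IsParentMap p x) (hd : IsDepth p x dep r) (w : W) (n : ℕ) :
    dep (p^[n] w) = dep w - n := by
  induction n with
  | zero => rfl
  | succ n ih => rw [Function.iterate_succ_apply', hd.parent_eq hp, ih, Nat.sub_sub]

lemma IsDepth.eq_root (hd : IsDepth p x dep r) {w : W} (hw : dep w = 0) : w = x := by
  by_contra h
  have := hd.succ w h
  omega

/-- The path from the root to `b`. -/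
lemma isSpine_reach (hp : IsParentMap p x) (hd : IsDepth p x dep r) (b : W) :
    IsSpine p x dep {w | Reach p b w} := by
  refine ⟨hp.reach b, fun w hw => Reach.trans hw (Reach.single p w), ?_⟩
  have key : ∀ m n, m ≤ n → dep (p^[m] b) = dep (p^[n] b) → p^[m] b = p^[n] b := by
    intro m n hmn h
    rw [hd.iterate_eq hp, hd.iterate_eq hp] at h
    by_cases hm : dep b ≤ m
    · rw [hd.eq_root (w := p^[m] b) (by rw [hd.iterate_eq hp]; omega),
        hd.eq_root (w := p^[n] b) (by rw [hd.iterate_eq hp]; omega)]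
    · rw [show m = n by omega]
  rintro _ ⟨m, rfl⟩ _ ⟨n, rfl⟩ h
  rcases le_total m n with hmn | hmn
  · exact key m n hmn h
  · exact (key n m hmn h.symm).symm

lemma spineVertices_concat {ω : ℕ → List ℕ → ℕ} {i : ℕ} {u : List ℕ} {k : ℕ} :
    (i, u ++ [k]) ∈ spineVertices ω ↔ (i, u) ∈ spineVertices ω ∧ k < ω i u :=
  mem_gwVertices_concat

lemma Compat.mem_spineVertices (hp : IsParentMap p x) {Q : Set W} (hQ : IsSpine p x dep Q)
    {ω : ℕ → List ℕ → ℕ} {f : W → ℕ × List ℕ}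
    (hf : Compat p dep r Q (fun q => ω q.1 q.2) f) (w : W) : f w ∈ spineVertices ω := by
  refine hp.induction (P := fun w => f w ∈ spineVertices ω) ?_ ?_ w
  · rw [hf.spine x hQ.root]
    exact nil_mem_gwVertices _
  · intro u _ ih
    by_cases hu : u ∈ Q
    · rw [hf.spine u hu]
      exact nil_mem_gwVertices _
    · obtain ⟨k, hk, hfu⟩ := hf.child u hu
      rw [hfu]
      exact spineVertices_concat.2 ⟨ih, hk⟩

/-- Besides the children counted by `ω`, a line vertex `(j, [])` has the child `(j + 1, [])`. Since
`b` has depth `r`, the path to `b` covers this child for all `j < r`, so no child of a vertex of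
depth less than `r` is missed. -/
lemma Compat.fits (hp : IsParentMap p x) (hd : IsDepth p x dep r) {b : W} (hb : dep b = r)
    {ω : ℕ → List ℕ → ℕ} {f : W → ℕ × List ℕ}
    (hf : Compat p dep r {w | Reach p b w} (fun q => ω q.1 q.2) f) :
    Fits p x {w | dep w < r} (spineParent ω) (spineRoot ω)
      fun w => ⟨f w, hf.mem_spineVertices hp (isSpine_reach hp hd b) w⟩ := by
  have hQ := isSpine_reach hp hd b
  have hx : f x = (0, []) := by rw [hf.spine x hQ.root, hd.root]
  refine ⟨fun a c hac => hf.inj (congrArg Subtype.val hac), Subtype.ext hx, ?_, ?_⟩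
  · intro w
    refine Subtype.ext ?_
    change spinePos (f w) = f (p w)
    by_cases hw : w ∈ {w | Reach p b w}
    · rw [hf.spine w hw, spinePos_nil, hf.spine _ (hQ.parent w hw), hd.parent_eq hp]
    · obtain ⟨k, -, hfw⟩ := hf.child w hw
      rw [hfw, spinePos_concat]
  · rintro ⟨⟨i, s⟩, hu⟩ ⟨w, hw, hwu⟩
    have hpar : f w = spinePos (i, s) := congrArg Subtype.val hwu
    have hw' : dep w < r := hw
    rcases List.eq_nil_or_concat s with rfl | ⟨s, k, rfl⟩
    · cases i with
      | zero => exact ⟨x, Subtype.ext hx⟩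
      | succ j =>
        rw [spinePos_nil, Nat.add_sub_cancel] at hpar
        have hwQ : w ∈ {w | Reach p b w} := by
          by_contra hwQ
          obtain ⟨k, -, hfw⟩ := hf.child w hwQ
          rw [hpar] at hfw
          simp at hfw
        rw [hf.spine w hwQ, Prod.mk.injEq] at hpar
        have hdep : dep (p^[r - (j + 1)] b) = j + 1 := by
          rw [hd.iterate_eq hp, hb]
          omega
        refine ⟨p^[r - (j + 1)] b, Subtype.ext ?_⟩
        change f _ = _
        rw [hf.spine _ ⟨_, rfl⟩, hdep]
    · rw [List.concat_eq_append] at hu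
      rw [List.concat_eq_append, spinePos_concat] at hpar
      obtain ⟨u', -, -, hu'⟩ := hf.surj w hw' k (by
        rw [hpar]
        exact (spineVertices_concat.1 hu).2)
      refine ⟨u', Subtype.ext ?_⟩
      change f u' = (i, s.concat k)
      rw [hu', hpar, List.concat_eq_append]

/-- Each line vertex is a child of the preceding one, so an exact embedding covers the line up to
`(r, [])`. The preimage of `(r, [])` is `b`, and the path to `b` is the preimage of the line. -/
lemma Fits.exists_compat (hp : IsParentMap p x) (hd : IsDepth p x dep r) {ω : ℕ → List ℕ → ℕ}
    {f : W → spineVertices ω} (hf : Fits p x {w | dep w < r} (spineParent ω) (spineRoot ω) f) :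
    ∃ b, dep b = r ∧
      Compat p dep r {w | Reach p b w} (fun q => ω q.1 q.2) fun w => (f w).1 := by
  set g : W → ℕ × List ℕ := fun w => (f w).1 with hg
  have ginj : Function.Injective g := Subtype.val_injective.comp hf.inj
  have gx : g x = (0, []) := congrArg Subtype.val hf.map_root
  have gpar : ∀ w, spinePos (g w) = g (p w) := fun w => congrArg Subtype.val (hf.map_parent w)
  have hlen : ∀ w, (g w).1 + (g w).2.length = dep w := by
    refine hp.induction ?_ fun u hu ih => ?_
    · rw [gx, hd.root]
      rfl
    · rw [← gpar u] at ih
      rw [hd.succ u hu, ← ih]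
      have hne : g u ≠ (0, []) := fun h => hu (ginj (h.trans gx.symm))
      generalize g u = q at hne
      obtain ⟨i, s⟩ := q
      rcases List.eq_nil_or_concat s with rfl | ⟨s, k, rfl⟩
      · have hi : i ≠ 0 := fun h => hne (by rw [h])
        rw [spinePos_nil]
        simp
        omega
      · rw [List.concat_eq_append, spinePos_concat]
        simp
        omega
  have hnil : ∀ w, (g w).2 = [] → g w = (dep w, []) := by
    intro w hw
    have := hlen w
    rw [hw, List.length_nil, add_zero] at this
    exact Prod.ext this hw
  have hspine : ∀ j, j ≤ r → ∃ w, g w = (j, []) := by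
    intro j
    induction j with
    | zero => exact fun _ => ⟨x, gx⟩
    | succ j ih =>
      intro hj
      obtain ⟨w, hw⟩ := ih (by omega)
      have hdw : dep w = j := by
        rw [← hlen w, hw]
        simp
      have hmem : (j + 1, ([] : List ℕ)) ∈ spineVertices ω := nil_mem_gwVertices _
      have hpar : spineParent ω ⟨_, hmem⟩ = f w :=
        Subtype.ext ((spinePos_nil (j + 1)).trans hw.symm)
      obtain ⟨u, hu⟩ := hf.mem_range ⟨_, hmem⟩
        ⟨w, by rw [Set.mem_ofPred_eq]; omega, hpar.symm⟩
      exact ⟨u, congrArg Subtype.val hu⟩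
  obtain ⟨b, hb⟩ := hspine r le_rfl
  have hbr : dep b = r := by
    rw [← hlen b, hb]
    simp
  have hit : ∀ n, (g (p^[n] b)).2 = [] := by
    intro n
    induction n with
    | zero => exact congrArg Prod.snd hb
    | succ n ih => rw [Function.iterate_succ_apply', ← gpar, hnil _ ih, spinePos_nil]
  have hQ : ∀ w, (g w).2 = [] → Reach p b w := by
    intro w hw
    refine ⟨r - dep w, ginj ?_⟩
    rw [hnil _ (hit _), hnil w hw, hd.iterate_eq hp, hbr, Nat.sub_sub_self (hd.le w)]
  refine ⟨b, hbr, ginj, ?_, ?_, ?_⟩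
  · rintro _ ⟨n, rfl⟩
    exact hnil _ (hit n)
  · intro u hu
    obtain ⟨k, hk⟩ := exists_eq_concat fun h => hu (hQ u h)
    have h1 := gpar u
    have hgu : g u = ((g u).1, (g u).2.dropLast ++ [k]) := Prod.ext rfl hk
    rw [hgu, spinePos_concat] at h1
    have hmem : g u ∈ spineVertices ω := (f u).2
    rw [hgu] at hmem
    refine ⟨k, ?_, ?_⟩
    · rw [← h1]
      exact (spineVertices_concat.1 hmem).2
    · rw [← h1]
      exact hgu
  · intro w hw k hk
    have hmem : ((g w).1, (g w).2 ++ [k]) ∈ spineVertices ω :=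
      spineVertices_concat.2 ⟨(f w).2, hk⟩
    have hpar : spineParent ω ⟨_, hmem⟩ = f w := Subtype.ext (spinePos_concat _ _ _)
    obtain ⟨u, hu⟩ := hf.mem_range ⟨_, hmem⟩ ⟨w, hw, hpar.symm⟩
    have hu' : g u = ((g w).1, (g w).2 ++ [k]) := congrArg Subtype.val hu
    refine ⟨u, ?_, hf.inj (by rw [← hf.map_parent, hu, hpar]), hu'⟩
    rintro ⟨n, rfl⟩
    have := hit n
    rw [hu'] at this
    simp at this

/-- Embeddings into a tree with a spine are compatible placements. -/
lemma card_fits_spine [Fintype W] (hp : IsParentMap p x) (hd : IsDepth p x dep r)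
    (ω : ℕ → List ℕ → ℕ) :
    Nat.card {f : W → spineVertices ω //
        Fits p x {w | dep w < r} (spineParent ω) (spineRoot ω) f} =
      Nat.card (Σ b : {b // dep b = r}, {f : W → ℕ × List ℕ //
        Compat p dep r {w | Reach p b.1 w} (fun q => ω q.1 q.2) f}) := by
  symm
  refine Nat.card_congr (Equiv.ofBijective (fun q => ⟨fun w => ⟨q.2.1 w,
    q.2.2.mem_spineVertices hp (isSpine_reach hp hd q.1.1) w⟩, q.2.2.fits hp hd q.1.2⟩) ⟨?_, ?_⟩)
  · rintro ⟨⟨b, hb⟩, f, hf⟩ ⟨⟨b', hb'⟩, f', hf'⟩ h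
    have hff : f = f' := funext fun w =>
      congrArg Subtype.val (congrFun (congrArg Subtype.val h) w)
    subst hff
    -- The end of the spine is determined by the placement as the preimage of `(r, [])`.
    have hbb : b = b' := by
      refine hf.inj ?_
      rw [hf.spine b (Reach.refl _ _), hf'.spine b' (Reach.refl _ _), hb, hb']
    subst hbb
    rfl
  · rintro ⟨f, hf⟩
    obtain ⟨b, hb, hc⟩ := hf.exists_compat hp hd
    exact ⟨⟨⟨b, hb⟩, _, hc⟩, rfl⟩

end FamilyTrees

/-! ### Independence of disjoint families of coordinates -/

open scoped Classical in
-- Both sides are the expectation of the number of events that occur. Measurability of `S` comes for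
-- free, since `S` is the union of the `E j`.
lemma measureReal_mul_eq_sum {Ω ι : Type*} [MeasurableSpace Ω] (μ : Measure Ω)
    [IsFiniteMeasure μ] [Fintype ι] {E : ι → Set Ω} (hE : ∀ j, MeasurableSet (E j)) {S : Set Ω}
    {A : ℕ} (hA : 0 < A) (h : ∀ ω, Nat.card {j // ω ∈ E j} = if ω ∈ S then A else 0) :
    μ.real S * A = ∑ j, μ.real (E j) := by
  have hS : S = ⋃ j, E j := by
    ext ω
    rw [Set.mem_iUnion]
    have h1 := h ω
    constructor
    · intro hω
      rw [if_pos hω] at h1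
      obtain ⟨j, hj⟩ := (Nat.card_pos_iff.1 (h1 ▸ hA)).1
      exact ⟨j, hj⟩
    · rintro ⟨j, hj⟩
      by_contra hω
      rw [if_neg hω] at h1
      have : Nonempty {j // ω ∈ E j} := ⟨j, hj⟩
      exact Nat.card_pos.ne' h1
  have hSm : MeasurableSet S := hS ▸ MeasurableSet.iUnion hE
  have h2 : ∀ ω, S.indicator (fun _ => (A : ℝ)) ω = ∑ j, (E j).indicator (fun _ => (1 : ℝ)) ω := by
    intro ω
    have h1 := h ω
    rw [Nat.card_eq_fintype_card, Fintype.card_subtype] at h1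
    simp only [Set.indicator_apply, Finset.sum_boole]
    rw [h1]
    split_ifs <;> simp
  have h3 : ∫ ω, S.indicator (fun _ => (A : ℝ)) ω ∂μ = μ.real S * A := by
    rw [integral_indicator_const _ hSm, smul_eq_mul]
  rw [← h3, integral_congr_ae (Filter.Eventually.of_forall h2), integral_finsetSum]
  · exact Finset.sum_congr rfl fun j _ => by rw [integral_indicator_const _ (hE j)]; simp
  · exact fun j _ => (integrable_const _).indicator (hE j)

/-- Events that depend on disjoint sets of coordinates are independent. -/
lemma infinitePi_forall_mem {ι J X : Type*} [Fintype ι] {κ : ι → Type*} [MeasurableSpace X]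
    (ν : Measure X) [IsProbabilityMeasure ν] {Z : (Σ i, κ i) → J} (hZ : Function.Injective Z)
    {T : ∀ i, Set (κ i → X)} (hT : ∀ i, MeasurableSet (T i)) :
    Measure.infinitePi (fun _ : J => ν) {ω | ∀ i, (fun u => ω (Z ⟨i, u⟩)) ∈ T i} =
      ∏ i, Measure.infinitePi (fun _ : κ i => ν) (T i) := by
  -- Selecting the coordinates in the range of `Z` preserves the product measure, and currying
  -- groups them into independent blocks.
  have h1 := Measure.map_infinitePi_infinitePi_of_inj (P := fun _ : J => ν) hZ
  have h2 := Measure.infinitePi_map_piCurry (κ := κ) (X := fun _ _ => X) (fun _ _ => ν)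
  rw [← h1, Measure.map_map (by fun_prop) (by fun_prop)] at h2
  rw [← Measure.pi_pi, ← Measure.infinitePi_eq_pi, ← h2, Measure.map_apply (by fun_prop)
    (MeasurableSet.univ_pi hT)]
  congr 1
  ext ω
  simp only [Set.mem_preimage, Set.mem_univ_pi]
  rfl

lemma poissonMeasure_one_singleton (k : ℕ) :
    (poissonMeasure 1).real {k} = Real.exp (-1) / k.factorial := by
  rw [poissonMeasure_real_singleton]
  simp

lemma infinitePi_poisson_cylinder {ι J : Type*} [Fintype ι] {a : ι → J}
    (ha : Function.Injective a) (k : ι → ℕ) :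
    (Measure.infinitePi fun _ : J => poissonMeasure 1).real {ω | ∀ i, ω (a i) = k i} =
      ∏ i, Real.exp (-1) / (k i).factorial := by
  have h1 := Measure.map_infinitePi_infinitePi_of_inj (P := fun _ : J => poissonMeasure 1) ha
  have h2 : {ω : J → ℕ | ∀ i, ω (a i) = k i} = (fun ω i => ω (a i)) ⁻¹' {k} := by
    ext ω
    simp [funext_iff]
  rw [h2, ← map_measureReal_apply (by fun_prop) (measurableSet_singleton k), h1, measureReal_def,
    Measure.infinitePi_singleton_of_fintype, ENNReal.toReal_prod]
  exact Finset.prod_congr rfl fun i _ => poissonMeasure_one_singleton (k i)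

/-- The numbers of children of finitely many individuals and the family trees of the descendants
of finitely many further individuals are independent. -/
lemma gwMeasure_cylinder {A B : Type*} [Fintype A] [Fintype B] {a : A → List ℕ} {b : B → List ℕ}
    (ha : Function.Injective a) (hb : ∀ i j u w, b i ++ u = b j ++ w → i = j)
    (hab : ∀ i j u, a i ≠ b j ++ u) (k : A → ℕ) {S : Set (List ℕ → ℕ)} (hS : MeasurableSet S) :
    gwMeasure.real {ξ | (∀ i, ξ (a i) = k i) ∧ ∀ j, (fun u => ξ (b j ++ u)) ∈ S} =
      (∏ i, Real.exp (-1) / (k i).factorial) * gwMeasure.real S ^ Fintype.card B := by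
  -- One block is the single coordinate `a i`, another all words that begin with `b j`; `ha`, `hb`
  -- and `hab` make the blocks disjoint.
  let κ : A ⊕ B → Type := fun s => s.elim (fun _ => Unit) (fun _ => List ℕ)
  let Z : (Σ s, κ s) → List ℕ := fun q => match q with
    | ⟨Sum.inl i, _⟩ => a i
    | ⟨Sum.inr j, u⟩ => b j ++ (show List ℕ from u)
  let T : ∀ s, Set (κ s → ℕ) := fun s => match s with
    | Sum.inl i => {g | g () = k i}
    | Sum.inr _ => S
  have hZ : Function.Injective Z := by
    rintro ⟨i | i, u⟩ ⟨j | j, w⟩ h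
    · cases ha h
      rfl
    · exact absurd h (hab i j w)
    · exact absurd h.symm (hab j i u)
    · cases hb i j u w h
      cases List.append_cancel_left h
      rfl
  have hT : ∀ s, MeasurableSet (T s) := by
    rintro (i | j)
    · exact (measurable_pi_apply (X := fun _ : Unit => ℕ) ()) (measurableSet_singleton (k i))
    · exact hS
  have h := infinitePi_forall_mem (poissonMeasure 1) hZ hT
  have hset : {ξ : List ℕ → ℕ | (∀ i, ξ (a i) = k i) ∧ ∀ j, (fun u => ξ (b j ++ u)) ∈ S} =
      {ω | ∀ i, (fun u => ω (Z ⟨i, u⟩)) ∈ T i} := by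
    ext ξ
    exact (Sum.forall (p := fun i => (fun u => ξ (Z ⟨i, u⟩)) ∈ T i)).symm
  rw [hset, measureReal_def, gwMeasure, h, ENNReal.toReal_prod, Fintype.prod_sum_type]
  congr 1
  · refine Finset.prod_congr rfl fun i _ => ?_
    have h1 := infinitePi_poisson_cylinder (J := Unit) (a := fun _ : Unit => ())
      (fun _ _ _ => rfl) (fun _ => k i)
    rw [Fintype.prod_unique] at h1
    rw [← h1, measureReal_def]
    congr 2
    ext g
    exact ⟨fun h _ => h, fun h => h ()⟩
  · refine (Finset.prod_const
      ((Measure.infinitePi fun _ : List ℕ => poissonMeasure 1).real S)).trans ?_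
    rw [Finset.card_univ]

/-! ### Survival of the Poisson(1) Galton–Watson tree -/

lemma append_mem_gwVertices {ξ : List ℕ → ℕ} {v u : List ℕ} :
    v ++ u ∈ gwVertices ξ ↔ v ∈ gwVertices ξ ∧ u ∈ gwVertices (fun u => ξ (v ++ u)) := by
  induction u using List.reverseRecOn with
  | nil => simp [nil_mem_gwVertices]
  | append_singleton u k ih => rw [← List.append_assoc, mem_gwVertices_concat, ih,
      mem_gwVertices_concat, and_assoc]

lemma survives_add {m n : ℕ} {ξ : List ℕ → ℕ} :
    Survives (m + n) ξ ↔
      ∃ v ∈ gwVertices ξ, v.length = m ∧ Survives n (fun u => ξ (v ++ u)) := by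
  constructor
  · rintro ⟨u, hu, hlen⟩
    rw [← List.take_append_drop m u, append_mem_gwVertices] at hu
    refine ⟨u.take m, hu.1, ?_, u.drop m, hu.2, ?_⟩
    · rw [List.length_take]
      omega
    · rw [List.length_drop]
      omega
  · rintro ⟨v, hv, rfl, u, hu, rfl⟩
    exact ⟨v ++ u, append_mem_gwVertices.2 ⟨hv, hu⟩, List.length_append⟩

lemma measurableSet_survives (N : ℕ) : MeasurableSet {ξ | Survives N ξ} := by
  have h : {ξ | Survives N ξ} = ⋃ u ∈ {u : List ℕ | u.length = N},
      ⋂ (w : List ℕ), ⋂ (k : ℕ), ⋂ (_ : w ++ [k] <+: u), {ξ | k < ξ w} := by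
    ext ξ
    simp only [Survives, gwVertices, Set.mem_ofPred_eq, Set.mem_iUnion, Set.mem_iInter,
      exists_prop, and_comm]
  rw [h]
  refine MeasurableSet.biUnion (Set.to_countable _) fun u _ => MeasurableSet.iInter fun w =>
    MeasurableSet.iInter fun k => MeasurableSet.iInter fun _ => ?_
  exact measurableSet_lt measurable_const (measurable_pi_apply w)

/-- The probability of extinction before generation `N`. -/
def extinctProb (N : ℕ) : ℝ := gwMeasure.real {ξ | ¬ Survives N ξ}

lemma survives_zero (ξ : List ℕ → ℕ) : Survives 0 ξ := ⟨[], nil_mem_gwVertices ξ, rfl⟩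

lemma extinctProb_zero : extinctProb 0 = 0 := by
  simp [extinctProb, survives_zero]

lemma measureReal_survives (N : ℕ) : gwMeasure.real {ξ | Survives N ξ} = 1 - extinctProb N := by
  have h := probReal_add_probReal_compl (μ := gwMeasure) (measurableSet_survives N)
  exact eq_sub_of_add_eq h

lemma survives_succ {N : ℕ} {ξ : List ℕ → ℕ} :
    Survives (N + 1) ξ ↔ ∃ i < ξ [], Survives N (fun u => ξ ([i] ++ u)) := by
  rw [add_comm, survives_add]
  constructor
  · rintro ⟨v, hv, hlen, h⟩
    obtain ⟨i, rfl⟩ := List.length_eq_one_iff.1 hlen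
    exact ⟨i, (mem_gwVertices_concat (u := []).1 hv).2, h⟩
  · rintro ⟨i, hi, h⟩
    exact ⟨[i], mem_gwVertices_concat (u := []).2 ⟨nil_mem_gwVertices ξ, hi⟩, rfl, h⟩

/-- Given that the root has `k` children, their `k` independent families must all die out before
generation `N`; summing over `k` yields the generating function of Poisson(1). -/
lemma extinctProb_succ (N : ℕ) : extinctProb (N + 1) = Real.exp (extinctProb N - 1) := by
  let D : ℕ → Set (List ℕ → ℕ) := fun k => {ξ | (∀ _ : Unit, ξ [] = k) ∧
    ∀ j : Fin k, (fun u => ξ ([(j : ℕ)] ++ u)) ∈ {ξ | ¬ Survives N ξ}}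
  have hS : MeasurableSet {ξ | ¬ Survives N ξ} := (measurableSet_survives N).compl
  have hD : ∀ k, gwMeasure.real (D k) = Real.exp (-1) * (extinctProb N ^ k / k.factorial) := by
    intro k
    have h := gwMeasure_cylinder (A := Unit) (B := Fin k) (a := fun _ => [])
      (b := fun j => [(j : ℕ)]) (fun _ _ _ => rfl)
      (fun i j u w h => Fin.ext (List.cons.inj h).1) (fun i j u h => by simp at h)
      (fun _ => k) hS
    rw [Fintype.card_fin, Fintype.prod_unique] at h
    rw [h, extinctProb]
    ring
  have hm : ∀ k, MeasurableSet (D k) := by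
    intro k
    have h1 : D k = {ξ | ξ [] = k} ∩ ⋂ j : Fin k,
        (fun (ξ : List ℕ → ℕ) u => ξ ([(j : ℕ)] ++ u)) ⁻¹' {ξ | ¬ Survives N ξ} := by
      ext ξ
      simp [D]
    rw [h1]
    refine MeasurableSet.inter
      ((measurable_pi_apply (X := fun _ : List ℕ => ℕ) []) (measurableSet_singleton k))
      (MeasurableSet.iInter fun j => hS.preimage (measurable_pi_lambda _ fun u => ?_))
    exact measurable_pi_apply _
  have hU : {ξ | ¬ Survives (N + 1) ξ} = ⋃ k, D k := by
    ext ξ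
    simp only [Set.mem_ofPred_eq, survives_succ, Set.mem_iUnion, D]
    constructor
    · intro h
      exact ⟨ξ [], fun _ => rfl, fun j hj => h ⟨j, j.2, hj⟩⟩
    · rintro ⟨k, hk, h⟩ ⟨i, hi, hs⟩
      exact h ⟨i, hk () ▸ hi⟩ hs
  have hdisj : Pairwise (Function.onFun Disjoint D) := by
    intro k l hkl
    refine Set.disjoint_left.2 fun ξ h1 h2 => hkl ?_
    exact (h1.1 ()).symm.trans (h2.1 ())
  have hsum : HasSum (fun k => gwMeasure.real (D k)) (extinctProb (N + 1)) := by
    have h1 := measure_iUnion (μ := gwMeasure) hdisj hm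
    rw [extinctProb, hU, measureReal_def, h1, ENNReal.tsum_toReal_eq fun k => measure_ne_top _ _]
    exact (ENNReal.summable_toReal (h1 ▸ measure_ne_top _ _)).hasSum
  simp only [hD] at hsum
  have h2 := (NormedSpace.expSeries_div_hasSum_exp (extinctProb N)).mul_left (Real.exp (-1))
  rw [hsum.unique h2, ← Real.exp_eq_exp_ℝ, ← Real.exp_add]
  ring_nf

/-- The probability of survival up to generation `N`. -/
def survProb (N : ℕ) : ℝ := 1 - extinctProb N

lemma survProb_succ (N : ℕ) : survProb (N + 1) = 1 - Real.exp (-survProb N) := by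
  rw [survProb, extinctProb_succ, survProb]
  ring_nf

lemma survProb_pos (N : ℕ) : 0 < survProb N := by
  induction N with
  | zero => simp [survProb, extinctProb_zero]
  | succ N ih =>
    rw [survProb_succ]
    have := Real.exp_lt_one_iff.2 (neg_lt_zero.2 ih)
    linarith

lemma survProb_antitone : Antitone survProb := by
  refine antitone_nat_of_succ_le fun N => ?_
  rw [survProb_succ]
  have := Real.add_one_le_exp (-survProb N)
  linarith

/-- The decreasing limit solves `s = 1 - e^{-s}`, and `e^{-s} > 1 - s` for `s ≠ 0` leaves only `s =
0`. -/
lemma tendsto_survProb : Tendsto survProb atTop (𝓝 0) := by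
  have h := tendsto_atTop_ciInf survProb_antitone ⟨0, by rintro _ ⟨N, rfl⟩; exact (survProb_pos N).le⟩
  set s := ⨅ N, survProb N
  have h1 : Tendsto (fun N => survProb (N + 1)) atTop (𝓝 (1 - Real.exp (-s))) := by
    simp only [survProb_succ]
    exact tendsto_const_nhds.sub ((Real.continuous_exp.tendsto _).comp h.neg)
  have h2 := tendsto_nhds_unique h1 ((tendsto_add_atTop_iff_nat 1).2 h)
  have h3 : s = 0 := by
    by_contra hs
    have := Real.add_one_lt_exp (neg_ne_zero.2 hs)
    linarith
  rwa [h3] at h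

/-- This is criticality: the recursion `s ↦ 1 - e^{-s}` has derivative `1` at its fixed point `0`.
-/
lemma tendsto_survProb_succ_div :
    Tendsto (fun N => survProb (N + 1) / survProb N) atTop (𝓝 1) := by
  have h1 : HasDerivAt (fun s : ℝ => 1 - Real.exp (-s)) 1 0 := by
    have := ((hasDerivAt_neg (0 : ℝ)).exp).const_sub 1
    simpa using this
  have h2 := h1.tendsto_slope_zero
  have h3 : Tendsto survProb atTop (𝓝[≠] 0) :=
    tendsto_nhdsWithin_iff.2 ⟨tendsto_survProb, Filter.Eventually.of_forall
      fun N => (survProb_pos N).ne'⟩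
  refine (h2.comp h3).congr fun N => ?_
  simp [survProb_succ, div_eq_inv_mul]

lemma tendsto_survProb_add_div (r : ℕ) :
    Tendsto (fun N => survProb (r + N) / survProb N) atTop (𝓝 1) := by
  induction r with
  | zero => simp [(survProb_pos _).ne']
  | succ r ih =>
    have h := (tendsto_survProb_succ_div.comp (tendsto_add_atTop_nat r)).mul ih
    rw [mul_one] at h
    refine h.congr fun N => ?_
    have h1 := (survProb_pos (r + N)).ne'
    simp only [Function.comp, add_comm N r]
    rw [div_mul_div_cancel₀ h1, show r + N + 1 = r + 1 + N by ring]

/-- Given survival for a long time, the chance that one of `m` families survives for a slightly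
shorter time is larger by the factor `m`. -/
lemma tendsto_one_sub_extinctProb_pow_div (r m : ℕ) :
    Tendsto (fun N => (1 - extinctProb N ^ m) / survProb (r + N)) atTop (𝓝 m) := by
  have h1 : Tendsto extinctProb atTop (𝓝 1) := by
    have := tendsto_survProb.const_sub 1
    simpa [survProb] using this
  -- In `1 - q ^ m = (1 - q) ∑ q ^ i` the geometric sum tends to `m` as `q` tends to `1`.
  have h2 : Tendsto (fun N => ∑ i ∈ Finset.range m, extinctProb N ^ i) atTop (𝓝 m) := by
    have := tendsto_finsetSum (Finset.range m) fun i _ => h1.pow i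
    simpa using this
  have h3 := h2.mul ((tendsto_survProb_add_div r).inv₀ one_ne_zero)
  rw [inv_one, mul_one] at h3
  refine h3.congr fun N => ?_
  have h4 := mul_neg_geom_sum (extinctProb N) m
  rw [inv_div, ← h4, survProb]
  ring

/-! ### The law of the truncated limit trees -/

section Laws

open scoped Classical

variable {W : Type*} {p : W → W} {x : W} {dep : W → ℕ} {r : ℕ} {Q : Set W}

/-- The labellings contribute the reciprocal of the product of the factorials. -/
lemma sum_labelling [Fintype W] [Fintype (Labelling p Q)] (hd : IsDepth p x dep r) (hQ : IsSpine p x dep Q) :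
    ∑ _e : Labelling p Q, ∏ w : {w // dep w < r}, Real.exp (-1) / (offCard p Q w).factorial =
      Real.exp (-{w | dep w < r}.ncard) := by
  -- The number of labellings cancels the factorials of the Poisson weights, leaving one factor
  -- `e^{-1}` per vertex of depth less than `r`.
  have h1 : Fintype.card (Labelling p Q) =
      ∏ w : {w // dep w < r}, (offCard p Q w).factorial := by
    rw [← Nat.card_eq_fintype_card, card_labelling,
      ← Fintype.prod_subtype_mul_prod_subtype (fun w => dep w < r)]
    rw [Fintype.prod_eq_one (fun w : {w // ¬ dep w < r} => (offCard p Q w).factorial), mul_one]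
    intro w
    rw [offCard_eq_zero hd hQ w.2, Nat.factorial_zero]
  rw [Finset.sum_const, Finset.card_univ, h1, nsmul_eq_mul, Finset.prod_div_distrib,
    Finset.prod_const, Finset.card_univ, Nat.cast_prod, mul_div_cancel₀]
  · rw [← Real.exp_nat_mul, ← Nat.card_eq_fintype_card, ← Nat.card_coe_set_eq]
    simp [Fintype.card_subtype]
  · exact Finset.prod_ne_zero_iff.2 fun w _ => Nat.cast_ne_zero.2 (Nat.factorial_ne_zero _)

lemma card_depth_eq [Fintype W] (hd : IsDepth p x dep r) :
    (Fintype.card {b // dep b = r} : ℝ) = Fintype.card W - {w | dep w < r}.ncard := by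
  have h1 := Fintype.card_subtype_compl (fun w => dep w < r)
  have h2 : Fintype.card {b // dep b = r} = Fintype.card {w // ¬ dep w < r} :=
    Fintype.card_congr (Equiv.subtypeEquivRight fun w => by have := hd.le w; omega)
  rw [h2, h1, Nat.cast_sub (Fintype.card_subtype_le _), ← Nat.card_coe_set_eq,
    ← Nat.card_eq_fintype_card (α := {w // dep w < r})]
  rfl

instance : IsProbabilityMeasure spineMeasure := by
  unfold spineMeasure
  infer_instance

lemma spineMeasure_cylinder {ι : Type*} [Fintype ι] {a : ι → ℕ × List ℕ}
    (ha : Function.Injective a) (k : ι → ℕ) :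
    spineMeasure.real {ω | ∀ i, ω (a i).1 (a i).2 = k i} =
      ∏ i, Real.exp (-1) / (k i).factorial := by
  rw [← infinitePi_poisson_cylinder ha k]
  have h := Measure.infinitePi_map_curry (fun (_ : ℕ) (_ : List ℕ) => poissonMeasure 1)
  rw [spineMeasure, gwMeasure, ← h, measureReal_def, measureReal_def, MeasurableEquiv.map_apply]
  rfl

/-- The law of the truncation of `𝒫₁`. -/
theorem p1TruncProb_mul_autCard [Fintype W] (hp : IsParentMap p x)
    (hd : IsDepth p x ((parentGraph p).dist x) r) :
    p1TruncProb r (parentGraph p) x * autCard (parentGraph p) x =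
      Real.exp (-{w | (parentGraph p).dist x w < r}.ncard) *
        (Fintype.card W - {w | (parentGraph p).dist x w < r}.ncard) := by
  have hQ := fun b : {b // (parentGraph p).dist x b = r} => isSpine_reach hp hd b.1
  set dep := (parentGraph p).dist x with hdep
  -- One event for each spine end and labelling, prescribing the offspring numbers at all positions
  -- of depth less than `r`. Every spine end contributes the same total, which produces the factor
  -- counting the vertices at depth `r`.
  let E : (Σ b : {b // dep b = r}, Labelling p {w | Reach p b.1 w}) → Set (ℕ → List ℕ → ℕ) :=
    fun j => {ω | ∀ w : {w // dep w < r}, ω (j.2.place dep w).1 (j.2.place dep w).2 =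
      offCard p {w | Reach p j.1.1 w} w}
  have hE : ∀ j, MeasurableSet (E j) := by
    intro j
    have h1 : E j = ⋂ w : {w // dep w < r}, {ω | ω (j.2.place dep w).1 (j.2.place dep w).2 =
      offCard p {w | Reach p j.1.1 w} w} := by
      ext ω
      simp [E]
    rw [h1]
    refine MeasurableSet.iInter fun w => ?_
    exact measurableSet_eq_fun (by fun_prop) measurable_const
  have h := measureReal_mul_eq_sum spineMeasure hE
    (S := {ω | TruncationIs (spineTree ω) (spineRoot ω) r (parentGraph p) x})
    (autCard_pos (parentGraph p) x) ?_
  · rw [p1TruncProb, h, Fintype.sum_sigma]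
    have h2 : ∀ b : {b // dep b = r}, ∑ e : Labelling p {w | Reach p b.1 w},
        spineMeasure.real (E ⟨b, e⟩) = Real.exp (-{w | dep w < r}.ncard) := by
      intro b
      rw [← sum_labelling hd (hQ b)]
      refine Finset.sum_congr rfl fun e _ => ?_
      exact spineMeasure_cylinder (a := fun w : {w // dep w < r} => e.place dep w)
        ((place_injective hp hd (hQ b) e).comp Subtype.val_injective) _
    rw [Finset.sum_congr rfl fun b _ => h2 b, Finset.sum_const, Finset.card_univ, nsmul_eq_mul,
      card_depth_eq hd, mul_comm]
  · intro ω
    have h3 := card_fits hp (isParentMap_spineParent ω) hd.le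
    rw [← spineTree_eq ω, card_fits_spine hp hd ω] at h3
    rw [Set.mem_ofPred_eq, ← h3]
    refine Nat.card_congr ?_
    refine Equiv.trans ?_ (Equiv.sigmaCongrRight fun b => compatEquiv hp hd (hQ b) _)
    exact ⟨fun j => ⟨j.1.1, j.1.2, fun w hw => j.2 ⟨w, hw⟩⟩,
      fun j => ⟨⟨j.1, j.2.1⟩, fun w => j.2.2 w.1 w.2⟩, fun _ => rfl, fun _ => rfl⟩

/-! ### The family tree conditioned to survive. -/

lemma Compat.fst_eq_zero (hp : IsParentMap p x) (hd : IsDepth p x dep r) {ω : ℕ × List ℕ → ℕ}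
    {f : W → ℕ × List ℕ} (hf : Compat p dep r {x} ω f) (w : W) : (f w).1 = 0 := by
  refine hp.induction (P := fun w => (f w).1 = 0) ?_ ?_ w
  · rw [hf.spine x rfl, hd.root]
  · intro u hu ih
    obtain ⟨k, -, hk⟩ := hf.child u hu
    rw [hk, ih]

lemma Compat.snd_mem (hp : IsParentMap p x) {ξ : List ℕ → ℕ}
    {f : W → ℕ × List ℕ} (hf : Compat p dep r {x} (fun q => ξ q.2) f) (w : W) :
    (f w).2 ∈ gwVertices ξ := by
  refine hp.induction (P := fun w => (f w).2 ∈ gwVertices ξ) ?_ ?_ w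
  · rw [hf.spine x rfl]
    exact nil_mem_gwVertices ξ
  · intro u hu ih
    obtain ⟨k, hk, hk'⟩ := hf.child u hu
    rw [hk']
    exact mem_gwVertices_concat.2 ⟨ih, hk⟩

lemma Compat.length_snd (hp : IsParentMap p x) (hd : IsDepth p x dep r) {ω : ℕ × List ℕ → ℕ}
    {f : W → ℕ × List ℕ} (hf : Compat p dep r {x} ω f) (w : W) : (f w).2.length = dep w := by
  rw [← fst_add_length_eq hp hd (isSpine_singleton hp dep) hf.spine
    (fun u hu => (hf.child u hu).imp fun k h => h.2) w, hf.fst_eq_zero hp hd, zero_add]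

/-- A compatible placement uses all the individuals of the first `r` generations. -/
lemma Compat.exists_snd_eq (hp : IsParentMap p x) (hd : IsDepth p x dep r) {ξ : List ℕ → ℕ}
    {f : W → ℕ × List ℕ} (hf : Compat p dep r {x} (fun q => ξ q.2) f) {u : List ℕ}
    (hu : u ∈ gwVertices ξ) (hlen : u.length ≤ r) : ∃ w, (f w).2 = u := by
  induction u using List.reverseRecOn with
  | nil => exact ⟨x, by rw [hf.spine x rfl]⟩
  | append_singleton u k ih =>
    rw [mem_gwVertices_concat] at hu
    rw [List.length_append, List.length_singleton] at hlen
    obtain ⟨w, rfl⟩ := ih hu.1 (by omega)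
    rw [hf.length_snd hp hd] at hlen
    obtain ⟨u, -, -, h⟩ := hf.surj w (by omega) k hu.2
    exact ⟨u, by rw [h]⟩

/-- Generation `r` consists exactly of the images of the vertices at depth `r`, and one of them must
have descendants `M` generations later. -/
lemma Compat.survives_iff (hp : IsParentMap p x) (hd : IsDepth p x dep r) {ξ : List ℕ → ℕ}
    {f : W → ℕ × List ℕ} (hf : Compat p dep r {x} (fun q => ξ q.2) f) (M : ℕ) :
    Survives (r + M) ξ ↔ ∃ b : {b // dep b = r}, Survives M (fun u => ξ ((f b).2 ++ u)) := by
  rw [survives_add]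
  constructor
  · rintro ⟨v, hv, hlen, h⟩
    obtain ⟨b, rfl⟩ := hf.exists_snd_eq hp hd hv hlen.le
    exact ⟨⟨b, by rw [← hf.length_snd hp hd b, hlen]⟩, h⟩
  · rintro ⟨b, h⟩
    exact ⟨_, hf.snd_mem hp b, by rw [hf.length_snd hp hd, b.2], h⟩

/-- The set of offspring numbers for which the tree is embedded with the labels `e`. -/
def labelEvent (dep : W → ℕ) (r : ℕ) (e : Labelling p {x}) : Set (List ℕ → ℕ) :=
  {ξ | ∀ w : {w // dep w < r}, ξ (e.place dep w).2 = offCard p {x} w}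

lemma measurableSet_labelEvent [Fintype W] (e : Labelling p {x}) : MeasurableSet (labelEvent dep r e) := by
  have h1 : labelEvent dep r e =
      ⋂ w : {w // dep w < r}, {ξ | ξ (e.place dep w).2 = offCard p {x} w} := by
    ext ξ
    simp [labelEvent]
  rw [h1]
  exact MeasurableSet.iInter fun w => measurableSet_eq_fun (by fun_prop) measurable_const

/-- The families founded by generation `r` are independent of one another and of the earlier
offspring numbers; extinction before generation `r + M` means that all of them die out before their
generation `M`. -/
lemma measureReal_labelEvent_inter_survives [Fintype W] (hp : IsParentMap p x) (hd : IsDepth p x dep r)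
    (e : Labelling p {x}) (M : ℕ) :
    gwMeasure.real (labelEvent dep r e ∩ {ξ | Survives (r + M) ξ}) =
      (∏ w : {w // dep w < r}, Real.exp (-1) / (offCard p {x} w).factorial) *
        (1 - extinctProb M ^ Fintype.card {b // dep b = r}) := by
  have hQ := isSpine_singleton hp dep
  have hc : ∀ ξ ∈ labelEvent dep r e, Compat p dep r {x} (fun q => ξ q.2) (e.place dep) :=
    fun ξ hξ => compat_place hp hd hQ e fun w hw => hξ ⟨w, hw⟩
  -- The placement depends on `e` only; offspring numbers read off from the finite tree itself make
  -- it compatible, so that the general facts on depth and word length apply.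
  have hc0 := compat_place hp hd hQ e (ω := fun q => if h : ∃ w, e.place dep w = q then
    offCard p {x} h.choose else 0) fun w _ => by
      have h : ∃ w', e.place dep w' = e.place dep w := ⟨w, rfl⟩
      rw [dif_pos h, place_injective hp hd hQ e h.choose_spec]
  have hlen := hc0.length_snd hp hd
  have hinj : ∀ w w', (e.place dep w).2 = (e.place dep w').2 → w = w' := fun w w' h =>
    hc0.inj (Prod.ext ((hc0.fst_eq_zero hp hd w).trans (hc0.fst_eq_zero hp hd w').symm) h)
  have hcyl := fun (S : Set (List ℕ → ℕ)) (hS : MeasurableSet S) =>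
    gwMeasure_cylinder (a := fun w : {w // dep w < r} => (e.place dep w).2)
    (b := fun w : {b // dep b = r} => (e.place dep w).2)
    (fun w w' h => Subtype.ext (hinj _ _ h))
    (fun w w' u u' h => Subtype.ext (hinj _ _ (List.append_inj h
      (by rw [hlen, hlen, w.2, w'.2])).1))
    (fun w w' u h => by
      have h1 := congrArg List.length h
      rw [List.length_append, hlen, hlen, w'.2] at h1
      have := w.2
      omega) (fun w => offCard p {x} w) hS
  have h1 := hcyl _ (measurableSet_survives M).compl
  -- With no condition on the later families this is the probability of the label event alone.
  have h2 := hcyl _ MeasurableSet.univ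
  have h3 : labelEvent dep r e \ {ξ | Survives (r + M) ξ} =
      {ξ | (∀ w : {w // dep w < r}, ξ (e.place dep w).2 = offCard p {x} w) ∧
        ∀ b : {b // dep b = r}, (fun u => ξ ((e.place dep b).2 ++ u)) ∈
          {ξ | Survives M ξ}ᶜ} := by
    ext ξ
    refine and_congr_right fun hξ => ?_
    rw [Set.mem_ofPred_eq, (hc ξ hξ).survives_iff hp hd, not_exists]
    rfl
  have h4 : labelEvent dep r e =
      {ξ | (∀ w : {w // dep w < r}, ξ (e.place dep w).2 = offCard p {x} w) ∧
        ∀ b : {b // dep b = r}, (fun u => ξ ((e.place dep b).2 ++ u)) ∈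
          (Set.univ : Set (List ℕ → ℕ))} := by
    ext ξ
    simp [labelEvent]
  rw [← h3] at h1
  rw [← h4, probReal_univ, one_pow, mul_one] at h2
  have h5 := measureReal_inter_add_sdiff (μ := gwMeasure) (s := labelEvent dep r e)
    (measurableSet_survives (r + M))
  rw [h2, h1] at h5
  rw [eq_sub_of_add_eq h5, mul_sub, mul_one]
  rfl

theorem gwCondTruncProb_mul_autCard [Fintype W] (hp : IsParentMap p x)
    (hd : IsDepth p x ((parentGraph p).dist x) r) (M : ℕ) :
    gwCondTruncProb (r + M) r (parentGraph p) x * autCard (parentGraph p) x =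
      Real.exp (-{w | (parentGraph p).dist x w < r}.ncard) *
        ((1 - extinctProb M ^ Fintype.card {b // (parentGraph p).dist x b = r}) /
          survProb (r + M)) := by
  have hQ := isSpine_singleton hp ((parentGraph p).dist x)
  set dep := (parentGraph p).dist x with hdep
  have h := measureReal_mul_eq_sum gwMeasure
    (E := fun e : Labelling p {x} => labelEvent dep r e ∩ {ξ | Survives (r + M) ξ})
    (fun e => (measurableSet_labelEvent e).inter (measurableSet_survives _))
    (S := {ξ | Survives (r + M) ξ ∧ TruncationIs (gwTree ξ) (gwRoot ξ) r (parentGraph p) x})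
    (autCard_pos (parentGraph p) x) ?_
  · rw [gwCondTruncProb, div_mul_eq_mul_div, h, measureReal_survives,
      Finset.sum_congr rfl fun e _ => measureReal_labelEvent_inter_survives hp hd e M,
      ← Finset.sum_mul, sum_labelling hd hQ, mul_div_assoc]
    rfl
  · intro ξ
    have h3 := card_fits hp (isParentMap_gwParent ξ) hd.le
    rw [← gwTree_eq ξ, card_fits_gw hp hd ξ, ← Nat.card_congr (compatEquiv hp hd hQ _)] at h3
    by_cases hs : Survives (r + M) ξ
    · simp only [Set.mem_ofPred_eq, hs, true_and]
      rw [← h3]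
      refine Nat.card_congr (Equiv.subtypeEquivRight fun e => ?_)
      exact ⟨fun h w hw => h.1 ⟨w, hw⟩, fun h => ⟨fun w => h w.1 w.2, hs⟩⟩
    · rw [if_neg fun h => hs h.1]
      have : IsEmpty {e : Labelling p {x} // ξ ∈ labelEvent dep r e ∩ {ξ | Survives (r + M) ξ}} :=
        ⟨fun e => hs e.2.2⟩
      exact Nat.card_of_isEmpty

/-- Conditioning on long survival biases the law by the number of vertices at depth `r`, which
matches the choice of the spine end in `𝒫₁`. -/
theorem tendsto_gwCondTruncProb [Fintype W] (hp : IsParentMap p x)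
    (hd : IsDepth p x ((parentGraph p).dist x) r) :
    Tendsto (fun N => gwCondTruncProb N r (parentGraph p) x * autCard (parentGraph p) x) atTop
      (𝓝 (Real.exp (-{w | (parentGraph p).dist x w < r}.ncard) *
        (Fintype.card W - {w | (parentGraph p).dist x w < r}.ncard))) := by
  rw [← tendsto_add_atTop_iff_nat r, ← card_depth_eq hd]
  refine ((tendsto_one_sub_extinctProb_pow_div r _).const_mul _).congr fun M => ?_
  rw [add_comm M r, gwCondTruncProb_mul_autCard hp hd]

end Laws

end UST

end

/-- Let `G n` be a Gino-regular sequence of finite connected graphs (self-edges and parallel edges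
allowed) whose numbers of vertices tend to infinity, and let `v n` be a vertex of `G n`. For every
`r` and every finite rooted tree `(t, x)` of height at most `r`, the probability that the
`r`-truncation at `v n` of a uniform spanning tree of `G n` is `(t, x)` converges to the
probability that the `r`-truncation of `𝒫₁` is `(t, x)`; here `𝒫₁`, the infinite line with
independent Poisson(1) Galton–Watson trees attached, is the limit of the Poisson(1) Galton–Watson
tree conditioned to survive for `N` generations. -/
theorem mainTheorem5 {α β : ℕ → Type*} (G : ∀ n, Graph (α n) (β n))
    (hV : ∀ n, (G n).vertexSet.Finite) (hE : ∀ n, (G n).edgeSet.Finite)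
    (hconn : ∀ n, UST.IsConnected (G n))
    (hsize : Tendsto (fun n => (G n).vertexSet.ncard) atTop atTop)
    (hG : UST.IsGinoRegular G) (v : ∀ n, (G n).vertexSet)
    (r : ℕ) {W : Type*} [Finite W] (t : SimpleGraph W) (x : W)
    (ht : t.IsTree) (hheight : ∀ w, t.dist x w ≤ r) :
    Tendsto (fun n => UST.ustTruncProb (G n) (v n) r t x) atTop (𝓝 (UST.p1TruncProb r t x)) ∧
    Tendsto (fun N => UST.gwCondTruncProb N r t x) atTop (𝓝 (UST.p1TruncProb r t x)) := by
  have := Fintype.ofFinite W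
  obtain ⟨p, hp, rfl, hdist⟩ := UST.exists_eq_parentGraph ht x
  have hd : UST.IsDepth p x ((UST.parentGraph p).dist x) r :=
    ⟨SimpleGraph.dist_self, hdist, hheight⟩
  have hA : (UST.autCard (UST.parentGraph p) x : ℝ) ≠ 0 :=
    Nat.cast_ne_zero.2 (UST.autCard_pos _ x).ne'
  have h1 := UST.tendsto_ustTruncProb G hV hE hconn hsize hG v hp hheight
  have h2 := UST.tendsto_gwCondTruncProb hp hd
  -- Both limits are the same explicit number, the law of `𝒫₁` times the number of automorphisms,
  -- and this nonzero number is divided out.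
  rw [← UST.p1TruncProb_mul_autCard hp hd] at h1 h2
  have h1' := h1.div_const (UST.autCard (UST.parentGraph p) x : ℝ)
  have h2' := h2.div_const (UST.autCard (UST.parentGraph p) x : ℝ)
  simp only [mul_div_cancel_right₀ _ hA] at h1' h2'
  exact ⟨h1', h2'⟩
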